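/- Let $T>0$, let $(\Omega,\mathcal F,\mathbb F=(\mathcal F_t)_{0\le t\le T},\mathbb P)$ be a filtered probability space satisfying the usual conditions, and let $S=(S_t)_{0\le t\le T}$ be a square integrable special semimartingale: $S=M+A$ with $M$ a càdlàg local martingale and $A$ a predictable càdlàg process of finite variation with $A_0=0$, where $\mathbb E[S_t^2]<\infty$ for all $t$ and $\int_0^T\mathbb E[S_t^2]\,dt<\infty$. Let $x\in\mathbb R$, $\lambda>0$, $\varepsilon>0$, $\phi,\varrho\ge 0$, and let the propagator $G$ on $[0,T]$ be either exponential, $G(t)=e^{-\beta t}$ with $\beta>0$, or a power law, $G(t)=(\ell+t)^{-\gamma}$ with either $\ell>0,\ \gamma>0$, or $\ell=0,\ \gamma\in(0,\tfrac12)$. Let $\mathcal U$ be the set of $\mathbb F$-progressively measurable $u$ with $\int_0^T\mathbb E[u_t^2]\,dt<\infty$. For $u\in\mathcal U$ put $X_t=x-\int_0^t u_s\,ds$, $Y_t=\int_0^t G(t-s)u_s\lambda\,ds$ and $$J(u)=\mathbb E\Big[\int_0^T (S_t-Y_t)u_t\,dt-\varepsilon\int_0^T u_t^2\,dt-\phi\int_0^T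 X_t^2\,dt+X_TS_T-\varrho X_T^2\Big].$$ For a kernel $F\in L^2([0,T]^2)$ let $\boldsymbol F$ be the integral operator $(\boldsymbol F g)_t=\int_0^T F(t,s)g_s\,ds$ on $L^2([0,T])$, let $F_t(s,r)=F(s,r)1_{\{r\ge t\}}$, with induced operator $\boldsymbol F_t$ and adjoint operator $\boldsymbol F_t^*$, and let $\langle\cdot,\cdot\rangle$ be the inner product of $L^2([0,T])$. Put $$K(t,s)=\big(2\varrho+2\phi(T-t)+\lambda G(t-s)\big)1_{\{s\le t\}},\qquad \boldsymbol D_t=2\varepsilon\,\mathrm{id}+\boldsymbol K_t+\boldsymbol K_t^*,$$ $$B(t,s)=1_{\{s\le t\}}\frac1{2\varepsilon}\Big(\big\langle 1_{\{t\le\cdot\}}K(\cdot,t),\ \boldsymbol D_t^{-1}1_{\{t\le\cdot\}}K(\cdot,s)\big\rangle-K(t,s)\Big),$$ $$b_t=\mathbb E[S_t-S_T\mid\mathcal F_t]+2\big(\phi(T-t)+\varrho\big)x,$$ $$a_t=\frac1{2\varepsilon}\Big(b_t-\big\langle 1_{\{t\le\cdot\}}K(\cdot,t),\ \boldsymbol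 D_t^{-1}1_{\{t\le\cdot\}}\mathbb E[b_\cdot\mid\mathcal F_t]\big\rangle\Big).$$ Then the random variable inside the expectation defining $J(u)$ is well defined and integrable for every $u\in\mathcal U$. Moreover $K\in L^2([0,T]^2)$, and for all $s,t\in[0,T]$ the function $K(\cdot,s)$ belongs to $L^2([0,T])$, the operator $\boldsymbol D_t$ is invertible on $L^2([0,T])$, and $B(t,\cdot)\in L^2([0,T])$. The processes $a$ and $b$ have progressively measurable versions with $\int_0^T\mathbb E[a_t^2+b_t^2]\,dt<\infty$. Finally, there is a strategy $u^\star\in\mathcal U$ which maximises $J$ over $\mathcal U$, it is unique up to $dt\otimes\mathbb P$-null sets, and (for a suitable version) it satisfies $$u^\star_t=a_t+\int_0^t B(t,s)u^\star_s\,ds\quad\text{almost surely, for every }t\in[0,T];$$ conversely, any $v\in\mathcal U$ which satisfies this equation $dt\otimes\mathbb P$-almost everywhere equals $u^\star$ up to $dt\otimes\mathbb P$-null sets. -/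

import Mathlib

open MeasureTheory ProbabilityTheory Set Filter Topology
open scoped ENNReal

namespace LinearPropagator

/-! ### The space `L²([0,T])` and kernel-induced integral operators -/

/-- The time interval `[0,T]`, carrying Lebesgue measure `volume`. -/
abbrev Time (T : ℝ) : Type := Set.Icc (0 : ℝ) T

noncomputable instance instMeasureSpaceTime (T : ℝ) : MeasureSpace (Time T) :=
  Measure.Subtype.measureSpace

/-- The Hilbert space `L²([0,T], ℝ)`. -/
abbrev L2 (T : ℝ) : Type := Lp ℝ 2 (volume : Measure (Time T))

open scoped Classical in
/-- The class in `L²([0,T])` of a square integrable function (and `0` for any other function). -/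
noncomputable def toL2 {T : ℝ} (f : Time T → ℝ) : L2 T :=
  if h : MemLp f 2 (volume : Measure (Time T)) then h.toLp f else 0

/-- `F ∈ L²([0,T]²)`. -/
def SqIntKernel {T : ℝ} (F : Time T → Time T → ℝ) : Prop :=
  MemLp (Function.uncurry F) 2 ((volume : Measure (Time T)).prod (volume : Measure (Time T)))

instance instFiniteTime (T : ℝ) : IsFiniteMeasure (volume : Measure (Time T)) := by
  refine ⟨?_⟩
  rw [Measure.Subtype.volume_univ measurableSet_Icc.nullMeasurableSet, Real.volume_Icc]
  exact ENNReal.ofReal_lt_top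

lemma SqIntKernel.memLp_section {T : ℝ} {F : Time T → Time T → ℝ} (hF : SqIntKernel F) :
    ∀ᵐ t : Time T, MemLp (F t) 2 (volume : Measure (Time T)) := by
  have h1 := hF.1.prodMk_left
  have h2 := ((memLp_two_iff_integrable_sq hF.1).1 hF).prod_right_ae
  filter_upwards [h1, h2] with t ht1 ht2
  exact (memLp_two_iff_integrable_sq ht1).2 ht2

/-- Cauchy-Schwarz for one section of the kernel. -/
lemma abs_integral_mul_le {T : ℝ} {f : Time T → ℝ} (hf : MemLp f 2 (volume : Measure (Time T)))
    (g : L2 T) :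
    (∫ s, f s * g s) ^ 2 ≤ (∫ s, f s ^ 2) * ‖g‖ ^ 2 := by
  have h1 : ∫ s, f s * g s = inner ℝ (hf.toLp f) g := by
    rw [L2.inner_def]
    apply integral_congr_ae
    filter_upwards [hf.coeFn_toLp] with s hs
    simp [hs, mul_comm]
  have h2 : ∫ s, f s ^ 2 = ‖hf.toLp f‖ ^ 2 := by
    rw [← real_inner_self_eq_norm_sq, L2.inner_def]
    apply integral_congr_ae
    filter_upwards [hf.coeFn_toLp] with s hs
    simp [hs, sq]
  rw [h1, h2, ← mul_pow, ← sq_abs]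
  exact pow_le_pow_left₀ (abs_nonneg _) (abs_real_inner_le_norm _ _) 2

lemma SqIntKernel.memLp_integral {T : ℝ} {F : Time T → Time T → ℝ} (hF : SqIntKernel F)
    (g : L2 T) : MemLp (fun t => ∫ s, F t s * g s) 2 (volume : Measure (Time T)) := by
  have hm : AEStronglyMeasurable (fun t => ∫ s, F t s * g s) (volume : Measure (Time T)) := by
    have : AEStronglyMeasurable (fun p : Time T × Time T => F p.1 p.2 * g p.2)
        ((volume : Measure (Time T)).prod (volume : Measure (Time T))) :=
      hF.1.mul (Lp.aestronglyMeasurable g).comp_snd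
    exact this.integral_prod_right'
  rw [memLp_two_iff_integrable_sq hm]
  have hi : Integrable (fun t => (∫ s, F t s ^ 2) * ‖g‖ ^ 2) (volume : Measure (Time T)) :=
    (((memLp_two_iff_integrable_sq hF.1).1 hF).integral_prod_left).mul_const _
  refine hi.mono' (hm.pow 2) ?_
  filter_upwards [hF.memLp_section] with t ht
  rw [Real.norm_of_nonneg (sq_nonneg _)]
  exact abs_integral_mul_le ht g

lemma SqIntKernel.norm_toLp_le {T : ℝ} {F : Time T → Time T → ℝ} (hF : SqIntKernel F)
    (g : L2 T) :
    ‖(hF.memLp_integral g).toLp _‖ ≤ Real.sqrt (∫ t, ∫ s, F t s ^ 2) * ‖g‖ := by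
  have h0 : 0 ≤ ∫ t, ∫ s, F t s ^ 2 :=
    integral_nonneg fun t => integral_nonneg fun s => sq_nonneg _
  refine abs_le_of_sq_le_sq' ?_ (by positivity) |>.2
  rw [mul_pow, Real.sq_sqrt h0, ← real_inner_self_eq_norm_sq, L2.inner_def]
  have hi : Integrable (fun t => (∫ s, F t s ^ 2) * ‖g‖ ^ 2) (volume : Measure (Time T)) :=
    (((memLp_two_iff_integrable_sq hF.1).1 hF).integral_prod_left).mul_const _
  rw [← integral_mul_const]
  refine integral_mono_ae (L2.integrable_inner _ _) hi ?_
  filter_upwards [hF.memLp_section, (hF.memLp_integral g).coeFn_toLp] with t ht h2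
  have := abs_integral_mul_le ht g
  simpa [h2, sq] using this

open scoped Classical in
/-- The integral operator `(𝑭 g)(t) = ∫₀ᵀ F(t,s) g(s) ds` on `L²([0,T])` induced by a kernel
`F ∈ L²([0,T]²)` (and `0` for any other kernel). -/
noncomputable def kernelOp {T : ℝ} (F : Time T → Time T → ℝ) : L2 T →L[ℝ] L2 T :=
  if hF : SqIntKernel F then
    LinearMap.mkContinuous
      { toFun := fun g => (hF.memLp_integral g).toLp (fun t => ∫ s, F t s * g s)
        map_add' := by
          intro g h
          rw [← MemLp.toLp_add, MemLp.toLp_eq_toLp_iff]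
          filter_upwards [hF.memLp_section] with t ht
          simp only [Pi.add_apply]
          have hg : Integrable (fun s => F t s * g s) := ht.integrable_mul (Lp.memLp g)
          have hh : Integrable (fun s => F t s * h s) := ht.integrable_mul (Lp.memLp h)
          rw [← integral_add hg hh]
          apply integral_congr_ae
          filter_upwards [Lp.coeFn_add g h] with s hs
          calc F t s * (g + h : L2 T) s = F t s * (g s + h s) := congrArg (F t s * ·) hs
            _ = F t s * g s + F t s * h s := mul_add _ _ _
        map_smul' := by
          intro c g
          rw [RingHom.id_apply, ← MemLp.toLp_const_smul, MemLp.toLp_eq_toLp_iff]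
          refine Eventually.of_forall fun t => ?_
          simp only [Pi.smul_apply, smul_eq_mul]
          rw [← integral_const_mul]
          apply integral_congr_ae
          filter_upwards [Lp.coeFn_smul c g] with s hs
          calc F t s * (c • g : L2 T) s = F t s * (c * g s) := congrArg (F t s * ·) hs
            _ = c * (F t s * g s) := mul_left_comm _ _ _ }
      (Real.sqrt (∫ t, ∫ s, F t s ^ 2)) (fun g => hF.norm_toLp_le g)
  else 0

/-! ### Stochastic basis and the unaffected price -/

variable {Ω : Type*} {mΩ : MeasurableSpace Ω} {T : ℝ}

/-- The usual conditions: the filtration is right-continuous, and the initial σ-algebra contains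
every null set. -/
structure UsualConditions [Fact (0 ≤ T)] (𝓕 : Filtration (Time T) mΩ) (P : Measure Ω) : Prop where
  rightContinuous : 𝓕.IsRightContinuous
  complete : ∀ N : Set Ω, P N = 0 → MeasurableSet[𝓕 ⊥] N

/-- Right-continuous with left limits. -/
def IsCadlag (f : Time T → ℝ) : Prop :=
  ∀ t, ContinuousWithinAt f (Ici t) t ∧ ∃ l, Tendsto f (𝓝[<] t) (𝓝 l)

/-- `S` is a special semimartingale: `S = M + A` with a càdlàg local martingale `M` and a
predictable càdlàg process `A` of finite variation which starts from `0`. -/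
def IsSpecialSemimartingale [Fact (0 ≤ T)] (𝓕 : Filtration (Time T) mΩ) (P : Measure Ω)
    (S : Time T → Ω → ℝ) : Prop :=
  ∃ M A : Time T → Ω → ℝ,
    StronglyAdapted 𝓕 M ∧ (∀ ω, IsCadlag (fun t => M t ω)) ∧
    Locally (fun Y : Time T → Ω → ℝ => Martingale Y 𝓕 P) 𝓕 M P ∧
    IsStronglyPredictable 𝓕 A ∧ (∀ ω, IsCadlag (fun t => A t ω)) ∧ (∀ ω, A ⊥ ω = 0) ∧
    (∀ ω, BoundedVariationOn (fun t => A t ω) univ) ∧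
    ∀ t ω, S t ω = M t ω + A t ω

/-- `∫₀ᵀ E[u_t²] dt < ∞`. -/
def SqIntProcess (P : Measure Ω) (u : Time T → Ω → ℝ) : Prop :=
  ∫⁻ t : Time T, ∫⁻ ω, ‖u t ω‖ₑ ^ 2 ∂P < ∞

/-- Square integrable special semimartingale. Square integrability is asked for only in the weak
form `E[S_t²] < ∞` for all `t` and `∫₀ᵀ E[S_t²] dt < ∞`, which is implied for instance by
`E[sup_t S_t²] < ∞`, or by `E[[M]_T] + E[(∫₀ᵀ |dA_s|)²] < ∞` and `E[S_0²] < ∞`. -/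
structure IsSqIntSpecialSemimartingale [Fact (0 ≤ T)] (𝓕 : Filtration (Time T) mΩ)
    (P : Measure Ω) (S : Time T → Ω → ℝ) : Prop where
  special : IsSpecialSemimartingale 𝓕 P S
  memLp : ∀ t, MemLp (S t) 2 P
  sqInt : SqIntProcess P S

/-! ### Price impact and the objective functional -/

/-- Propagators on `[0,T]`: exponential kernels `e^{-βt}` and power-law kernels `(ℓ+t)^{-γ}`,
non-singular (`ℓ > 0`, `γ > 0`) or singular (`ℓ = 0`, `0 < γ < 1/2`). -/
def IsPropagator (T : ℝ) (G : ℝ → ℝ) : Prop :=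
  (∃ β : ℝ, 0 < β ∧ ∀ t ∈ Icc 0 T, G t = Real.exp (-β * t)) ∨
  (∃ l γ : ℝ, 0 < l ∧ 0 < γ ∧ ∀ t ∈ Icc 0 T, G t = 1 / (l + t) ^ γ) ∨
  (∃ γ : ℝ, 0 < γ ∧ γ < 1 / 2 ∧ ∀ t ∈ Icc 0 T, G t = 1 / t ^ γ)

/-- The inventory `X_t = x - ∫₀ᵗ u_s ds` along a path `u`. -/
noncomputable def inventory (x : ℝ) (u : Time T → ℝ) (t : Time T) : ℝ :=
  x - ∫ s in Iic t, u s

/-- The transient price impact `Y_t = ∫₀ᵗ G(t-s) u_s λ ds` along a path `u`. -/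
noncomputable def impact (G : ℝ → ℝ) (lam : ℝ) (u : Time T → ℝ) (t : Time T) : ℝ :=
  ∫ s : Time T in Iic t, G ((t : ℝ) - s) * u s * lam

/-- The set `𝓤` of admissible strategies: progressively measurable selling rates with
`∫₀ᵀ E[u_t²] dt < ∞`. -/
def Admissible (𝓕 : Filtration (Time T) mΩ) (P : Measure Ω) (u : Time T → Ω → ℝ) : Prop :=
  IsStronglyProgressive 𝓕 u ∧ SqIntProcess P u

/-- The random variable whose expectation is the objective, on a path `S` of the unaffected price
and a path `u` of the strategy. -/
noncomputable def payoff [Fact (0 ≤ T)] (G : ℝ → ℝ) (x lam ε φ ϱ : ℝ) (S u : Time T → ℝ) : ℝ :=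
  (∫ t, (S t - impact G lam u t) * u t) - ε * (∫ t, u t ^ 2) - φ * (∫ t, inventory x u t ^ 2)
    + inventory x u ⊤ * S ⊤ - ϱ * inventory x u ⊤ ^ 2

/-- All the integrals along a path which enter `payoff` converge. -/
structure PathwiseIntegrable (G : ℝ → ℝ) (x lam : ℝ) (S u : Time T → ℝ) : Prop where
  strategy : MemLp u 2 (volume : Measure (Time T))
  impactIntegrand : ∀ t : Time T, IntegrableOn (fun s : Time T => G ((t : ℝ) - s) * u s * lam) (Iic t)
  gains : Integrable (fun t => (S t - impact G lam u t) * u t)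
  inventory : Integrable (fun t => inventory x u t ^ 2)

/-- The objective functional `J(u)`. -/
noncomputable def J [Fact (0 ≤ T)] (P : Measure Ω) (G : ℝ → ℝ) (x lam ε φ ϱ : ℝ)
    (S u : Time T → Ω → ℝ) : ℝ :=
  ∫ ω, payoff G x lam ε φ ϱ (fun t => S t ω) (fun t => u t ω) ∂P

/-- `u` maximises `J` over `𝓤`. -/
def IsOptimal [Fact (0 ≤ T)] (𝓕 : Filtration (Time T) mΩ) (P : Measure Ω) (G : ℝ → ℝ)
    (x lam ε φ ϱ : ℝ) (S u : Time T → Ω → ℝ) : Prop :=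
  Admissible 𝓕 P u ∧
    ∀ v, Admissible 𝓕 P v → J P G x lam ε φ ϱ S v ≤ J P G x lam ε φ ϱ S u

/-! ### The data of the Volterra equation -/

/-- The kernel `C̃ = 2ϱ 1_{s ≤ t} + 2φ(T-t) 1_{s ≤ t}`. -/
noncomputable def kernelC (φ ϱ : ℝ) (t s : Time T) : ℝ :=
  if s ≤ t then 2 * ϱ + 2 * φ * (T - t) else 0

/-- The kernel `K(t,s) = C̃ + λ G(t-s) 1_{s ≤ t}`. -/
noncomputable def kernelK (G : ℝ → ℝ) (lam φ ϱ : ℝ) (t s : Time T) : ℝ :=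
  kernelC φ ϱ t s + if s ≤ t then lam * G ((t : ℝ) - s) else 0

/-- The truncated kernel `F_t(s,r) = F(s,r) 1_{r ≥ t}`. -/
noncomputable def truncKernel (F : Time T → Time T → ℝ) (t : Time T) (s r : Time T) : ℝ :=
  if t ≤ r then F s r else 0

/-- The adjoint kernel `F*(s,r) = F(r,s)`. -/
def adjKernel (F : Time T → Time T → ℝ) (s r : Time T) : ℝ := F r s

/-- The operator `𝑫_t = 2ε id + 𝑲_t + 𝑲_t*` on `L²([0,T])`. -/
noncomputable def opD (G : ℝ → ℝ) (lam ε φ ϱ : ℝ) (t : Time T) : L2 T →L[ℝ] L2 T :=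
  (2 * ε) • ContinuousLinearMap.id ℝ (L2 T) + kernelOp (truncKernel (kernelK G lam φ ϱ) t)
    + kernelOp (adjKernel (truncKernel (kernelK G lam φ ϱ) t))

/-- `𝑫_t⁻¹` (with value `0` if `𝑫_t` is not invertible). -/
noncomputable def invD (G : ℝ → ℝ) (lam ε φ ϱ : ℝ) (t : Time T) : L2 T →L[ℝ] L2 T :=
  Ring.inverse (opD G lam ε φ ϱ t)

/-- The function `r ↦ 1_{t ≤ r} f(r)`. -/
noncomputable def cutoff (t : Time T) (f : Time T → ℝ) (r : Time T) : ℝ :=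
  if t ≤ r then f r else 0

/-- The scalar `⟨1_{t ≤ ·} K(·,t), 𝑫_t⁻¹ 1_{t ≤ ·} f⟩`. -/
noncomputable def pairing (G : ℝ → ℝ) (lam ε φ ϱ : ℝ) (t : Time T) (f : Time T → ℝ) : ℝ :=
  inner ℝ (toL2 (cutoff t fun r => kernelK G lam φ ϱ r t))
    (invD G lam ε φ ϱ t (toL2 (cutoff t f)))

/-- The kernel
`B(t,s) = 1_{s ≤ t} (2ε)⁻¹ (⟨1_{t ≤ ·} K(·,t), 𝑫_t⁻¹ 1_{t ≤ ·} K(·,s)⟩ - K(t,s))`. -/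
noncomputable def kernelB (G : ℝ → ℝ) (lam ε φ ϱ : ℝ) (t s : Time T) : ℝ :=
  if s ≤ t then
    1 / (2 * ε) * (pairing G lam ε φ ϱ t (fun r => kernelK G lam φ ϱ r s) - kernelK G lam φ ϱ t s)
  else 0

/-- `b` is a progressively measurable version of the process
`b_t = E[S_t - S_T | 𝓕_t] + 2(φ(T-t) + ϱ)x`. -/
def IsProcessB [Fact (0 ≤ T)] (𝓕 : Filtration (Time T) mΩ) (P : Measure Ω)
    (x φ ϱ : ℝ) (S b : Time T → Ω → ℝ) : Prop :=
  IsStronglyProgressive 𝓕 b ∧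
    ∀ t : Time T, b t =ᵐ[P] fun ω => (P[S t - S ⊤ | 𝓕 t]) ω + 2 * (φ * (T - t) + ϱ) * x

/-- For fixed `t`, `β` is a jointly measurable version of `s ↦ E[b_s | 𝓕_t]` on `[t,T]`. Only its
paths as classes in `L²([0,T])` are used below, so versions are taken for almost every `s`. -/
def IsCondVersion (𝓕 : Filtration (Time T) mΩ) (P : Measure Ω) (b : Time T → Ω → ℝ)
    (t : Time T) (β : Time T → Ω → ℝ) : Prop :=
  Measurable (Function.uncurry β) ∧ ∀ᵐ s : Time T, t ≤ s → β s =ᵐ[P] P[b s | 𝓕 t]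

/-- `a` is a progressively measurable version of the process
`a_t = (2ε)⁻¹ (b_t - ⟨1_{t ≤ ·} K(·,t), 𝑫_t⁻¹ 1_{t ≤ ·} E[b_· | 𝓕_t]⟩)`. -/
def IsProcessA (𝓕 : Filtration (Time T) mΩ) (P : Measure Ω) (G : ℝ → ℝ) (lam ε φ ϱ : ℝ)
    (b a : Time T → Ω → ℝ) : Prop :=
  IsStronglyProgressive 𝓕 a ∧
    ∀ t : Time T, ∃ β, IsCondVersion 𝓕 P b t β ∧
      ∀ᵐ ω ∂P, MemLp (cutoff t fun s => β s ω) 2 (volume : Measure (Time T)) ∧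
        a t ω = 1 / (2 * ε) * (b t ω - pairing G lam ε φ ϱ t (fun s => β s ω))

/-- Equality of processes up to `dt ⊗ P`-null sets. -/
def ProcessEq (P : Measure Ω) (u v : Time T → Ω → ℝ) : Prop :=
  ∀ᵐ p ∂((volume : Measure (Time T)).prod P), u p.1 p.2 = v p.1 p.2

end LinearPropagator

open LinearPropagator

/-! Pathwise the payoff is a quadratic functional of the strategy (`payoff_eq`): up to a term free
of `u` it equals `⟨p, u⟩ - ½⟨(2ε id + 𝑲 + 𝑲*)u, u⟩`, where `p` is the anticipating signal `S_t - S_T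
+ 2(φ(T-t) + ϱ)x`. The kernel `K` is of positive type. Its inventory part contributes sums of
squares, and the propagator is an exponential or, through the Gamma integral, a positive mixture of
exponentials (`integral_mixture_nonneg`). Hence `2ε id + 𝑲 + 𝑲*` and all the operators `𝑫_t` are
coercive with constant `2ε`.

Progressive processes form a closed subspace of `L²(dt ⊗ P)`, so Lax-Milgram on that subspace gives
`u` with `E⟨(2ε id + 𝑲 + 𝑲*)u, h⟩ = E⟨b, h⟩` for every admissible `h`
(`exists_first_order_condition`). Here `b` may replace `p` because it is the optional projection of
`p`. Completing the square yields `J(v) + ε E‖v - u‖² ≤ J(u)`, which gives optimality and uniqueness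
together.

The Volterra form comes from eliminating the future of `u`. Projected on `𝓕_t`, the first order
condition reads `2ε u_t + E[∫ (K(t,s) + K(s,t)) u_s ds | 𝓕_t] = b_t`. Take `ψ = 𝑫_t⁻¹ 1_{t ≤ ·}
K(·,t)`, the `costate`. It vanishes before `t`, and `2ε id + 𝑲 + 𝑲*` maps it to `K(·,t)` plus a
function carried by `[0,t)` (`coeFn_symmOp_costate`). Testing the first order condition with `1_E
ψ`, `E ∈ 𝓕_t`, therefore expresses the conditional expectation of `∫ K(s,t) u_s ds` through `E[⟨ψ,
b⟩ | 𝓕_t]` and the past of `u`; this is the equation with kernel `B` (`exists_volterra_solution`).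
The rows of `B` are uniformly bounded in `L²`, so a Gronwall argument shows that the equation has at
most one square integrable solution.

The remaining work is measurability: conditional expectations `E[η_t | 𝓕_t]` need versions that are
progressive in `t` and correct at every `t`, which
`exists_progressive_condExp_of_stronglyMeasurable` provides. -/

namespace LinearPropagator

/-! ### Progressive measurability as measurability for a single σ-algebra. -/

section ProgressiveSigma

variable {Ω : Type*} {mΩ : MeasurableSpace Ω} {T : ℝ}

/-- The progressive σ-algebra on `[0,T] × Ω`. -/
@[reducible] def progSigma (𝓕 : Filtration (Time T) mΩ) : MeasurableSpace (Time T × Ω) :=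
  ⨅ i : Time T, MeasurableSpace.map (fun p : Iic i × Ω => ((p.1 : Time T), p.2))
    (Subtype.instMeasurableSpace.prod (𝓕 i))

lemma measurableSet_progSigma {𝓕 : Filtration (Time T) mΩ} {E : Set (Time T × Ω)} :
    MeasurableSet[progSigma 𝓕] E ↔ ∀ i : Time T,
      MeasurableSet[Subtype.instMeasurableSpace.prod (𝓕 i)]
        ((fun p : Iic i × Ω => ((p.1 : Time T), p.2)) ⁻¹' E) := by
  rw [progSigma, MeasurableSpace.measurableSet_iInf]
  rfl

lemma isStronglyProgressive_iff {𝓕 : Filtration (Time T) mΩ} {u : Time T → Ω → ℝ} :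
    IsStronglyProgressive 𝓕 u ↔ Measurable[progSigma 𝓕] (Function.uncurry u) := by
  constructor
  · intro h E hE
    exact measurableSet_progSigma.2 fun i => (h i).measurable hE
  · intro h i
    refine Measurable.stronglyMeasurable ?_
    intro E hE
    exact measurableSet_progSigma.1 (h hE) i

/-- The constraint at the final time alone already forces joint measurability, since there the
restricted time set is all of `[0,T]`. -/
lemma progSigma_le [Fact (0 ≤ T)] (𝓕 : Filtration (Time T) mΩ) :
    progSigma 𝓕 ≤ (inferInstance : MeasurableSpace (Time T × Ω)) := by
  intro E hE
  have h := measurableSet_progSigma.1 hE ⊤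
  have hm : @Measurable _ _ _ (Subtype.instMeasurableSpace.prod (𝓕 ⊤))
      (fun p : Time T × Ω => ((⟨p.1, (le_top : p.1 ≤ ⊤)⟩ : Iic (⊤ : Time T)), p.2)) := by
    refine Measurable.prodMk (measurable_fst.subtype_mk) ?_
    exact measurable_snd.mono le_rfl (𝓕.le ⊤)
  exact hm h

lemma measurable_fst_progSigma (𝓕 : Filtration (Time T) mΩ) :
    Measurable[progSigma 𝓕] (Prod.fst : Time T × Ω → Time T) := by
  intro E hE
  refine measurableSet_progSigma.2 fun i => ?_
  exact (measurable_subtype_coe.comp measurable_fst) hE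

/-- Restricted to times before `σ` the rectangle is empty; from `σ` on, `C` has become an event of
the current σ-algebra. -/
lemma measurableSet_progSigma_prod {𝓕 : Filtration (Time T) mΩ} {σ : Time T} {A : Set (Time T)}
    (hA : MeasurableSet A) (hσ : ∀ t ∈ A, σ ≤ t) {C : Set Ω} (hC : MeasurableSet[𝓕 σ] C) :
    MeasurableSet[progSigma 𝓕] (A ×ˢ C) := by
  refine measurableSet_progSigma.2 fun i => ?_
  by_cases hi : σ ≤ i
  · exact @MeasurableSet.prod _ _ _ (𝓕 i) _ _ (measurable_subtype_coe hA) (𝓕.mono hi _ hC)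
  · convert @MeasurableSet.empty _ (Subtype.instMeasurableSpace.prod (𝓕 i))
    ext p
    simp only [mem_preimage, mem_prod, mem_empty_iff_false, iff_false, not_and]
    intro hp
    exact (hi ((hσ _ hp).trans p.1.2)).elim

/-- Sampling an adapted process at an earlier time with countably many values decomposes every
preimage into countably many progressive rectangles. Adaptedness suffices and no path regularity is
needed. The set `N` allows the same lemma to treat a countable exceptional set of times. -/
lemma measurable_progSigma_comp {𝓕 : Filtration (Time T) mΩ} {τ : Time T → Time T}
    (hτ : Measurable τ) (hc : (range τ).Countable) {N : Set (Time T)} (hN : MeasurableSet N)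
    (hle : ∀ t ∈ N, τ t ≤ t)
    {g : Time T → Ω → ℝ} (hg : StronglyAdapted 𝓕 g) :
    Measurable[progSigma 𝓕] (fun p : Time T × Ω => N.indicator (fun t => g (τ t) p.2) p.1) := by
  have key : ∀ E : Set ℝ, MeasurableSet E → MeasurableSet[progSigma 𝓕]
      {p : Time T × Ω | p.1 ∈ N ∧ g (τ p.1) p.2 ∈ E} := by
    intro E hE
    have : {p : Time T × Ω | p.1 ∈ N ∧ g (τ p.1) p.2 ∈ E}
        = ⋃ σ ∈ range τ, (N ∩ τ ⁻¹' {σ}) ×ˢ (g σ ⁻¹' E) := by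
      ext p
      simp only [mem_ofPred_eq, mem_iUnion, mem_prod, mem_inter_iff, mem_preimage,
        mem_singleton_iff, exists_prop]
      constructor
      · rintro ⟨h1, h2⟩
        exact ⟨τ p.1, ⟨_, rfl⟩, ⟨h1, rfl⟩, h2⟩
      · rintro ⟨σ, -, ⟨h1, h2⟩, h3⟩
        subst h2
        exact ⟨h1, h3⟩
    rw [this]
    refine @MeasurableSet.biUnion _ _ (progSigma 𝓕) _ _ hc fun σ _ => ?_
    refine measurableSet_progSigma_prod (σ := σ) (hN.inter (hτ (measurableSet_singleton σ))) ?_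
      ((hg σ).measurable hE)
    rintro t ⟨h1, h2⟩
    rw [← (h2 : τ t = σ)]
    exact hle t h1
  intro E hE
  have h1 := measurable_fst_progSigma 𝓕 hN
  have : (fun p : Time T × Ω => N.indicator (fun t => g (τ t) p.2) p.1) ⁻¹' E
      = {p : Time T × Ω | p.1 ∈ N ∧ g (τ p.1) p.2 ∈ E} ∪
        ((Prod.fst ⁻¹' N)ᶜ ∩ {_p | (0:ℝ) ∈ E}) := by
    ext p
    by_cases hp : p.1 ∈ N <;> simp [hp]
  rw [this]
  exact @MeasurableSet.union _ (progSigma 𝓕) _ _ (key E hE)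
    (@MeasurableSet.inter _ (progSigma 𝓕) _ _ (@MeasurableSet.compl _ _ (progSigma 𝓕) h1)
      (@MeasurableSet.const _ (progSigma 𝓕) _))

lemma measurable_uncurry_of_progressive [Fact (0 ≤ T)] {𝓕 : Filtration (Time T) mΩ}
    {u : Time T → Ω → ℝ} (h : IsStronglyProgressive 𝓕 u) : Measurable (Function.uncurry u) :=
  (isStronglyProgressive_iff.1 h).mono (progSigma_le 𝓕) le_rfl

end ProgressiveSigma

/-! ### Jointly measurable functions as strongly measurable maps into L². -/

section StronglyMeasurableSections

variable {Ω X : Type*} {mΩ : MeasurableSpace Ω} [MeasurableSpace X]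

/-- Dominated convergence in `L²`. -/
lemma tendsto_toLp_of_dominated {P : Measure Ω} {f : ℕ → Ω → ℝ} {g h : Ω → ℝ}
    (hf : ∀ n, MemLp (f n) 2 P) (hg : MemLp g 2 P) (hh : MemLp h 2 P)
    (hle : ∀ n, ∀ᵐ ω ∂P, ‖f n ω‖ ≤ h ω)
    (hlim : ∀ᵐ ω ∂P, Tendsto (fun n => f n ω) atTop (𝓝 (g ω))) :
    Tendsto (fun n => (hf n).toLp (f n)) atTop (𝓝 (hg.toLp g)) := by
  rw [Lp.tendsto_Lp_iff_tendsto_eLpNorm'']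
  have hsq : ∀ n, eLpNorm (f n - g) 2 P = (∫⁻ ω, ‖f n ω - g ω‖ₑ ^ (2:ℝ) ∂P) ^ (1 / (2:ℝ)) := by
    intro n
    rw [eLpNorm_eq_lintegral_rpow_enorm_toReal (by norm_num) (by norm_num)]
    simp
  simp_rw [hsq]
  have hzero : (0 : ℝ≥0∞) = 0 ^ (1 / (2:ℝ)) := by simp
  rw [hzero]
  refine ((ENNReal.continuous_rpow_const).tendsto _).comp ?_
  have h0 : (0 : ℝ≥0∞) = ∫⁻ _, 0 ∂P := by simp
  rw [h0]
  have hhg := (hh.add hg.norm)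
  refine tendsto_lintegral_of_dominated_convergence' (fun ω => ‖h ω + ‖g ω‖‖ₑ ^ (2:ℝ)) ?_ ?_ ?_ ?_
  · intro n
    exact (((hf n).1.sub hg.1).enorm).pow_const _
  · intro n
    filter_upwards [hle n] with ω hω
    refine ENNReal.rpow_le_rpow ?_ (by norm_num)
    refine enorm_le_iff_norm_le.2 ?_
    calc ‖f n ω - g ω‖ ≤ ‖f n ω‖ + ‖g ω‖ := norm_sub_le _ _
      _ ≤ h ω + ‖g ω‖ := by gcongr
      _ ≤ ‖h ω + ‖g ω‖‖ := le_abs_self _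
  · have := lintegral_rpow_enorm_lt_top_of_eLpNorm_lt_top (by norm_num) (by norm_num) hhg.2
    simpa using this.ne
  · filter_upwards [hlim] with ω hω
    have h1 : Tendsto (fun n => ‖f n ω - g ω‖ₑ ^ (2:ℝ)) atTop (𝓝 (‖g ω - g ω‖ₑ ^ (2:ℝ))) :=
      ((ENNReal.continuous_rpow_const).tendsto _).comp
        ((continuous_enorm.tendsto _).comp (hω.sub_const _))
    simpa using h1

/-- Functions with square integrable sections which are strongly measurable with values in `L²`. -/
def StronglyMeasurableSections (P : Measure Ω) (f : X → Ω → ℝ) : Prop :=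
  ∃ h : ∀ x, MemLp (f x) 2 P, StronglyMeasurable fun x => (h x).toLp (f x)

lemma StronglyMeasurableSections.add {P : Measure Ω} {f g : X → Ω → ℝ}
    (hf : StronglyMeasurableSections P f) (hg : StronglyMeasurableSections P g) :
    StronglyMeasurableSections P (fun x => f x + g x) := by
  obtain ⟨h1, h2⟩ := hf
  obtain ⟨h3, h4⟩ := hg
  exact ⟨fun x => (h1 x).add (h3 x), h2.add h4⟩

lemma StronglyMeasurableSections.const_smul {P : Measure Ω} {f : X → Ω → ℝ}
    (hf : StronglyMeasurableSections P f) (c : ℝ) :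
    StronglyMeasurableSections P (fun x => c • f x) := by
  obtain ⟨h1, h2⟩ := hf
  exact ⟨fun x => (h1 x).const_smul c, h2.const_smul c⟩

lemma StronglyMeasurableSections.of_tendsto {P : Measure Ω} {f : ℕ → X → Ω → ℝ} {g h : X → Ω → ℝ}
    (hf : ∀ n, StronglyMeasurableSections P (f n)) (hg : ∀ x, MemLp (g x) 2 P)
    (hh : ∀ x, MemLp (h x) 2 P) (hle : ∀ n x ω, ‖f n x ω‖ ≤ h x ω)
    (hlim : ∀ x ω, Tendsto (fun n => f n x ω) atTop (𝓝 (g x ω))) :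
    StronglyMeasurableSections P g := by
  choose h1 h2 using hf
  refine ⟨hg, stronglyMeasurable_of_tendsto atTop h2 ?_⟩
  rw [tendsto_pi_nhds]
  intro x
  exact tendsto_toLp_of_dominated (fun n => h1 n x) (hg x) (hh x)
    (fun n => ae_of_all _ (hle n x)) (ae_of_all _ (hlim x))

lemma stronglyMeasurableSections_indicator_const {P : Measure Ω} {A : Set X}
    (hA : MeasurableSet A) {g : Ω → ℝ} (hg : MemLp g 2 P) :
    StronglyMeasurableSections P (A.indicator fun _ => g) := by
  have hz : MemLp (0 : Ω → ℝ) 2 P := MemLp.zero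
  have hm : ∀ x, MemLp (A.indicator (fun _ => g) x) 2 P := by
    intro x
    by_cases hx : x ∈ A <;> simp only [hx, not_false_eq_true, indicator_of_mem,
      indicator_of_notMem, hg, hz]
  refine ⟨hm, ?_⟩
  have : (fun x => (hm x).toLp _) = A.indicator fun _ => hg.toLp g := by
    funext x
    by_cases hx : x ∈ A
    · refine Eq.trans ?_ (indicator_of_mem hx _).symm
      exact MemLp.toLp_congr _ _ (ae_of_all _ fun ω => by rw [indicator_of_mem hx])
    · refine Eq.trans ?_ (indicator_of_notMem hx _).symm
      rw [← MemLp.toLp_zero hz]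
      exact MemLp.toLp_congr _ _ (ae_of_all _ fun ω => by rw [indicator_of_notMem hx])
  rw [this]
  exact stronglyMeasurable_const.indicator hA

/-- A Dynkin class argument from measurable rectangles. Strong measurability is preserved under
sums, scalings and dominated limits; the last handles countable disjoint unions, with dominating
function `1`, which is square integrable because `P` is finite. -/
lemma stronglyMeasurableSections_indicator {P : Measure Ω} [IsFiniteMeasure P] {E : Set (X × Ω)}
    (hE : MeasurableSet E) :
    StronglyMeasurableSections P fun x ω => E.indicator (fun _ => (1 : ℝ)) (x, ω) := by
  have hmem : ∀ {E : Set (X × Ω)}, MeasurableSet E → ∀ x,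
      MemLp (fun ω => E.indicator (fun _ => (1 : ℝ)) (x, ω)) 2 P := by
    intro E hE x
    refine MemLp.of_bound (C := 1) ?_ ?_
    · exact ((measurable_const.indicator hE).comp measurable_prodMk_left).aestronglyMeasurable
    · refine ae_of_all _ fun ω => ?_
      by_cases h : (x, ω) ∈ E <;> simp [h]
  induction E, hE using MeasurableSpace.induction_on_inter generateFrom_prod.symm
    isPiSystem_prod with
  | empty => exact ⟨hmem .empty, by simpa using! stronglyMeasurable_const⟩
  | basic t ht =>
    obtain ⟨A, hA, C, hC, rfl⟩ := ht
    have hA : MeasurableSet A := hA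
    have hC : MeasurableSet C := hC
    have h1 : MemLp (C.indicator fun _ => (1 : ℝ)) 2 P := memLp_indicator_const _ hC _ (by simp)
    convert stronglyMeasurableSections_indicator_const hA h1 using 3 with x ω
    by_cases hx : x ∈ A <;> by_cases hω : ω ∈ C <;> simp [hx, hω]
  | compl t ht ih =>
    have h1 : StronglyMeasurableSections P (fun (_ : X) (_ : Ω) => (1 : ℝ)) :=
      ⟨fun _ => memLp_const _, stronglyMeasurable_const⟩
    convert h1.add (ih.const_smul (-1)) using 3 with x ω
    by_cases h : (x, ω) ∈ t <;> simp [h]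
  | iUnion F hd hF ih =>
    have hpart : ∀ n : ℕ, StronglyMeasurableSections P
        (fun x ω => (⋃ i ∈ Finset.range n, F i).indicator (fun _ => (1 : ℝ)) (x, ω)) := by
      intro n
      induction n with
      | zero => exact ⟨hmem (by simp), by simpa using! stronglyMeasurable_const⟩
      | succ k hk =>
        convert hk.add (ih k) using 3 with x ω
        have hdis : Disjoint (⋃ i ∈ Finset.range k, F i) (F k) := by
          simp only [disjoint_iUnion_left, Finset.mem_range]
          exact fun i hi => hd hi.ne
        have hun : (⋃ i ∈ Finset.range (k + 1), F i) = (⋃ i ∈ Finset.range k, F i) ∪ F k := by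
          rw [Finset.range_add_one, Finset.set_biUnion_insert, union_comm]
        rw [hun, indicator_union_of_disjoint hdis]
        rfl
    refine StronglyMeasurableSections.of_tendsto (h := fun _ _ => 1) hpart
      (hmem (MeasurableSet.iUnion hF)) (fun _ => memLp_const _) ?_ ?_
    · intro n x ω
      by_cases h : (x, ω) ∈ ⋃ i ∈ Finset.range n, F i
      · rw [indicator_of_mem h]; simp
      · rw [indicator_of_notMem h]; simp
    · intro x ω
      by_cases h : (x, ω) ∈ ⋃ i, F i
      · obtain ⟨i, hi⟩ := mem_iUnion.1 h
        refine tendsto_const_nhds.congr' ?_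
        filter_upwards [eventually_gt_atTop i] with n hn
        rw [indicator_of_mem h, indicator_of_mem]
        exact mem_biUnion (Finset.mem_coe.2 (Finset.mem_range.2 hn)) hi
      · refine tendsto_const_nhds.congr' ?_
        refine Eventually.of_forall fun n => ?_
        beta_reduce
        rw [indicator_of_notMem h, indicator_of_notMem]
        intro h'
        obtain ⟨i, -, hi⟩ := mem_iUnion₂.1 h'
        exact h (mem_iUnion.2 ⟨i, hi⟩)

lemma stronglyMeasurableSections_simpleFunc {P : Measure Ω} [IsFiniteMeasure P]
    (F : SimpleFunc (X × Ω) ℝ) : StronglyMeasurableSections P fun x ω => F (x, ω) := by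
  induction F using SimpleFunc.induction with
  | const c hs =>
    convert (stronglyMeasurableSections_indicator (P := P) hs).const_smul c using 3 with x ω
    rename_i s
    by_cases h : (x, ω) ∈ s <;> simp [h]
  | add hfg h1 h2 => exact h1.add h2

/-- A jointly measurable process with square integrable sections is strongly measurable as a
function with values in `L²`. -/
lemma stronglyMeasurable_toLp {P : Measure Ω} [IsFiniteMeasure P] {f : X → Ω → ℝ}
    (hf : Measurable (Function.uncurry f)) (h2 : ∀ x, MemLp (f x) 2 P) :
    StronglyMeasurable fun x => (h2 x).toLp (f x) := by
  have : StronglyMeasurableSections P f := by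
    refine StronglyMeasurableSections.of_tendsto
      (f := fun n x ω => SimpleFunc.approxOn (Function.uncurry f) hf univ 0 (mem_univ _) n (x, ω))
      (h := fun x ω => ‖f x ω‖ + ‖f x ω‖)
      (fun n => stronglyMeasurableSections_simpleFunc _) h2
      (fun x => (h2 x).norm.add (h2 x).norm) ?_ ?_
    · intro n x ω
      exact SimpleFunc.norm_approxOn_zero_le hf (mem_univ _) (x, ω) n
    · intro x ω
      exact SimpleFunc.tendsto_approxOn hf (mem_univ _) (by simp)
  exact this.2

end StronglyMeasurableSections

/-! ### Progressive versions of conditional expectations. -/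

section ProgressiveVersion

variable {Ω : Type*} {mΩ : MeasurableSpace Ω} {T : ℝ}

/-- Pythagoras for martingale increments: by the tower property the cross term equals the energy of
the coarser projection. -/
lemma integral_sq_condExp_sub {P : Measure Ω} [IsProbabilityMeasure P] {m₁ m₂ : MeasurableSpace Ω}
    (h₁₂ : m₁ ≤ m₂) (h₂ : m₂ ≤ mΩ) {ξ : Ω → ℝ} (hξ : MemLp ξ 2 P) :
    ∫ ω, ((P[ξ | m₂]) ω - (P[ξ | m₁]) ω) ^ 2 ∂P
      = ∫ ω, (P[ξ | m₂]) ω ^ 2 ∂P - ∫ ω, (P[ξ | m₁]) ω ^ 2 ∂P := by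
  have m1 : MemLp (P[ξ | m₁]) 2 P := hξ.condExp one_le_two
  have m2 : MemLp (P[ξ | m₂]) 2 P := hξ.condExp one_le_two
  have hi : Integrable (fun ω => (P[ξ | m₂]) ω * (P[ξ | m₁]) ω) P := m2.integrable_mul m1
  have hcross : ∫ ω, (P[ξ | m₂]) ω * (P[ξ | m₁]) ω ∂P = ∫ ω, (P[ξ | m₁]) ω ^ 2 ∂P := by
    have h1 : P[fun ω => (P[ξ | m₂]) ω * (P[ξ | m₁]) ω | m₁]
        =ᵐ[P] fun ω => (P[P[ξ | m₂] | m₁]) ω * (P[ξ | m₁]) ω :=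
      condExp_mul_of_stronglyMeasurable_right stronglyMeasurable_condExp hi integrable_condExp
    rw [← integral_condExp (h₁₂.trans h₂)]
    refine integral_congr_ae ?_
    filter_upwards [h1, condExp_condExp_of_le (μ := P) (f := ξ) h₁₂ h₂] with ω a b
    rw [a, b, sq]
  have e : ∀ ω, ((P[ξ | m₂]) ω - (P[ξ | m₁]) ω) ^ 2
      = (P[ξ | m₂]) ω ^ 2 - 2 * ((P[ξ | m₂]) ω * (P[ξ | m₁]) ω) + (P[ξ | m₁]) ω ^ 2 :=
    fun ω => by ring
  have hi2 : Integrable (fun ω => (P[ξ | m₂]) ω ^ 2 - 2 * ((P[ξ | m₂]) ω * (P[ξ | m₁]) ω)) P :=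
    m2.integrable_sq.sub (hi.const_mul 2)
  simp_rw [e]
  rw [integral_add hi2 m1.integrable_sq,
    integral_sub m2.integrable_sq (hi.const_mul 2), integral_const_mul, hcross]
  ring

/-- The largest dyadic point of level `n` before `t`. -/
noncomputable def dyadicFloor [Fact (0 ≤ T)] (n : ℕ) (t : Time T) : Time T :=
  projIcc 0 T (Fact.out : 0 ≤ T) (⌊(2:ℝ) ^ n * t⌋₊ / 2 ^ n)

/-- The projection onto `[0,T]` in the definition only supplies the type: the floor already lies
between `0` and `t`. -/
lemma coe_dyadicFloor [Fact (0 ≤ T)] (n : ℕ) (t : Time T) :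
    (dyadicFloor n t : ℝ) = ⌊(2:ℝ) ^ n * t⌋₊ / 2 ^ n := by
  have h0 : (0:ℝ) ≤ 2 ^ n * t := mul_nonneg (by positivity) t.2.1
  rw [dyadicFloor, projIcc_of_mem]
  refine ⟨by positivity, ?_⟩
  rw [div_le_iff₀ (by positivity)]
  refine (Nat.floor_le h0).trans ?_
  rw [mul_comm]
  exact mul_le_mul_of_nonneg_right t.2.2 (by positivity)

lemma dyadicFloor_le [Fact (0 ≤ T)] (n : ℕ) (t : Time T) : dyadicFloor n t ≤ t := by
  have h0 : (0:ℝ) ≤ 2 ^ n * t := mul_nonneg (by positivity) t.2.1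
  rw [← Subtype.coe_le_coe, coe_dyadicFloor, div_le_iff₀ (by positivity)]
  exact (Nat.floor_le h0).trans_eq (mul_comm _ _)

lemma monotone_dyadicFloor [Fact (0 ≤ T)] (t : Time T) : Monotone fun n => dyadicFloor n t := by
  refine monotone_nat_of_le_succ fun n => ?_
  have h0 : (0:ℝ) ≤ 2 ^ n * t := mul_nonneg (by positivity) t.2.1
  rw [← Subtype.coe_le_coe, coe_dyadicFloor, coe_dyadicFloor, div_le_div_iff₀ (by positivity)
    (by positivity), pow_succ]
  have h1 : (2 * ⌊(2:ℝ) ^ n * t⌋₊ : ℕ) ≤ ⌊(2:ℝ) ^ n * 2 * t⌋₊ := by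
    refine Nat.le_floor ?_
    push_cast
    nlinarith [Nat.floor_le h0]
  have h2 : (2 * ⌊(2:ℝ) ^ n * t⌋₊ : ℝ) ≤ ⌊(2:ℝ) ^ n * 2 * t⌋₊ := by exact_mod_cast h1
  have h3 : (0:ℝ) < 2 ^ n := by positivity
  nlinarith

lemma tendsto_dyadicFloor [Fact (0 ≤ T)] (t : Time T) :
    Tendsto (fun n => dyadicFloor n t) atTop (𝓝 t) := by
  rw [tendsto_subtype_rng]
  have h0 : ∀ n : ℕ, (0:ℝ) ≤ 2 ^ n * t := fun n => mul_nonneg (by positivity) t.2.1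
  have hlow : Tendsto (fun n : ℕ => (t : ℝ) - (1 / 2) ^ n) atTop (𝓝 ((t : ℝ) - 0)) :=
    tendsto_const_nhds.sub (tendsto_pow_atTop_nhds_zero_of_lt_one (by norm_num) (by norm_num))
  rw [sub_zero] at hlow
  refine tendsto_of_tendsto_of_tendsto_of_le_of_le hlow tendsto_const_nhds ?_ ?_
  · intro n
    beta_reduce
    rw [coe_dyadicFloor, le_div_iff₀ (by positivity), sub_mul, ← mul_pow]
    have := Nat.lt_floor_add_one ((2:ℝ) ^ n * t)
    norm_num
    linarith
  · exact fun n => dyadicFloor_le n t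

lemma measurable_dyadicFloor [Fact (0 ≤ T)] (n : ℕ) : Measurable (dyadicFloor (T := T) n) := by
  unfold dyadicFloor
  refine continuous_projIcc.measurable.comp ?_
  refine Measurable.div_const ?_ _
  exact measurable_from_nat.comp (Nat.measurable_floor.comp (measurable_subtype_coe.const_mul _))

lemma countable_range_dyadicFloor [Fact (0 ≤ T)] (n : ℕ) :
    (range (dyadicFloor (T := T) n)).Countable := by
  refine (countable_range fun k : ℕ => projIcc 0 T (Fact.out : 0 ≤ T) (k / 2 ^ n)).mono ?_
  rintro _ ⟨t, rfl⟩
  exact ⟨_, rfl⟩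

/-- Every square integrable closed martingale has a progressively measurable version. -/
lemma exists_progressive_condExp [Fact (0 ≤ T)] {P : Measure Ω} [IsProbabilityMeasure P]
    (𝓕 : Filtration (Time T) mΩ) {ξ : Ω → ℝ} (hξ : MemLp ξ 2 P) :
    ∃ Y : Time T → Ω → ℝ, IsStronglyProgressive 𝓕 Y ∧ ∀ t, Y t =ᵐ[P] P[ξ | 𝓕 t] := by
  classical
  set g : Time T → Ω → ℝ := fun t => P[ξ | 𝓕 t] with hg
  have hga : StronglyAdapted 𝓕 g := fun t => stronglyMeasurable_condExp
  have hgm : ∀ t, MemLp (g t) 2 P := fun t => hξ.condExp one_le_two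
  -- The energy `V` is monotone, so it has only countably many discontinuities. At its continuity
  -- points the martingale is left continuous in `L²`, and its value can be recovered from earlier
  -- dyadic times; at the remaining times it is left untouched.
  set V : Time T → ℝ := fun t => ∫ ω, g t ω ^ 2 ∂P with hV
  have hdiff : ∀ {s t}, s ≤ t → ∫ ω, (g t ω - g s ω) ^ 2 ∂P = V t - V s := fun {s t} hst =>
    integral_sq_condExp_sub (𝓕.mono hst) (𝓕.le t) hξ
  have hVm : Monotone V := by
    intro s t hst
    have h1 : 0 ≤ ∫ ω, (g t ω - g s ω) ^ 2 ∂P := integral_nonneg fun _ => sq_nonneg _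
    rw [hdiff hst] at h1
    linarith
  set N : Set (Time T) := {t | ¬ ContinuousAt V t} with hN
  have hNc : N.Countable := hVm.countable_not_continuousAt
  set Z : Time T × Ω → ℝ := fun p => limsup (fun n => g (dyadicFloor n p.1) p.2) atTop with hZ
  have hZm : Measurable[progSigma 𝓕] Z := by
    refine Measurable.limsup fun n => ?_
    simpa using measurable_progSigma_comp (measurable_dyadicFloor n) (countable_range_dyadicFloor n)
      MeasurableSet.univ (fun t _ => dyadicFloor_le n t) hga
  have hNm : Measurable[progSigma 𝓕] (fun p : Time T × Ω => N.indicator (fun t => g t p.2) p.1) := by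
    have hτ : Measurable (fun t : Time T => if t ∈ N then t else ⊥) :=
      Measurable.ite hNc.measurableSet measurable_id measurable_const
    have hr : (range fun t : Time T => if t ∈ N then t else ⊥).Countable := by
      refine (hNc.insert ⊥).mono ?_
      rintro _ ⟨t, rfl⟩
      by_cases ht : t ∈ N <;> simp [ht]
    convert measurable_progSigma_comp hτ hr hNc.measurableSet (fun t ht => by simp [ht]) hga
      using 2 with p
    by_cases hp : p.1 ∈ N <;> simp [hp]
  refine ⟨fun t ω => if t ∈ N then N.indicator (fun t => g t ω) t else Z (t, ω), ?_, ?_⟩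
  · rw [isStronglyProgressive_iff]
    exact Measurable.ite (m := progSigma 𝓕) (p := fun p : Time T × Ω => p.1 ∈ N)
      (measurable_fst_progSigma 𝓕 hNc.measurableSet) hNm hZm
  · intro t
    by_cases ht : t ∈ N
    · simp only [ht, if_true, indicator_of_mem]
      rfl
    · simp only [ht, if_false]
      have hc : ContinuousAt V t := by simpa [hN] using ht
      -- Lévy's upward theorem along the dyadic σ-algebras gives almost sure convergence to some
      -- limit. The `L²` limit from continuity of `V` identifies that limit as `g t`, through
      -- uniqueness of limits in measure.
      let 𝓗 : Filtration ℕ mΩ := ⟨fun n => 𝓕 (dyadicFloor n t),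
        fun _ _ h => 𝓕.mono (monotone_dyadicFloor t h), fun _ => 𝓕.le _⟩
      have hae : ∀ᵐ ω ∂P, Tendsto (fun n => g (dyadicFloor n t) ω) atTop
          (𝓝 ((P[ξ | ⨆ n, 𝓗 n]) ω)) := tendsto_ae_condExp (ℱ := 𝓗) ξ
      have hL2 : Tendsto (fun n => eLpNorm (g (dyadicFloor n t) - g t) 2 P) atTop (𝓝 0) := by
        have h1 : ∀ n, eLpNorm (g (dyadicFloor n t) - g t) 2 P
            = ENNReal.ofReal ((V t - V (dyadicFloor n t)) ^ (1 / 2 : ℝ)) := by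
          intro n
          rw [MemLp.eLpNorm_eq_integral_rpow_norm two_ne_zero ENNReal.ofNat_ne_top
            ((hgm _).sub (hgm _)), ← hdiff (dyadicFloor_le n t)]
          simp [← abs_sub_comm (g t _)]
        simp_rw [h1]
        have h2 : Tendsto (fun n => V t - V (dyadicFloor n t)) atTop (𝓝 (V t - V t)) :=
          tendsto_const_nhds.sub (hc.tendsto.comp (tendsto_dyadicFloor t))
        rw [sub_self] at h2
        have h3 := ENNReal.tendsto_ofReal (h2.rpow_const (p := 1 / 2) (Or.inr (by norm_num)))
        simpa using h3
      have hm1 : TendstoInMeasure P (fun n => g (dyadicFloor n t)) atTop (g t) :=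
        tendstoInMeasure_of_tendsto_eLpNorm two_ne_zero (fun n => (hgm _).1) (hgm _).1 hL2
      have hm2 : TendstoInMeasure P (fun n => g (dyadicFloor n t)) atTop (P[ξ | ⨆ n, 𝓗 n]) :=
        tendstoInMeasure_of_tendsto_ae (fun n => (hgm _).1) hae
      have heq : g t =ᵐ[P] P[ξ | ⨆ n, 𝓗 n] := tendstoInMeasure_ae_unique hm1 hm2
      filter_upwards [hae, heq] with ω h1 h2
      exact h1.limsup_eq.trans h2.symm

/-- The conditional expectations `E[η_t | 𝓕_t]` of a strongly measurable `L²`-valued function have a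
progressively measurable version. -/
lemma exists_progressive_condExp_of_stronglyMeasurable [Fact (0 ≤ T)] {P : Measure Ω}
    [IsProbabilityMeasure P] (𝓕 : Filtration (Time T) mΩ) {η : Time T → Lp ℝ 2 P}
    (hη : StronglyMeasurable η) :
    ∃ Z : Time T → Ω → ℝ, IsStronglyProgressive 𝓕 Z ∧ ∀ t, Z t =ᵐ[P] P[η t | 𝓕 t] := by
  classical
  obtain ⟨c, hcc, hcd⟩ := hη.isSeparable_range
  have hne : c.Nonempty := by
    rw [← closure_nonempty_iff]
    exact ⟨_, hcd ⟨⊥, rfl⟩⟩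
  obtain ⟨d, hd⟩ := hcc.exists_eq_range hne
  have hex : ∀ (n : ℕ) (t : Time T), ∃ k, ‖d k - η t‖ < (1 / 2) ^ n := by
    intro n t
    have h1 : η t ∈ closure c := hcd ⟨t, rfl⟩
    obtain ⟨y, hy, hy2⟩ := Metric.mem_closure_iff.1 h1 ((1 / 2) ^ n) (by positivity)
    rw [hd] at hy
    obtain ⟨k, rfl⟩ := hy
    exact ⟨k, by rwa [← dist_eq_norm, dist_comm]⟩
  choose Y hY1 hY2 using fun k => exists_progressive_condExp 𝓕 (P := P) (Lp.memLp (d k))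
  -- The index of the first element of the countable family within `2⁻ⁿ` of `η t`. Taking the least
  -- index makes the selection measurable in `t`, so that `η t` is approximated by one of countably
  -- many closed martingales.
  set κ : ℕ → Time T → ℕ := fun n t => Nat.find (hex n t) with hκ
  have hκm : ∀ n, Measurable (κ n) := by
    intro n
    refine measurable_find _ fun k => ?_
    exact (stronglyMeasurable_const.sub hη).norm.measurable measurableSet_Iio
  set Z : Time T × Ω → ℝ := fun p => limsup (fun n => Y (κ n p.1) p.1 p.2) atTop with hZ
  refine ⟨fun t ω => Z (t, ω), ?_, ?_⟩
  · rw [isStronglyProgressive_iff]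
    refine Measurable.limsup fun n => ?_
    have h1 : @Measurable _ _ (@Prod.instMeasurableSpace _ _ _ (progSigma 𝓕)) _
        (fun q : ℕ × (Time T × Ω) => Y q.1 q.2.1 q.2.2) := by
      refine @measurable_from_prod_countable_right _ _ _ _ (progSigma 𝓕) _ _ _ _ fun k => ?_
      exact isStronglyProgressive_iff.1 (hY1 k)
    exact h1.comp (((hκm n).comp (measurable_fst_progSigma 𝓕)).prodMk measurable_id)
  · intro t
    -- Conditional expectation contracts `L¹`, so the errors are summable in `L¹`. Thus the full
    -- sequence converges almost surely for each fixed `t`, and the `limsup` is the right version at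
    -- every time.
    have hn : ∀ n, eLpNorm (fun ω => Y (κ n t) t ω - (P[η t | 𝓕 t]) ω) 1 P
        ≤ ENNReal.ofReal ((1 / 2) ^ n) := by
      intro n
      have h1 : (fun ω => Y (κ n t) t ω - (P[η t | 𝓕 t]) ω)
          =ᵐ[P] P[(d (κ n t) : Ω → ℝ) - (η t : Ω → ℝ) | 𝓕 t] := by
        filter_upwards [hY2 (κ n t) t, condExp_sub ((Lp.memLp (d (κ n t))).integrable one_le_two)
          ((Lp.memLp (η t)).integrable one_le_two) (𝓕 t)] with ω a b
        rw [a, b]; rfl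
      rw [eLpNorm_congr_ae h1]
      refine (eLpNorm_condExp_le_eLpNorm _ le_rfl).trans ?_
      refine (eLpNorm_le_eLpNorm_of_exponent_le one_le_two
        ((Lp.aestronglyMeasurable _).sub (Lp.aestronglyMeasurable _))).trans ?_
      rw [← eLpNorm_congr_ae (Lp.coeFn_sub _ _), ← Lp.enorm_def, ← ofReal_norm]
      exact ENNReal.ofReal_le_ofReal (Nat.find_spec (hex n t)).le
    have hsum : ∫⁻ ω, ∑' n, ‖Y (κ n t) t ω - (P[η t | 𝓕 t]) ω‖ₑ ∂P ≠ ∞ := by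
      rw [lintegral_tsum]
      · refine ne_top_of_le_ne_top ?_ (ENNReal.tsum_le_tsum fun n => ?_)
          (b := ∑' n : ℕ, ENNReal.ofReal ((1 / 2) ^ n))
        · exact (summable_geometric_of_lt_one (by norm_num) (by norm_num)).tsum_ofReal_ne_top
        · rw [← eLpNorm_one_eq_lintegral_enorm]
          exact hn n
      · intro n
        exact ((((measurable_uncurry_of_progressive (hY1 (κ n t))).comp measurable_prodMk_left).sub
          (stronglyMeasurable_condExp.mono (𝓕.le t)).measurable).enorm).aemeasurable
    have hmeas : Measurable fun ω => ∑' n, ‖Y (κ n t) t ω - (P[η t | 𝓕 t]) ω‖ₑ := by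
      refine Measurable.tsum fun n => ?_
      exact ((((measurable_uncurry_of_progressive (hY1 (κ n t))).comp measurable_prodMk_left).sub
          (stronglyMeasurable_condExp.mono (𝓕.le t)).measurable).enorm)
    filter_upwards [ae_lt_top hmeas hsum] with ω hω
    have h1 := ENNReal.tendsto_atTop_zero_of_tsum_ne_top hω.ne
    have h2 : Tendsto (fun n => Y (κ n t) t ω) atTop (𝓝 ((P[η t | 𝓕 t]) ω)) := by
      rw [tendsto_iff_edist_tendsto_0]
      simpa [edist_eq_enorm_sub] using h1
    exact h2.limsup_eq

end ProgressiveVersion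

/-! ### Integral operators of causal kernels, coercivity and inverses. -/

section KernelOperators

variable {T : ℝ}

lemma ae_ne_time (t : Time T) : ∀ᵐ s : Time T, s ≠ t := by
  have : (volume : Measure (Time T)) {t} = 0 := by
    rw [show (volume : Measure (Time T)) = Measure.comap Subtype.val volume from rfl,
      (MeasurableEmbedding.subtype_coe measurableSet_Icc).comap_apply]
    simp
  exact measure_eq_zero_iff_ae_notMem.1 this

lemma toL2_eq {f : Time T → ℝ} (h : MemLp f 2 (volume : Measure (Time T))) :
    toL2 f = h.toLp f := dif_pos h

lemma coeFn_toL2 {f : Time T → ℝ} (h : MemLp f 2 (volume : Measure (Time T))) :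
    toL2 f =ᵐ[volume] f := by
  rw [toL2_eq h]
  exact h.coeFn_toLp

lemma inner_L2 (f g : L2 T) : inner ℝ f g = ∫ s, f s * g s := by
  rw [L2.inner_def]
  refine integral_congr_ae (ae_of_all _ fun s => ?_)
  simp [mul_comm]

lemma inner_toL2_right {f : Time T → ℝ} (h : MemLp f 2 (volume : Measure (Time T))) (g : L2 T) :
    inner ℝ g (toL2 f) = ∫ s, g s * f s := by
  rw [inner_L2]
  refine integral_congr_ae ?_
  filter_upwards [coeFn_toL2 h] with s hs
  rw [hs]

lemma norm_toL2_sq {f : Time T → ℝ} (h : MemLp f 2 (volume : Measure (Time T))) :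
    ‖toL2 f‖ ^ 2 = ∫ s, f s ^ 2 := by
  rw [← real_inner_self_eq_norm_sq, inner_toL2_right h]
  refine integral_congr_ae ?_
  filter_upwards [coeFn_toL2 h] with s hs
  rw [hs, sq]

lemma memLp_cutoff {f : Time T → ℝ} (h : MemLp f 2 (volume : Measure (Time T))) (t : Time T) :
    MemLp (cutoff t f) 2 (volume : Measure (Time T)) := by
  have : cutoff t f = (Ici t).indicator f := by
    funext r
    by_cases hr : t ≤ r <;> simp [cutoff, hr]
  rw [this]
  exact h.indicator measurableSet_Ici

lemma coeFn_kernelOp {F : Time T → Time T → ℝ} (hF : SqIntKernel F) (g : L2 T) :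
    kernelOp F g =ᵐ[volume] fun t => ∫ s, F t s * g s := by
  have : kernelOp F g = (hF.memLp_integral g).toLp (fun t => ∫ s, F t s * g s) := by
    rw [kernelOp, dif_pos hF]
    rfl
  rw [this]
  exact (hF.memLp_integral g).coeFn_toLp

lemma norm_kernelOp_le {F : Time T → Time T → ℝ} (hF : SqIntKernel F) :
    ‖kernelOp F‖ ≤ Real.sqrt (∫ t, ∫ s, F t s ^ 2) := by
  rw [kernelOp, dif_pos hF]
  exact LinearMap.mkContinuous_norm_le _ (Real.sqrt_nonneg _) _

lemma SqIntKernel.sub {F F' : Time T → Time T → ℝ} (hF : SqIntKernel F) (hF' : SqIntKernel F') :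
    SqIntKernel (fun t s => F t s - F' t s) :=
  MemLp.sub hF hF'

lemma kernelOp_sub {F F' : Time T → Time T → ℝ} (hF : SqIntKernel F) (hF' : SqIntKernel F') :
    kernelOp F - kernelOp F' = kernelOp (fun t s => F t s - F' t s) := by
  ext1 g
  rw [sub_apply]
  refine Lp.ext ?_
  filter_upwards [Lp.coeFn_sub (kernelOp F g) (kernelOp F' g), coeFn_kernelOp hF g,
    coeFn_kernelOp hF' g, coeFn_kernelOp (hF.sub hF') g, hF.memLp_section, hF'.memLp_section]
    with t h1 h2 h3 h4 h5 h6
  have h7 : Integrable (fun s => F t s * g s) := h5.integrable_mul (Lp.memLp g)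
  have h8 : Integrable (fun s => F' t s * g s) := h6.integrable_mul (Lp.memLp g)
  rw [h1, h4, Pi.sub_apply, h2, h3, ← integral_sub h7 h8]
  refine integral_congr_ae (ae_of_all _ fun s => ?_)
  simp [sub_mul]

lemma SqIntKernel.adj {F : Time T → Time T → ℝ} (hF : SqIntKernel F) :
    SqIntKernel (adjKernel F) :=
  MemLp.comp_measurePreserving hF Measure.measurePreserving_swap

lemma SqIntKernel.integrable_bilin {F : Time T → Time T → ℝ} (hF : SqIntKernel F) (f g : L2 T) :
    Integrable (fun p : Time T × Time T => F p.1 p.2 * (f p.1 * g p.2))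
      ((volume : Measure (Time T)).prod volume) := by
  have h : MemLp (fun p : Time T × Time T => f p.1 * g p.2) 2
      ((volume : Measure (Time T)).prod volume) := by
    rw [memLp_two_iff_integrable_sq]
    · simp_rw [mul_pow]
      exact (Lp.memLp f).integrable_sq.mul_prod (Lp.memLp g).integrable_sq
    · exact (Lp.aestronglyMeasurable f).comp_fst.mul (Lp.aestronglyMeasurable g).comp_snd
  exact MemLp.integrable_mul hF h

lemma inner_kernelOp {F : Time T → Time T → ℝ} (hF : SqIntKernel F) (f g : L2 T) :
    inner ℝ f (kernelOp F g)
      = ∫ p : Time T × Time T, F p.1 p.2 * (f p.1 * g p.2)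
          ∂((volume : Measure (Time T)).prod volume) := by
  rw [integral_prod _ (hF.integrable_bilin f g), inner_L2]
  refine integral_congr_ae ?_
  filter_upwards [coeFn_kernelOp hF g] with t ht
  rw [ht, ← integral_const_mul]
  refine integral_congr_ae (ae_of_all _ fun s => ?_)
  ring

lemma kernelOp_adj {F : Time T → Time T → ℝ} (hF : SqIntKernel F) :
    kernelOp (adjKernel F) = ContinuousLinearMap.adjoint (kernelOp F) := by
  rw [ContinuousLinearMap.eq_adjoint_iff]
  intro f g
  rw [real_inner_comm, inner_kernelOp hF.adj, inner_kernelOp hF, ← integral_prod_swap]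
  refine integral_congr_ae (ae_of_all _ fun p => ?_)
  simp [adjKernel]
  ring_nf
  simp

/-- A kernel supported on `{s ≤ t}` whose sections are bounded in `L²`. -/
structure IsCausalKernel (K : Time T → Time T → ℝ) (C : ℝ) : Prop where
  measurable : Measurable (Function.uncurry K)
  causal : ∀ t s, t < s → K t s = 0
  row_memLp : ∀ t, MemLp (K t) 2 (volume : Measure (Time T))
  col_memLp : ∀ s, MemLp (fun t => K t s) 2 (volume : Measure (Time T))
  row_le : ∀ t, ∫ s, K t s ^ 2 ≤ C
  col_le : ∀ s, ∫ t, K t s ^ 2 ≤ C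

lemma IsCausalKernel.sqInt {K : Time T → Time T → ℝ} {C : ℝ} (hK : IsCausalKernel K C) :
    SqIntKernel K := by
  have hm := hK.measurable.aestronglyMeasurable
    (μ := (volume : Measure (Time T)).prod (volume : Measure (Time T)))
  rw [SqIntKernel, memLp_two_iff_integrable_sq hm]
  refine (integrable_prod_iff (hm.pow 2)).2 ?_
  refine ⟨ae_of_all _ fun t => (hK.row_memLp t).integrable_sq, ?_⟩
  refine Integrable.of_bound (C := C) ((hm.pow 2).norm.integral_prod_right') (ae_of_all _ fun t => ?_)
  have h0 : 0 ≤ ∫ s, K t s ^ 2 := integral_nonneg fun _ => sq_nonneg _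
  have : ∫ s, ‖(Function.uncurry K (t, s)) ^ 2‖ = ∫ s, K t s ^ 2 := by
    refine integral_congr_ae (ae_of_all _ fun s => ?_)
    simp [Function.uncurry]
  simp only [Pi.pow_apply]
  rw [this, Real.norm_of_nonneg h0]
  exact hK.row_le t

lemma truncKernel_eq (K : Time T → Time T → ℝ) (t : Time T) :
    Function.uncurry (truncKernel K t)
      = {p : Time T × Time T | t ≤ p.2}.indicator (Function.uncurry K) := by
  funext p
  by_cases hp : t ≤ p.2 <;> simp [truncKernel, hp, Function.uncurry]

lemma SqIntKernel.trunc {K : Time T → Time T → ℝ} (hK : SqIntKernel K) (t : Time T) :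
    SqIntKernel (truncKernel K t) := by
  rw [SqIntKernel, truncKernel_eq]
  exact MemLp.indicator (measurableSet_le measurable_const measurable_snd) hK

/-- The operator `2ε id + 𝑲_t + 𝑲_t*` of a kernel `K`. -/
noncomputable def truncSymmOp (K : Time T → Time T → ℝ) (ε : ℝ) (t : Time T) : L2 T →L[ℝ] L2 T :=
  (2 * ε) • ContinuousLinearMap.id ℝ (L2 T) + kernelOp (truncKernel K t)
    + kernelOp (adjKernel (truncKernel K t))

/-- The operator `2ε id + 𝑲 + 𝑲*` of a kernel `K`. -/
noncomputable def symmOp (K : Time T → Time T → ℝ) (ε : ℝ) : L2 T →L[ℝ] L2 T :=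
  (2 * ε) • ContinuousLinearMap.id ℝ (L2 T) + kernelOp K + kernelOp (adjKernel K)

lemma coeFn_symmOp {K : Time T → Time T → ℝ} (hK : SqIntKernel K) (ε : ℝ) (f : L2 T) :
    symmOp K ε f =ᵐ[volume] fun s => 2 * ε * f s + (∫ r, K s r * f r) + ∫ r, K r s * f r := by
  have e : symmOp K ε f = (2 * ε) • f + kernelOp K f + kernelOp (adjKernel K) f := rfl
  rw [e]
  filter_upwards [Lp.coeFn_add ((2 * ε) • f + kernelOp K f) (kernelOp (adjKernel K) f),
    Lp.coeFn_add ((2 * ε) • f) (kernelOp K f), Lp.coeFn_smul (2 * ε) f,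
    coeFn_kernelOp hK f, coeFn_kernelOp hK.adj f] with s h1 h2 h3 h4 h5
  rw [h1, Pi.add_apply, h2, Pi.add_apply, h3, h4, h5]
  rfl

lemma inner_symmOp_left {K : Time T → Time T → ℝ} (hK : SqIntKernel K) (ε : ℝ) (f g : L2 T) :
    inner ℝ (symmOp K ε f) g = inner ℝ f (symmOp K ε g) := by
  simp only [symmOp, kernelOp_adj hK, add_apply, smul_apply, ContinuousLinearMap.id_apply,
    inner_add_left, inner_add_right, inner_smul_left, inner_smul_right,
    ContinuousLinearMap.adjoint_inner_left, ContinuousLinearMap.adjoint_inner_right]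
  simp
  ring

lemma inner_symmOp_self {K : Time T → Time T → ℝ} (hK : SqIntKernel K) (ε : ℝ) (f : L2 T) :
    inner ℝ (symmOp K ε f) f = 2 * ε * ‖f‖ ^ 2 + 2 * inner ℝ (kernelOp K f) f := by
  simp only [symmOp, kernelOp_adj hK, add_apply, smul_apply, ContinuousLinearMap.id_apply,
    inner_add_left, inner_smul_left, ContinuousLinearMap.adjoint_inner_left,
    real_inner_self_eq_norm_sq, real_inner_comm f (kernelOp K f)]
  simp
  ring

lemma truncSymmOp_eq (K : Time T → Time T → ℝ) (ε : ℝ) (t : Time T) :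
    truncSymmOp K ε t = symmOp (truncKernel K t) ε := rfl

/-- Truncating the columns of a causal kernel truncates its rows for free: if `t ≤ r` and `s < t`,
then `s < r` and `K s r = 0`. The quadratic form of the truncated operator is thus that of `K` on
cut-off functions, and positivity passes to every `𝑫_t`. -/
lemma inner_kernelOp_trunc {K : Time T → Time T → ℝ} {C : ℝ} (hK : IsCausalKernel K C) (t : Time T)
    (f : L2 T) : inner ℝ (kernelOp (truncKernel K t) f) f
      = inner ℝ (kernelOp K (toL2 (cutoff t f))) (toL2 (cutoff t f)) := by
  rw [inner_toL2_right (memLp_cutoff (Lp.memLp f) t), inner_L2]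
  refine integral_congr_ae ?_
  filter_upwards [coeFn_kernelOp hK.sqInt (toL2 (cutoff t f)),
    coeFn_kernelOp (hK.sqInt.trunc t) f] with s h1 h2
  have h3 : ∫ r, K s r * (toL2 (cutoff t f)) r = ∫ r, truncKernel K t s r * f r := by
    refine integral_congr_ae ?_
    filter_upwards [coeFn_toL2 (memLp_cutoff (Lp.memLp f) t)] with r hr
    rw [hr]
    by_cases h : t ≤ r <;> simp [cutoff, truncKernel, h]
  rw [h1, h2, h3]
  by_cases h : t ≤ s
  · simp [cutoff, h]
  · have h4 : ∀ r, truncKernel K t s r = 0 := by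
      intro r
      by_cases hr : t ≤ r
      · simp [truncKernel, hr, hK.causal s r ((not_le.1 h).trans_le hr)]
      · simp [truncKernel, hr]
    simp [h4]

/-- A causal kernel which induces a monotone operator. -/
structure IsMonotoneKernel (K : Time T → Time T → ℝ) (C : ℝ) : Prop extends IsCausalKernel K C where
  nonneg : ∀ f : L2 T, 0 ≤ inner ℝ (kernelOp K f) f

variable {K : Time T → Time T → ℝ} {C ε : ℝ}

lemma IsMonotoneKernel.le_inner_symmOp (hK : IsMonotoneKernel K C) (ε : ℝ) (f : L2 T) :
    2 * ε * ‖f‖ ^ 2 ≤ inner ℝ (symmOp K ε f) f := by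
  rw [inner_symmOp_self hK.sqInt]
  linarith [hK.nonneg f]

lemma IsMonotoneKernel.le_inner_truncSymmOp (hK : IsMonotoneKernel K C) (ε : ℝ) (t : Time T)
    (f : L2 T) : 2 * ε * ‖f‖ ^ 2 ≤ inner ℝ (truncSymmOp K ε t f) f := by
  rw [truncSymmOp_eq, inner_symmOp_self (hK.sqInt.trunc t),
    inner_kernelOp_trunc hK.toIsCausalKernel]
  linarith [hK.nonneg (toL2 (cutoff t f))]

/-- The Lax-Milgram theorem. -/
lemma isUnit_of_coercive {H : Type*} [NormedAddCommGroup H] [InnerProductSpace ℝ H]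
    [CompleteSpace H] {A : H →L[ℝ] H} {c : ℝ} (hc : 0 < c)
    (h : ∀ f, c * ‖f‖ ^ 2 ≤ inner ℝ (A f) f) : IsUnit A := by
  refine ContinuousLinearMap.isUnit_of_forall_le_norm_inner_map A (c := ⟨c, hc.le⟩) hc fun f => ?_
  rw [mul_comm]
  exact (h f).trans (le_abs_self _)

lemma IsMonotoneKernel.isUnit_truncSymmOp (hK : IsMonotoneKernel K C) (hε : 0 < ε) (t : Time T) :
    IsUnit (truncSymmOp K ε t) :=
  isUnit_of_coercive (by positivity : 0 < 2 * ε) (hK.le_inner_truncSymmOp ε t)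

lemma IsMonotoneKernel.truncSymmOp_inverse (hK : IsMonotoneKernel K C) (hε : 0 < ε) (t : Time T)
    (f : L2 T) : truncSymmOp K ε t (Ring.inverse (truncSymmOp K ε t) f) = f := by
  have := Ring.mul_inverse_cancel _ (hK.isUnit_truncSymmOp hε t)
  exact congrArg (fun A : L2 T →L[ℝ] L2 T => A f) this

lemma IsMonotoneKernel.inner_inverse_left (hK : IsMonotoneKernel K C) (hε : 0 < ε) (t : Time T)
    (f g : L2 T) : inner ℝ (Ring.inverse (truncSymmOp K ε t) f) g
      = inner ℝ f (Ring.inverse (truncSymmOp K ε t) g) := by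
  conv_lhs => rw [← hK.truncSymmOp_inverse hε t g]
  rw [truncSymmOp_eq, ← inner_symmOp_left (hK.sqInt.trunc t), ← truncSymmOp_eq,
    hK.truncSymmOp_inverse hε]

/-- Coercivity and Cauchy-Schwarz at the preimage give a bound that does not depend on `t`. -/
lemma IsMonotoneKernel.norm_inverse_le (hK : IsMonotoneKernel K C) (hε : 0 < ε) (t : Time T)
    (f : L2 T) : ‖Ring.inverse (truncSymmOp K ε t) f‖ ≤ (2 * ε)⁻¹ * ‖f‖ := by
  set g := Ring.inverse (truncSymmOp K ε t) f with hg
  have h1 := hK.le_inner_truncSymmOp ε t g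
  rw [hg, hK.truncSymmOp_inverse hε, ← hg] at h1
  have h2 := h1.trans (real_inner_le_norm f g)
  rw [inv_mul_eq_div, le_div_iff₀ (by positivity)]
  rcases (norm_nonneg g).eq_or_lt with h | h
  · rw [← h]; simp
  · nlinarith

/-- The operator norm is at most the Hilbert-Schmidt norm. Truncations at `t` and `t₀` differ only
on the strip of columns between them, and this strip shrinks to a null set, so dominated convergence
applies with `K²` as the bound. Continuity is what later makes the costate measurable in `t`. -/
lemma IsCausalKernel.continuous_truncSymmOp (hK : IsCausalKernel K C) (ε : ℝ) :
    Continuous (truncSymmOp K ε) := by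
  have hop : Continuous fun t => kernelOp (truncKernel K t) := by
    refine continuous_iff_continuousAt.2 fun t₀ => ?_
    rw [ContinuousAt, tendsto_iff_norm_sub_tendsto_zero]
    have hbound : ∀ t, ‖kernelOp (truncKernel K t) - kernelOp (truncKernel K t₀)‖
        ≤ Real.sqrt (∫ p : Time T × Time T, (truncKernel K t p.1 p.2 - truncKernel K t₀ p.1 p.2) ^ 2
          ∂((volume : Measure (Time T)).prod volume)) := by
      intro t
      rw [kernelOp_sub (hK.sqInt.trunc t) (hK.sqInt.trunc t₀)]
      refine (norm_kernelOp_le ((hK.sqInt.trunc t).sub (hK.sqInt.trunc t₀))).trans_eq ?_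
      have hi := MemLp.integrable_sq ((hK.sqInt.trunc t).sub (hK.sqInt.trunc t₀))
      rw [← integral_prod (fun p : Time T × Time T =>
        (truncKernel K t p.1 p.2 - truncKernel K t₀ p.1 p.2) ^ 2) hi]
    refine squeeze_zero (fun _ => norm_nonneg _) hbound ?_
    have h0 : ∫ p : Time T × Time T, (0:ℝ) ∂((volume : Measure (Time T)).prod volume) = 0 := by
      simp
    suffices h : Tendsto (fun t => ∫ p : Time T × Time T,
        (truncKernel K t p.1 p.2 - truncKernel K t₀ p.1 p.2) ^ 2
          ∂((volume : Measure (Time T)).prod volume)) (𝓝 t₀)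
        (𝓝 (∫ p : Time T × Time T, (0:ℝ) ∂((volume : Measure (Time T)).prod volume))) by
      rw [h0] at h
      have h2 := (Real.continuous_sqrt.tendsto 0).comp h
      rwa [Real.sqrt_zero] at h2
    refine tendsto_integral_filter_of_dominated_convergence
      (fun p : Time T × Time T => (K p.1 p.2) ^ 2) (Eventually.of_forall fun t => ?_)
      (Eventually.of_forall fun t => ae_of_all _ fun p => ?_) (MemLp.integrable_sq hK.sqInt) ?_
    · exact (MemLp.integrable_sq ((hK.sqInt.trunc t).sub (hK.sqInt.trunc t₀))).1
    · rw [Real.norm_of_nonneg (sq_nonneg _)]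
      by_cases h1 : t ≤ p.2 <;> by_cases h2 : t₀ ≤ p.2 <;>
        simp [truncKernel, h1, h2, sq_nonneg]
    · have hne : ∀ᵐ p : Time T × Time T ∂((volume : Measure (Time T)).prod volume), p.2 ≠ t₀ := by
        exact Measure.quasiMeasurePreserving_snd.ae (ae_ne_time t₀)
      filter_upwards [hne] with p hp
      refine tendsto_const_nhds.congr' ?_
      rcases lt_or_gt_of_ne hp with h | h
      · filter_upwards [lt_mem_nhds h] with t ht
        simp [truncKernel, not_le.2 h, not_le.2 ht]
      · filter_upwards [gt_mem_nhds h] with t ht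
        simp [truncKernel, h.le, ht.le]
  have e : truncSymmOp K ε = fun t => (2 * ε) • ContinuousLinearMap.id ℝ (L2 T)
      + kernelOp (truncKernel K t)
      + ContinuousLinearMap.adjoint (kernelOp (truncKernel K t)) := by
    funext t
    rw [← kernelOp_adj (hK.sqInt.trunc t)]
    rfl
  rw [e]
  exact (continuous_const.add hop).add
    ((LinearIsometryEquiv.continuous ContinuousLinearMap.adjoint).comp hop)

lemma IsMonotoneKernel.continuous_inverse (hK : IsMonotoneKernel K C) (hε : 0 < ε) :
    Continuous fun t => Ring.inverse (truncSymmOp K ε t) := by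
  refine continuous_iff_continuousAt.2 fun t => ?_
  obtain ⟨u, hu⟩ := hK.isUnit_truncSymmOp hε t
  have h1 : ContinuousAt Ring.inverse (truncSymmOp K ε t) := by
    rw [← hu]
    exact NormedRing.inverse_continuousAt u
  exact ContinuousAt.comp (f := truncSymmOp K ε) h1 (hK.continuous_truncSymmOp ε).continuousAt

end KernelOperators

/-! ### The costate and the elimination of the future. -/

section VolterraKernel

variable {T : ℝ} {K : Time T → Time T → ℝ} {C ε : ℝ}

/-- The function `𝑫_t⁻¹ 1_{t ≤ ·} K(·,t)`. -/
noncomputable def costate (K : Time T → Time T → ℝ) (ε : ℝ) (t : Time T) : L2 T :=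
  Ring.inverse (truncSymmOp K ε t) (toL2 (cutoff t fun r => K r t))

/-- The scalar `⟨𝑫_t⁻¹ 1_{t ≤ ·} K(·,t), 1_{t ≤ ·} f⟩`. -/
noncomputable def costatePairing (K : Time T → Time T → ℝ) (ε : ℝ) (t : Time T)
    (f : Time T → ℝ) : ℝ :=
  inner ℝ (costate K ε t) (toL2 (cutoff t f))

/-- The kernel of the Volterra equation for the kernel `K`. -/
noncomputable def volterraKernel (K : Time T → Time T → ℝ) (ε : ℝ) (t s : Time T) : ℝ :=
  if s ≤ t then 1 / (2 * ε) * (costatePairing K ε t (fun r => K r s) - K t s) else 0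

lemma costatePairing_eq_integral {f : Time T → ℝ} (hf : MemLp f 2 (volume : Measure (Time T)))
    (t : Time T) : costatePairing K ε t f = ∫ s, costate K ε t s * cutoff t f s :=
  inner_toL2_right (memLp_cutoff hf t) _

lemma norm_toL2_cutoff_le {f : Time T → ℝ} (hf : MemLp f 2 (volume : Measure (Time T)))
    (t : Time T) : ‖toL2 (cutoff t f)‖ ≤ Real.sqrt (∫ s, f s ^ 2) := by
  refine Real.le_sqrt_of_sq_le ?_
  rw [norm_toL2_sq (memLp_cutoff hf t)]
  refine integral_mono (memLp_cutoff hf t).integrable_sq hf.integrable_sq fun s => ?_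
  by_cases h : t ≤ s <;> simp [cutoff, h, sq_nonneg]

namespace IsMonotoneKernel

lemma norm_costate_le (hK : IsMonotoneKernel K C) (hε : 0 < ε) (t : Time T) :
    ‖costate K ε t‖ ≤ (2 * ε)⁻¹ * Real.sqrt C := by
  refine (hK.norm_inverse_le hε t _).trans ?_
  gcongr
  exact (norm_toL2_cutoff_le (hK.col_memLp t) t).trans (Real.sqrt_le_sqrt (hK.col_le t))

/-- The cutoff time and the column are kept as separate variables: the diagonal enters the costate,
while the off-diagonal values enter its pairing with other columns. -/
lemma stronglyMeasurable_toL2_cutoff (hK : IsMonotoneKernel K C) :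
    StronglyMeasurable fun p : Time T × Time T => toL2 (cutoff p.1 fun r => K r p.2) := by
  have hm : Measurable (Function.uncurry fun (p : Time T × Time T) (r : Time T) =>
      cutoff p.1 (fun r => K r p.2) r) := by
    unfold cutoff
    refine Measurable.ite (measurableSet_le (by fun_prop) (by fun_prop)) ?_ measurable_const
    exact hK.measurable.comp (by fun_prop : Measurable fun q : (Time T × Time T) × Time T =>
      (q.2, q.1.2))
  have h2 := fun p : Time T × Time T => memLp_cutoff (hK.col_memLp p.2) p.1
  have := stronglyMeasurable_toLp hm h2
  convert this using 2 with p
  exact toL2_eq (h2 p)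

lemma stronglyMeasurable_costate (hK : IsMonotoneKernel K C) (hε : 0 < ε) :
    StronglyMeasurable (costate K ε) := by
  have h1 : StronglyMeasurable fun t : Time T => toL2 (cutoff t fun r => K r t) :=
    hK.stronglyMeasurable_toL2_cutoff.comp_measurable (measurable_id.prodMk measurable_id)
  have h2 := (hK.continuous_inverse hε).stronglyMeasurable
  exact isBoundedBilinearMap_apply.continuous.comp_stronglyMeasurable (h2.prodMk h1)

lemma measurable_costatePairing (hK : IsMonotoneKernel K C) (hε : 0 < ε) :
    Measurable fun p : Time T × Time T => costatePairing K ε p.1 fun r => K r p.2 :=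
  (((hK.stronglyMeasurable_costate hε).comp_measurable measurable_fst).inner
    hK.stronglyMeasurable_toL2_cutoff).measurable

lemma abs_costatePairing_le (hK : IsMonotoneKernel K C) (hε : 0 < ε) (t s : Time T) :
    |costatePairing K ε t fun r => K r s| ≤ (2 * ε)⁻¹ * C := by
  have hC : 0 ≤ C := (integral_nonneg fun _ => sq_nonneg _).trans (hK.col_le t)
  calc |costatePairing K ε t fun r => K r s|
      ≤ ‖costate K ε t‖ * ‖toL2 (cutoff t fun r => K r s)‖ := abs_real_inner_le_norm _ _
    _ ≤ ((2 * ε)⁻¹ * Real.sqrt C) * Real.sqrt C := by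
        gcongr
        · exact hK.norm_costate_le hε t
        · exact (norm_toL2_cutoff_le (hK.col_memLp s) t).trans (Real.sqrt_le_sqrt (hK.col_le s))
    _ = (2 * ε)⁻¹ * C := by rw [mul_assoc, Real.mul_self_sqrt hC]

lemma measurable_volterraKernel (hK : IsMonotoneKernel K C) (hε : 0 < ε) :
    Measurable (Function.uncurry (volterraKernel K ε)) :=
  Measurable.ite (measurableSet_le measurable_snd measurable_fst)
    (((hK.measurable_costatePairing hε).sub hK.measurable).const_mul _) measurable_const

/-- The pairing in the kernel is bounded by `(2ε)⁻¹ C`, so only the rows of `K` can be unbounded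
functions, and their `L²` norms are controlled uniformly. The resulting bound on rows drives the
Gronwall argument. -/
lemma exists_integral_volterraKernel_le (hK : IsMonotoneKernel K C) (hε : 0 < ε) :
    ∃ C', 0 ≤ C' ∧ ∀ t, MemLp (volterraKernel K ε t) 2 (volume : Measure (Time T)) ∧
      ∫ s, volterraKernel K ε t s ^ 2 ≤ C' := by
  have hb : ∀ t s, volterraKernel K ε t s ^ 2
      ≤ (1 / (2 * ε)) ^ 2 * 2 * (((2 * ε)⁻¹ * C) ^ 2 + K t s ^ 2) := by
    intro t s
    have h1 := sq_abs (costatePairing K ε t fun r => K r s)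
    have h2 := pow_le_pow_left₀ (abs_nonneg _) (hK.abs_costatePairing_le hε t s) 2
    rw [h1] at h2
    have h3 : (costatePairing K ε t (fun r => K r s) - K t s) ^ 2
        ≤ 2 * (((2 * ε)⁻¹ * C) ^ 2 + K t s ^ 2) := by
      nlinarith [sq_nonneg (costatePairing K ε t (fun r => K r s) + K t s)]
    by_cases h : s ≤ t
    · simp only [volterraKernel, h, if_true]
      rw [mul_pow, mul_assoc]
      exact mul_le_mul_of_nonneg_left h3 (by positivity)
    · simp only [volterraKernel, h, if_false]
      rw [zero_pow two_ne_zero]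
      positivity
  have hi : ∀ t, Integrable fun s => (1 / (2 * ε)) ^ 2 * 2 * (((2 * ε)⁻¹ * C) ^ 2 + K t s ^ 2) :=
    fun t => ((integrable_const _).add (hK.row_memLp t).integrable_sq).const_mul _
  have hm : ∀ t, AEStronglyMeasurable (volterraKernel K ε t) (volume : Measure (Time T)) :=
    fun t => ((hK.measurable_volterraKernel hε).comp measurable_prodMk_left).aestronglyMeasurable
  have hC : ∀ _ : Time T, 0 ≤ C :=
    fun t => (integral_nonneg fun _ => sq_nonneg _).trans (hK.col_le t)
  -- Using `|C|` makes the constant nonnegative even when no point of the time interval is available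
  -- to show `0 ≤ C`.
  refine ⟨(1 / (2 * ε)) ^ 2 * 2 * ((volume : Measure (Time T)).real univ * ((2 * ε)⁻¹ * C) ^ 2
    + |C|), by positivity, fun t => ?_⟩
  have hsq : Integrable fun s => volterraKernel K ε t s ^ 2 := by
    refine (hi t).mono' ((hm t).pow 2) (ae_of_all _ fun s => ?_)
    rw [Real.norm_of_nonneg (sq_nonneg _)]
    exact hb t s
  refine ⟨(memLp_two_iff_integrable_sq (hm t)).2 hsq, ?_⟩
  refine (integral_mono hsq (hi t) (hb t)).trans ?_
  rw [integral_const_mul, integral_add (integrable_const _) (hK.row_memLp t).integrable_sq,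
    integral_const, smul_eq_mul]
  gcongr
  exact (hK.row_le t).trans (le_abs_self C)

lemma coeFn_truncSymmOp_costate (hK : IsMonotoneKernel K C) (hε : 0 < ε) (t : Time T) :
    ∀ᵐ s, 2 * ε * costate K ε t s + (∫ r, truncKernel K t s r * costate K ε t r)
      + (∫ r, truncKernel K t r s * costate K ε t r) = cutoff t (fun r => K r t) s := by
  have h1 : truncSymmOp K ε t (costate K ε t) = toL2 (cutoff t fun r => K r t) :=
    hK.truncSymmOp_inverse hε t _
  have h2 := coeFn_symmOp (hK.sqInt.trunc t) ε (costate K ε t)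
  rw [← truncSymmOp_eq, h1] at h2
  filter_upwards [h2, coeFn_toL2 (memLp_cutoff (hK.col_memLp t) t)] with s h3 h4
  rw [← h3, h4]

/-- At `s < t` causality kills the row of the truncated kernel, truncation kills its column, and the
right-hand side is cut off. What is left of the defining equation is `2ε` times the costate. -/
lemma costate_eq_zero (hK : IsMonotoneKernel K C) (hε : 0 < ε) (t : Time T) :
    ∀ᵐ s, s < t → costate K ε t s = 0 := by
  filter_upwards [hK.coeFn_truncSymmOp_costate hε t] with s hs hst
  have h1 : ∀ r, truncKernel K t s r = 0 := by
    intro r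
    by_cases hr : t ≤ r
    · simp [truncKernel, hr, hK.causal s r (hst.trans_le hr)]
    · simp [truncKernel, hr]
  have h2 : ∀ r, truncKernel K t r s = 0 := fun r => by simp [truncKernel, not_le.2 hst]
  simp only [h1, h2, cutoff, not_le.2 hst, if_false, zero_mul, integral_zero, add_zero] at hs
  exact (mul_eq_zero.1 hs).resolve_left (by positivity)

/-- The costate solves its equation for the truncated operator. Since it lives on `[t,T]`, removing
the truncation changes nothing from `t` on; before `t` only the adjoint part survives, and it reads
off the pairing with the column `K(·,s)`. -/
lemma coeFn_symmOp_costate (hK : IsMonotoneKernel K C) (hε : 0 < ε) (t : Time T) :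
    ∀ᵐ s, symmOp K ε (costate K ε t) s
      = K s t + (Iio t).indicator (fun s => costatePairing K ε t fun r => K r s) s := by
  filter_upwards [coeFn_symmOp hK.sqInt ε (costate K ε t), hK.coeFn_truncSymmOp_costate hε t,
    hK.costate_eq_zero hε t] with s h1 h2 h3
  have h0 := hK.costate_eq_zero hε t
  rw [h1]
  rcases lt_or_ge s t with hst | hst
  · have h4 : ∫ r, K s r * costate K ε t r = 0 := by
      rw [← integral_zero (Time T) ℝ]
      refine integral_congr_ae ?_
      filter_upwards [h0] with r hr
      rcases lt_or_ge r t with h | h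
      · simp [hr h]
      · simp [hK.causal s r (hst.trans_le h)]
    rw [h3 hst, h4, hK.causal s t hst, indicator_of_mem (mem_Iio.2 hst),
      costatePairing_eq_integral (hK.col_memLp s)]
    simp only [mul_zero, zero_add]
    refine integral_congr_ae ?_
    filter_upwards [h0] with r hr
    rcases lt_or_ge r t with h | h
    · simp [hr h]
    · simp [cutoff, h, mul_comm]
  · have h4 : ∫ r, truncKernel K t s r * costate K ε t r = ∫ r, K s r * costate K ε t r := by
      refine integral_congr_ae ?_
      filter_upwards [h0] with r hr
      rcases lt_or_ge r t with h | h
      · simp [hr h]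
      · simp [truncKernel, h]
    rw [h4] at h2
    simp only [truncKernel, cutoff, hst, if_true] at h2
    rw [h2, indicator_of_notMem (by simpa using hst), add_zero]

/-- Symmetry moves the operator onto the costate. The result splits into the anticipating integral
of `f` against `K(·,t)` and an integral over the past of `t`. -/
lemma inner_costate_symmOp (hK : IsMonotoneKernel K C) (hε : 0 < ε) (t : Time T) (f : L2 T) :
    inner ℝ (costate K ε t) (symmOp K ε f) = (∫ s, K s t * f s)
      + ∫ s in Iic t, costatePairing K ε t (fun r => K r s) * f s := by
  have hf : Integrable (fun s => f s) (volume : Measure (Time T)) :=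
    (Lp.memLp f).integrable one_le_two
  have hi1 : Integrable fun s => K s t * f s := (hK.col_memLp t).integrable_mul (Lp.memLp f)
  have hi2 : Integrable fun s => costatePairing K ε t (fun r => K r s) * f s := by
    refine hf.bdd_mul (c := (2 * ε)⁻¹ * C) ?_ (ae_of_all _ (hK.abs_costatePairing_le hε t))
    exact ((hK.measurable_costatePairing hε).comp measurable_prodMk_left).aestronglyMeasurable
  rw [← inner_symmOp_left hK.sqInt, inner_L2, ← integral_indicator measurableSet_Iic,
    ← integral_add hi1 (hi2.indicator measurableSet_Iic)]
  refine integral_congr_ae ?_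
  filter_upwards [hK.coeFn_symmOp_costate hε t, ae_ne_time t] with s hs hne
  rw [hs]
  by_cases h : s < t
  · simp [h, h.le, add_mul]
  · have h2 : ¬ s ≤ t := fun h' => h (lt_of_le_of_ne h' hne)
    simp [h, h2]

lemma setIntegral_Iic (hK : IsMonotoneKernel K C) (t : Time T) (f : Time T → ℝ) :
    ∫ s in Iic t, K t s * f s = ∫ s, K t s * f s := by
  rw [← integral_indicator measurableSet_Iic]
  congr 1
  funext s
  by_cases h : s ≤ t
  · simp [h]
  · simp [h, hK.causal t s (not_le.1 h)]

/-- The anticipating part of the first order condition, after elimination by the costate. -/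
lemma integral_symm_kernel (hK : IsMonotoneKernel K C) (hε : 0 < ε) (t : Time T) (f : L2 T) :
    ∫ s, (K t s + K s t) * f s = inner ℝ (costate K ε t) (symmOp K ε f)
      - 2 * ε * ∫ s in Iic t, volterraKernel K ε t s * f s := by
  have hf : Integrable (fun s => f s) (volume : Measure (Time T)) :=
    (Lp.memLp f).integrable one_le_two
  have hi0 : Integrable fun s => K t s * f s := (hK.row_memLp t).integrable_mul (Lp.memLp f)
  have hi1 : Integrable fun s => K s t * f s := (hK.col_memLp t).integrable_mul (Lp.memLp f)
  have hi2 : Integrable fun s => costatePairing K ε t (fun r => K r s) * f s := by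
    refine hf.bdd_mul (c := (2 * ε)⁻¹ * C) ?_ (ae_of_all _ (hK.abs_costatePairing_le hε t))
    exact ((hK.measurable_costatePairing hε).comp measurable_prodMk_left).aestronglyMeasurable
  have h1 : 2 * ε * ∫ s in Iic t, volterraKernel K ε t s * f s
      = (∫ s in Iic t, costatePairing K ε t (fun r => K r s) * f s) - ∫ s, K t s * f s := by
    rw [← hK.setIntegral_Iic, ← integral_const_mul,
      ← integral_sub hi2.integrableOn hi0.integrableOn]
    refine setIntegral_congr_fun measurableSet_Iic fun s hs => ?_
    have hs' : s ≤ t := hs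
    simp only [volterraKernel, hs', if_true]
    field_simp
  rw [h1, hK.inner_costate_symmOp hε]
  simp_rw [add_mul]
  rw [integral_add hi0 hi1]
  ring

end IsMonotoneKernel

end VolterraKernel

/-! ### Quadratic identities for running integrals and exponential kernels. -/

section RunningIntegral

variable {T : ℝ}

/-- The running integral `t ↦ ∫₀ᵗ F`. -/
noncomputable def runningIntegral (F : Time T → ℝ) (t : Time T) : ℝ := ∫ s in Iic t, F s

lemma ae_fst_ne_snd :
    ∀ᵐ p : Time T × Time T ∂((volume : Measure (Time T)).prod volume), p.1 ≠ p.2 := by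
  refine (Measure.ae_prod_iff_ae_ae (p := fun p : Time T × Time T => p.1 ≠ p.2)
    (measurableSet_eq_fun measurable_fst measurable_snd).compl).2 (ae_of_all _ fun t => ?_)
  filter_upwards [ae_ne_time t] with s hs
  exact fun h => hs h.symm

lemma runningIntegral_eq_integral (F : Time T → ℝ) (t : Time T) :
    runningIntegral F t = ∫ s, (Iic t).indicator F s :=
  (integral_indicator measurableSet_Iic).symm

lemma abs_runningIntegral_le {F : Time T → ℝ} (hF : Integrable F) (t : Time T) :
    |runningIntegral F t| ≤ ∫ s, |F s| := by
  refine (abs_integral_le_integral_abs).trans ?_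
  exact setIntegral_le_integral hF.abs (ae_of_all _ fun _ => abs_nonneg _)

lemma aestronglyMeasurable_runningIntegral {F : Time T → ℝ} (hF : Integrable F) :
    AEStronglyMeasurable (runningIntegral F) (volume : Measure (Time T)) := by
  have h : AEStronglyMeasurable (fun p : Time T × Time T =>
      {p : Time T × Time T | p.2 ≤ p.1}.indicator (fun p => F p.2) p)
      ((volume : Measure (Time T)).prod volume) :=
    (hF.1.comp_snd).indicator (measurableSet_le measurable_snd measurable_fst)
  refine (h.integral_prod_right').congr (ae_of_all _ fun t => ?_)
  rw [runningIntegral_eq_integral]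
  rfl

lemma integrable_mul_runningIntegral {F : Time T → ℝ} (hF : Integrable F) :
    Integrable fun t => F t * runningIntegral F t :=
  hF.mul_bdd (c := ∫ s, |F s|) (aestronglyMeasurable_runningIntegral hF)
    (ae_of_all _ fun t => abs_runningIntegral_le hF t)

/-- The square `[0,r]²` is split along its null diagonal into two triangles of equal integral. This
replaces differentiating `½(∫F)²`, as `F` is merely integrable. -/
lemma integral_Iic_mul_runningIntegral {F : Time T → ℝ} (hF : Integrable F) (r : Time T) :
    ∫ t in Iic r, F t * runningIntegral F t = 1 / 2 * runningIntegral F r ^ 2 := by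
  set H := (Iic r).indicator F with hH
  have hHi : Integrable H := hF.indicator measurableSet_Iic
  set g : Time T × Time T → ℝ := fun p => H p.1 * H p.2 with hg
  have hgi : Integrable g ((volume : Measure (Time T)).prod volume) := hHi.mul_prod hHi
  set D : Set (Time T × Time T) := {p | p.2 ≤ p.1} with hD
  set D' : Set (Time T × Time T) := {p | p.1 ≤ p.2} with hD'
  have hDm : MeasurableSet D := measurableSet_le measurable_snd measurable_fst
  have hDm' : MeasurableSet D' := measurableSet_le measurable_fst measurable_snd
  have hsum : (∫ p, D.indicator g p ∂((volume : Measure (Time T)).prod volume))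
      + ∫ p, D'.indicator g p ∂((volume : Measure (Time T)).prod volume)
      = runningIntegral F r ^ 2 := by
    rw [← integral_add (hgi.indicator hDm) (hgi.indicator hDm'), sq, runningIntegral_eq_integral,
      ← integral_prod_mul]
    refine integral_congr_ae ?_
    filter_upwards [ae_fst_ne_snd] with p hp
    rcases lt_or_gt_of_ne hp with h | h
    · simp [hD, hD', h.le, not_le.2 h, hg, hH]
    · simp [hD, hD', h.le, not_le.2 h, hg, hH]
  have hswap : ∫ p, D'.indicator g p ∂((volume : Measure (Time T)).prod volume)
      = ∫ p, D.indicator g p ∂((volume : Measure (Time T)).prod volume) := by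
    rw [← integral_prod_swap]
    refine integral_congr_ae (ae_of_all _ fun p => ?_)
    by_cases h : p.2 ≤ p.1
    · simp [hD, hD', h, hg, mul_comm]
    · simp [hD, hD', h]
  have hI : ∫ t in Iic r, F t * runningIntegral F t
      = ∫ p, D.indicator g p ∂((volume : Measure (Time T)).prod volume) := by
    rw [integral_prod _ (hgi.indicator hDm), ← integral_indicator measurableSet_Iic]
    refine integral_congr_ae (ae_of_all _ fun t => ?_)
    by_cases ht : t ≤ r
    · simp only [mem_Iic, ht, indicator_of_mem]
      rw [runningIntegral_eq_integral, ← integral_const_mul]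
      refine integral_congr_ae (ae_of_all _ fun s => ?_)
      by_cases hs : s ≤ t
      · simp [hD, hg, hH, hs, hs.trans ht, ht]
      · simp [hD, hs]
    · simp only [mem_Iic, ht, not_false_eq_true, indicator_of_notMem]
      refine ((integral_eq_zero_of_ae (ae_of_all _ fun s => ?_))).symm
      by_cases hs : s ≤ t <;> simp [hD, hg, hH, hs, ht]
  rw [hI]
  linarith

/-- Writing the weight as the tail of `w` and applying Fubini reduces to the unweighted identity on
each `[0,r]`. A decreasing weight thereby becomes a positive superposition of squares. -/
lemma integral_mul_mul_runningIntegral {F w : Time T → ℝ} (hF : Integrable F) (hw : Integrable w) :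
    ∫ t, (∫ r in Ici t, w r) * (F t * runningIntegral F t)
      = 1 / 2 * ∫ r, w r * runningIntegral F r ^ 2 := by
  have hi : Integrable (fun p : Time T × Time T => {p : Time T × Time T | p.1 ≤ p.2}.indicator
      (fun p => F p.1 * runningIntegral F p.1 * w p.2) p)
      ((volume : Measure (Time T)).prod volume) :=
    ((integrable_mul_runningIntegral hF).mul_prod hw).indicator
      (measurableSet_le measurable_fst measurable_snd)
  have h1 : ∫ t, (∫ r in Ici t, w r) * (F t * runningIntegral F t)
      = ∫ t, ∫ r, {p : Time T × Time T | p.1 ≤ p.2}.indicator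
      (fun p => F p.1 * runningIntegral F p.1 * w p.2) (t, r) := by
    refine integral_congr_ae (ae_of_all _ fun t => ?_)
    beta_reduce
    rw [mul_comm, ← integral_const_mul, ← integral_indicator measurableSet_Ici]
    refine integral_congr_ae (ae_of_all _ fun r => ?_)
    by_cases h : t ≤ r <;> simp [h]
  have hsw := integral_integral_swap (f := fun t r => {p : Time T × Time T | p.1 ≤ p.2}.indicator
      (fun p => F p.1 * runningIntegral F p.1 * w p.2) (t, r)) hi
  rw [h1, hsw, ← integral_const_mul]
  refine integral_congr_ae (ae_of_all _ fun r => ?_)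
  beta_reduce
  have h2 : ∫ t, {p : Time T × Time T | p.1 ≤ p.2}.indicator
      (fun p => F p.1 * runningIntegral F p.1 * w p.2) (t, r)
      = (∫ t in Iic r, F t * runningIntegral F t) * w r := by
    rw [← integral_mul_const, ← integral_indicator measurableSet_Iic]
    refine integral_congr_ae (ae_of_all _ fun t => ?_)
    by_cases h : t ≤ r <;> simp [h]
  rw [h2, integral_Iic_mul_runningIntegral hF]
  ring

lemma integral_Ici_eq {g : ℝ → ℝ} (t : Time T) :
    ∫ r : Time T in Ici t, g r = ∫ r in (t : ℝ)..T, g r := by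
  rw [← integral_indicator measurableSet_Ici, intervalIntegral.integral_of_le t.2.2,
    ← integral_Icc_eq_integral_Ioc, ← integral_indicator measurableSet_Icc]
  have h1 : ∀ r : Time T, (Ici t).indicator (fun r : Time T => g r) r
      = (Icc (t : ℝ) T).indicator g r := by
    intro r
    by_cases h : t ≤ r
    · rw [indicator_of_mem (mem_Ici.2 h), indicator_of_mem (show (r:ℝ) ∈ Icc (t:ℝ) T from ⟨h, r.2.2⟩)]
    · rw [indicator_of_notMem (by simpa using h), indicator_of_notMem]
      exact fun h' => h h'.1
  simp_rw [h1]
  rw [integral_subtype measurableSet_Icc ((Icc (t : ℝ) T).indicator g),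
    setIntegral_indicator measurableSet_Icc, integral_indicator measurableSet_Icc]
  congr 2
  exact inter_eq_right.2 (Icc_subset_Icc t.2.1 le_rfl)

lemma integral_sub_mul_runningIntegral {F : Time T → ℝ} (hF : Integrable F) :
    ∫ t : Time T, (T - t) * (F t * runningIntegral F t)
      = 1 / 2 * ∫ r, runningIntegral F r ^ 2 := by
  have h := integral_mul_mul_runningIntegral hF (integrable_const (1:ℝ))
  simp only [one_mul] at h
  rw [← h]
  refine integral_congr_ae (ae_of_all _ fun t => ?_)
  have := integral_Ici_eq (g := fun _ => 1) t
  simp only [intervalIntegral.integral_const, smul_eq_mul, mul_one] at this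
  simp only [this]

/-- Exponential kernels are of positive type. -/
lemma integral_exp_kernel_nonneg [Fact (0 ≤ T)] {f : Time T → ℝ} (hf : Integrable f) {z : ℝ} (hz : 0 ≤ z) :
    0 ≤ ∫ t : Time T, f t * ∫ s in Iic t, Real.exp (-(z * ((t : ℝ) - s))) * f s := by
  -- The exponential kernel factorises: in terms of `F` the integrand is `e^{-2zt} F(t) ∫₀ᵗ F`.
  set F : Time T → ℝ := fun s => Real.exp (z * s) * f s with hFdef
  have hFi : Integrable F := by
    refine hf.bdd_mul (c := Real.exp (z * T)) (by fun_prop) (ae_of_all _ fun s => ?_)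
    rw [Real.norm_of_nonneg (Real.exp_nonneg _)]
    exact Real.exp_le_exp.2 (mul_le_mul_of_nonneg_left s.2.2 hz)
  -- The density whose tail on `[t,T]` is `e^{-2zt} - e^{-2zT}`. The missing constant `e^{-2zT}`
  -- multiplies the unweighted form, which is half the square of the total integral.
  set w : Time T → ℝ := fun r => 2 * z * Real.exp (-(2 * z * r)) with hw
  have hwi : Integrable w := by
    refine Integrable.of_bound (C := 2 * z) (by fun_prop) (ae_of_all _ fun r => ?_)
    rw [Real.norm_of_nonneg (by positivity)]
    have h1 : Real.exp (-(2 * z * r)) ≤ 1 := by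
      rw [Real.exp_le_one_iff]
      have := r.2.1
      have h2 : 0 ≤ 2 * z * (r:ℝ) := by positivity
      linarith
    exact mul_le_of_le_one_right (by positivity) h1
  have hW : ∀ t : Time T, ∫ r in Ici t, w r = Real.exp (-(2 * z * t)) - Real.exp (-(2 * z * T)) := by
    intro t
    rw [integral_Ici_eq (g := fun r => 2 * z * Real.exp (-(2 * z * r))) t]
    have hd : ∀ r ∈ uIcc (t:ℝ) T, HasDerivAt (fun r => -Real.exp (-(2 * z * r)))
        (2 * z * Real.exp (-(2 * z * r))) r := by
      intro r _
      have h1 : HasDerivAt (fun r : ℝ => -(2 * z * r)) (-(2 * z)) r := by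
        simpa using ((hasDerivAt_id' r).const_mul (2 * z)).fun_neg
      have h2 := h1.exp.fun_neg
      rwa [mul_neg, neg_neg, mul_comm (Real.exp _)] at h2
    rw [intervalIntegral.integral_eq_sub_of_hasDerivAt hd
      (Continuous.intervalIntegrable (by fun_prop) _ _)]
    ring
  have key : ∫ t : Time T, f t * ∫ s in Iic t, Real.exp (-(z * ((t : ℝ) - s))) * f s
      = (∫ t, (∫ r in Ici t, w r) * (F t * runningIntegral F t))
        + Real.exp (-(2 * z * T)) * ∫ t, F t * runningIntegral F t := by
    have hi1 : Integrable fun t => (∫ r in Ici t, w r) * (F t * runningIntegral F t) := by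
      refine (integrable_mul_runningIntegral hFi).bdd_mul (c := 1 + 1) ?_ (ae_of_all _ fun t => ?_)
      · simp_rw [hW]
        fun_prop
      · rw [hW]
        refine (norm_sub_le _ _).trans ?_
        have h0 : 0 ≤ T := t.2.1.trans t.2.2
        have h1 := t.2.1
        rw [Real.norm_of_nonneg (Real.exp_nonneg _), Real.norm_of_nonneg (Real.exp_nonneg _)]
        refine add_le_add ?_ ?_ <;>
        · rw [Real.exp_le_one_iff, neg_nonpos]
          positivity
    rw [← integral_const_mul, ← integral_add hi1 ((integrable_mul_runningIntegral hFi).const_mul _)]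
    refine integral_congr_ae (ae_of_all _ fun t => ?_)
    have h2 : ∫ s in Iic t, Real.exp (-(z * ((t : ℝ) - s))) * f s
        = Real.exp (-(z * t)) * runningIntegral F t := by
      rw [runningIntegral, ← integral_const_mul]
      refine integral_congr_ae (ae_of_all _ fun s => ?_)
      simp only [hFdef]
      rw [← mul_assoc, ← Real.exp_add]
      ring_nf
    have h3 : f t = Real.exp (-(z * t)) * F t := by
      simp only [hFdef]
      rw [← mul_assoc, ← Real.exp_add, neg_add_cancel, Real.exp_zero, one_mul]
    have h4 : Real.exp (-(2 * z * t)) = Real.exp (-(z * t)) * Real.exp (-(z * t)) := by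
      rw [← Real.exp_add]
      ring_nf
    beta_reduce
    rw [h2, h3, hW, h4]
    ring
  rw [key, integral_mul_mul_runningIntegral hFi hwi]
  have hT : 0 ≤ ∫ t, F t * runningIntegral F t := by
    have h5 := integral_Iic_mul_runningIntegral hFi ⊤
    rw [Iic_top, Measure.restrict_univ] at h5
    rw [h5]
    positivity
  have h6 : 0 ≤ ∫ r, w r * runningIntegral F r ^ 2 :=
    integral_nonneg fun r => by positivity
  positivity

end RunningIntegral

/-! ### Positive type and square integrability of the propagators. -/

section Propagator

variable {T : ℝ}

lemma integral_prod_lower {g : Time T → Time T → ℝ} {f : Time T → ℝ}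
    (hi : Integrable (fun p : Time T × Time T => (if p.2 ≤ p.1 then g p.1 p.2 else 0)
      * (f p.1 * f p.2)) ((volume : Measure (Time T)).prod volume)) :
    ∫ p : Time T × Time T, (if p.2 ≤ p.1 then g p.1 p.2 else 0) * (f p.1 * f p.2)
      ∂((volume : Measure (Time T)).prod volume) = ∫ t, f t * ∫ s in Iic t, g t s * f s := by
  rw [integral_prod _ hi]
  refine integral_congr_ae (ae_of_all _ fun t => ?_)
  beta_reduce
  rw [← integral_indicator measurableSet_Iic, ← integral_const_mul]
  refine integral_congr_ae (ae_of_all _ fun s => ?_)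
  by_cases h : s ≤ t
  · simp [h]; ring
  · simp [h]

lemma integral_prod_exp_nonneg [Fact (0 ≤ T)] {f : Time T → ℝ} (hf : Integrable f) {z : ℝ}
    (hz : 0 ≤ z) :
    0 ≤ ∫ p : Time T × Time T, (if p.2 ≤ p.1 then Real.exp (-(z * ((p.1 : ℝ) - p.2))) else 0)
      * (f p.1 * f p.2) ∂((volume : Measure (Time T)).prod volume) := by
  rw [integral_prod_lower (g := fun t s => Real.exp (-(z * ((t : ℝ) - s))))]
  · exact integral_exp_kernel_nonneg hf hz
  · refine (hf.mul_prod hf).bdd_mul (c := 1) ?_ (ae_of_all _ fun p => ?_)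
    · exact (Measurable.ite (measurableSet_le measurable_snd measurable_fst) (by fun_prop)
        measurable_const).aestronglyMeasurable
    · by_cases h : p.2 ≤ p.1
      · have h' : (p.2 : ℝ) ≤ p.1 := h
        rw [if_pos h, Real.norm_of_nonneg (Real.exp_nonneg _), Real.exp_le_one_iff, neg_nonpos]
        exact mul_nonneg hz (sub_nonneg.2 h')
      · simp [h]

/-- Mixtures of exponential kernels are of positive type. -/
lemma integral_mixture_nonneg [Fact (0 ≤ T)] {g ρ : ℝ → ℝ} (hρm : Measurable ρ)
    (hρ : ∀ z ∈ Ioi (0 : ℝ), 0 ≤ ρ z) {c : ℝ} (hc : 0 < c)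
    (hg : ∀ τ ∈ Ioc 0 T, ∫ z in Ioi (0 : ℝ), ρ z * Real.exp (-(z * τ)) = c * g τ)
    (hint : ∀ τ ∈ Ioc 0 T, IntegrableOn (fun z => ρ z * Real.exp (-(z * τ))) (Ioi 0))
    {f : Time T → ℝ} (hf : Integrable f) (hfm : Measurable f)
    (hi : Integrable (fun p : Time T × Time T => (if p.2 ≤ p.1 then g ((p.1 : ℝ) - p.2) else 0)
      * (f p.1 * f p.2)) ((volume : Measure (Time T)).prod volume)) :
    0 ≤ ∫ p : Time T × Time T, (if p.2 ≤ p.1 then g ((p.1 : ℝ) - p.2) else 0)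
      * (f p.1 * f p.2) ∂((volume : Measure (Time T)).prod volume) := by
  set H : Time T × Time T → ℝ → ℝ := fun p z =>
    ρ z * ((if p.2 ≤ p.1 then Real.exp (-(z * ((p.1 : ℝ) - p.2))) else 0) * (f p.1 * f p.2)) with hH
  have hmem : ∀ p : Time T × Time T, p.2 < p.1 → (p.1 : ℝ) - p.2 ∈ Ioc 0 T := by
    intro p hp
    have h1 : (p.2 : ℝ) < p.1 := hp
    exact ⟨by linarith, by linarith [p.1.2.2, p.2.2.1]⟩
  have hHm : Measurable (Function.uncurry H) := by
    refine (hρm.comp measurable_snd).mul (Measurable.mul (Measurable.ite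
      (measurableSet_le (by fun_prop) (by fun_prop)) (by fun_prop) measurable_const) ?_)
    exact (hfm.comp (measurable_fst.comp measurable_fst)).mul
      (hfm.comp (measurable_snd.comp measurable_fst))
  have hsec : ∀ p : Time T × Time T, p.2 < p.1 → H p = fun z =>
      ρ z * Real.exp (-(z * ((p.1 : ℝ) - p.2))) * (f p.1 * f p.2) := by
    intro p hp
    funext z
    simp only [hH, hp.le, if_true, mul_assoc]
  have hsec0 : ∀ p : Time T × Time T, p.1 < p.2 → H p = fun _ => 0 := by
    intro p hp
    funext z
    simp [hH, not_le.2 hp]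
  have hHi : Integrable (Function.uncurry H)
      (((volume : Measure (Time T)).prod volume).prod (volume.restrict (Ioi (0 : ℝ)))) := by
    refine (integrable_prod_iff hHm.aestronglyMeasurable).2 ⟨?_, ?_⟩
    · filter_upwards [ae_fst_ne_snd] with p hp
      change Integrable (H p) (volume.restrict (Ioi (0 : ℝ)))
      rcases lt_or_gt_of_ne hp with h | h
      · rw [hsec0 p h]
        exact integrable_zero _ _ _
      · rw [hsec p h]
        exact (hint _ (hmem p h)).mul_const _
    -- As the mixture has nonnegative weights, the absolute integral in `z` is computed exactly and
    -- is the norm of the given integrand times `c`. The formula is needed only for positive lags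
    -- because the diagonal is null; this is what admits singular kernels.
    · refine (hi.const_mul c).norm.congr ?_
      filter_upwards [ae_fst_ne_snd] with p hp
      change _ = ∫ z in Ioi (0 : ℝ), ‖H p z‖
      rcases lt_or_gt_of_ne hp with h | h
      · simp [hsec0 p h, not_le.2 h]
      · have h1 : 0 ≤ c * g ((p.1 : ℝ) - p.2) := by
          rw [← hg _ (hmem p h)]
          exact setIntegral_nonneg measurableSet_Ioi fun z hz =>
            mul_nonneg (hρ z hz) (Real.exp_nonneg _)
        have h2 : ∫ z in Ioi (0 : ℝ), ‖H p z‖ = ∫ z in Ioi (0 : ℝ),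
            ρ z * Real.exp (-(z * ((p.1 : ℝ) - p.2))) * ‖f p.1 * f p.2‖ := by
          refine setIntegral_congr_fun measurableSet_Ioi fun z hz => ?_
          rw [hsec p h]
          beta_reduce
          rw [norm_mul, Real.norm_of_nonneg (mul_nonneg (hρ z hz) (Real.exp_nonneg _))]
        rw [h2, integral_mul_const, hg _ (hmem p h), if_pos h.le, ← mul_assoc, norm_mul,
          Real.norm_of_nonneg h1]
  have hsw := integral_integral_swap hHi
  have h1 : ∫ p, (∫ z in Ioi (0 : ℝ), H p z) ∂((volume : Measure (Time T)).prod volume)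
      = c * ∫ p : Time T × Time T, (if p.2 ≤ p.1 then g ((p.1 : ℝ) - p.2) else 0)
        * (f p.1 * f p.2) ∂((volume : Measure (Time T)).prod volume) := by
    rw [← integral_const_mul]
    refine integral_congr_ae ?_
    filter_upwards [ae_fst_ne_snd] with p hp
    rcases lt_or_gt_of_ne hp with h | h
    · simp [hsec0 p h, not_le.2 h]
    · rw [hsec p h]
      beta_reduce
      rw [integral_mul_const, hg _ (hmem p h), if_pos h.le, mul_assoc]
  have h2 : 0 ≤ ∫ z in Ioi (0 : ℝ), ∫ p, H p z ∂((volume : Measure (Time T)).prod volume) := by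
    refine setIntegral_nonneg measurableSet_Ioi fun z hz => ?_
    simp only [hH]
    rw [integral_const_mul]
    exact mul_nonneg (hρ z hz) (integral_prod_exp_nonneg hf (le_of_lt hz))
  rw [← hsw, h1] at h2
  exact nonneg_of_mul_nonneg_right h2 hc

/-- The Gamma integral at rate `l + τ`, with `e^{-zl}` absorbed into the mixing density. -/
lemma rpow_eq_mixture {l γ τ : ℝ} (hγ : 0 < γ) (hτ : 0 < l + τ) :
    ∫ z in Ioi (0 : ℝ), z ^ (γ - 1) * Real.exp (-(z * l)) * Real.exp (-(z * τ))
      = Real.Gamma γ * (1 / (l + τ) ^ γ) := by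
  have h := Real.integral_rpow_mul_exp_neg_mul_Ioi hγ hτ
  rw [Real.div_rpow zero_le_one hτ.le, Real.one_rpow, mul_comm (1 / _)] at h
  rw [← h]
  refine integral_congr_ae (ae_of_all _ fun z => ?_)
  beta_reduce
  rw [mul_assoc, ← Real.exp_add]
  ring_nf

/-- The truncation of a propagator to `[0,T]`. -/
noncomputable def truncPropagator (T : ℝ) (G : ℝ → ℝ) : ℝ → ℝ := (Icc 0 T).indicator G

lemma IsPropagator.measurable {G : ℝ → ℝ} (hG : IsPropagator T G) :
    Measurable (truncPropagator T G) := by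
  have key : ∀ g : ℝ → ℝ, Measurable g → (∀ t ∈ Icc 0 T, G t = g t) →
      Measurable (truncPropagator T G) := by
    intro g hg h
    rw [truncPropagator, indicator_congr (g := g) h]
    exact hg.indicator measurableSet_Icc
  rcases hG with ⟨β, -, h⟩ | ⟨l, γ, -, -, h⟩ | ⟨γ, -, -, h⟩
  · exact key _ (by fun_prop) h
  · exact key _ (by fun_prop) h
  · exact key _ (by fun_prop) h

lemma IsPropagator.integrable_sq [hT : Fact (0 ≤ T)] {G : ℝ → ℝ} (hG : IsPropagator T G) :
    Integrable fun τ => truncPropagator T G τ ^ 2 := by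
  have h0 : (fun τ => truncPropagator T G τ ^ 2) = (Icc 0 T).indicator fun τ => G τ ^ 2 := by
    funext τ
    by_cases h : τ ∈ Icc 0 T <;> simp [truncPropagator, h]
  rw [h0, integrable_indicator_iff measurableSet_Icc]
  rcases hG with ⟨β, -, h⟩ | ⟨l, γ, hl, -, h⟩ | ⟨γ, h1, h2, h⟩
  · refine IntegrableOn.congr_fun (f := fun τ => Real.exp (-β * τ) ^ 2) ?_
      (fun t ht => by simp only [h t ht]) measurableSet_Icc
    exact Continuous.integrableOn_Icc (by fun_prop)
  · refine IntegrableOn.congr_fun (f := fun τ => (1 / (l + τ) ^ γ) ^ 2) ?_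
      (fun t ht => by simp only [h t ht]) measurableSet_Icc
    refine ContinuousOn.integrableOn_Icc ?_
    have hpos : ∀ τ ∈ Icc 0 T, 0 < l + τ := fun τ hτ => by linarith [hτ.1]
    refine (ContinuousOn.div continuousOn_const ?_ fun τ hτ =>
      (Real.rpow_pos_of_pos (hpos τ hτ) γ).ne').pow 2
    exact ContinuousOn.rpow_const (by fun_prop) fun τ hτ => Or.inl (hpos τ hτ).ne'
  -- The condition `γ < 1/2` enters here: the square of the singular propagator is `τ^{-2γ}`, with
  -- exponent above `-1`.
  · have h3 : IntegrableOn (fun τ : ℝ => τ ^ (-(2 * γ))) (Ioc 0 T) := by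
      have := intervalIntegral.intervalIntegrable_rpow' (a := 0) (b := T) (r := -(2 * γ))
        (by linarith)
      rwa [intervalIntegrable_iff_integrableOn_Ioc_of_le hT.out] at this
    rw [integrableOn_Icc_iff_integrableOn_Ioc]
    refine h3.congr_fun (fun τ hτ => ?_) measurableSet_Ioc
    simp only
    rw [h τ (Ioc_subset_Icc_self hτ), div_pow, one_pow, ← Real.rpow_mul_natCast hτ.1.le,
      Real.rpow_neg hτ.1.le, one_div]
    push_cast
    rw [mul_comm]

lemma IsPropagator.integral_nonneg [Fact (0 ≤ T)] {G : ℝ → ℝ} (hG : IsPropagator T G)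
    {f : Time T → ℝ} (hf : Integrable f) (hfm : Measurable f)
    (hi : Integrable (fun p : Time T × Time T => (if p.2 ≤ p.1 then G ((p.1 : ℝ) - p.2) else 0)
      * (f p.1 * f p.2)) ((volume : Measure (Time T)).prod volume)) :
    0 ≤ ∫ p : Time T × Time T, (if p.2 ≤ p.1 then G ((p.1 : ℝ) - p.2) else 0)
      * (f p.1 * f p.2) ∂((volume : Measure (Time T)).prod volume) := by
  have hpow : ∀ l γ : ℝ, 0 ≤ l → 0 < γ → (∀ t ∈ Icc 0 T, G t = 1 / (l + t) ^ γ) →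
      0 ≤ ∫ p : Time T × Time T, (if p.2 ≤ p.1 then G ((p.1 : ℝ) - p.2) else 0)
      * (f p.1 * f p.2) ∂((volume : Measure (Time T)).prod volume) := by
    intro l γ hl hγ h
    have hmix : ∀ τ ∈ Ioc 0 T, ∫ z in Ioi (0 : ℝ),
        z ^ (γ - 1) * Real.exp (-(z * l)) * Real.exp (-(z * τ)) = Real.Gamma γ * G τ := by
      intro τ hτ
      rw [rpow_eq_mixture hγ (by linarith [hτ.1]), h τ (Ioc_subset_Icc_self hτ)]
    refine integral_mixture_nonneg (ρ := fun z => z ^ (γ - 1) * Real.exp (-(z * l)))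
      (by fun_prop) (fun z hz => ?_) (Real.Gamma_pos_of_pos hγ) hmix (fun τ hτ => ?_) hf hfm hi
    · exact mul_nonneg (Real.rpow_nonneg (le_of_lt hz) _) (Real.exp_nonneg _)
    -- A non-integrable function has integral `0` by convention, so the strictly positive value
    -- already computed entails integrability.
    · refine Integrable.of_integral_ne_zero ?_
      rw [hmix τ hτ, h τ (Ioc_subset_Icc_self hτ)]
      have := Real.Gamma_pos_of_pos hγ
      have h2 := Real.rpow_pos_of_pos (by linarith [hτ.1] : 0 < l + τ) γ
      positivity
  rcases hG with ⟨β, hβ, h⟩ | ⟨l, γ, hl, hγ, h⟩ | ⟨γ, hγ, -, h⟩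
  · refine (integral_prod_exp_nonneg hf hβ.le).trans_eq ?_
    refine integral_congr_ae (ae_of_all _ fun p => ?_)
    by_cases hp : p.2 ≤ p.1
    · have h1 : (p.2 : ℝ) ≤ p.1 := hp
      simp only [hp, if_true]
      rw [h _ ⟨by linarith, by linarith [p.1.2.2, p.2.2.1]⟩, neg_mul]
    · simp [hp]
  · exact hpow l γ hl.le hγ h
  · exact hpow 0 γ le_rfl hγ (by simpa using h)

end Propagator

/-! ### The kernel of the control problem. -/

section ImpactKernel

variable {T : ℝ} {G : ℝ → ℝ} {lam φ ϱ : ℝ}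

lemma integrable_comp_coe {h : ℝ → ℝ} (hi : Integrable h) :
    Integrable fun s : Time T => h s :=
  ((measurePreserving_subtype_coe (μa := (volume : Measure ℝ)) measurableSet_Icc).integrable_comp_emb
    (MeasurableEmbedding.subtype_coe measurableSet_Icc) (g := h)).2 hi.integrableOn

lemma integral_comp_coe_le {h : ℝ → ℝ} (hi : Integrable h) (h0 : ∀ τ, 0 ≤ h τ) :
    ∫ s : Time T, h s ≤ ∫ τ, h τ := by
  rw [integral_subtype measurableSet_Icc]
  exact setIntegral_le_integral hi (ae_of_all _ h0)

/-- Extending the propagator by zero absorbs the causality indicator, so the kernel becomes a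
convolution kernel on the line. -/
lemma ite_propagator_eq (G : ℝ → ℝ) (t s : Time T) :
    (if s ≤ t then G ((t : ℝ) - s) else 0) = truncPropagator T G ((t : ℝ) - s) := by
  by_cases h : s ≤ t
  · have h' : (s : ℝ) ≤ t := h
    rw [if_pos h, truncPropagator, indicator_of_mem]
    exact ⟨by linarith, by linarith [t.2.2, s.2.1]⟩
  · rw [if_neg h, truncPropagator, indicator_of_notMem]
    intro h'
    have h2 : (s : ℝ) ≤ t := by linarith [h'.1]
    exact h h2

lemma kernelK_eq (t s : Time T) : kernelK G lam φ ϱ t s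
    = kernelC φ ϱ t s + lam * truncPropagator T G ((t : ℝ) - s) := by
  rw [kernelK, ← ite_propagator_eq]
  by_cases h : s ≤ t <;> simp [h]

lemma measurable_kernelC : Measurable (Function.uncurry (kernelC (T := T) φ ϱ)) :=
  Measurable.ite (measurableSet_le measurable_snd measurable_fst) (by fun_prop) measurable_const

lemma abs_kernelC_le (hφ : 0 ≤ φ) (hϱ : 0 ≤ ϱ) (t s : Time T) :
    |kernelC φ ϱ t s| ≤ 2 * ϱ + 2 * φ * T := by
  have h0 : 0 ≤ T := t.2.1.trans t.2.2
  by_cases h : s ≤ t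
  · have h1 : 0 ≤ T - (t:ℝ) := sub_nonneg.2 t.2.2
    simp only [kernelC, h, if_true]
    rw [abs_of_nonneg (by positivity)]
    have : T - (t:ℝ) ≤ T := by linarith [t.2.1]
    gcongr
  · simp only [kernelC, h, if_false, abs_zero]
    positivity

lemma memLp_kernelC_row (hφ : 0 ≤ φ) (hϱ : 0 ≤ ϱ) (t : Time T) :
    MemLp (kernelC φ ϱ t) 2 (volume : Measure (Time T)) :=
  MemLp.of_bound (measurable_kernelC.comp measurable_prodMk_left).aestronglyMeasurable _
    (ae_of_all _ fun s => abs_kernelC_le hφ hϱ t s)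

lemma memLp_kernelC_col (hφ : 0 ≤ φ) (hϱ : 0 ≤ ϱ) (s : Time T) :
    MemLp (fun t => kernelC φ ϱ t s) 2 (volume : Measure (Time T)) :=
  MemLp.of_bound (measurable_kernelC.comp measurable_prodMk_right).aestronglyMeasurable _
    (ae_of_all _ fun t => abs_kernelC_le hφ hϱ t s)

lemma IsPropagator.integrable_row [Fact (0 ≤ T)] (hG : IsPropagator T G) (t : Time T) :
    Integrable fun s : Time T => truncPropagator T G ((t : ℝ) - s) ^ 2 :=
  integrable_comp_coe (h := fun s => truncPropagator T G ((t : ℝ) - s) ^ 2)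
    (hG.integrable_sq.comp_sub_left (t : ℝ))

lemma IsPropagator.integrable_col [Fact (0 ≤ T)] (hG : IsPropagator T G) (s : Time T) :
    Integrable fun t : Time T => truncPropagator T G ((t : ℝ) - s) ^ 2 :=
  integrable_comp_coe (h := fun t => truncPropagator T G (t - s) ^ 2)
    (hG.integrable_sq.comp_sub_right (s : ℝ))

lemma IsPropagator.memLp_row [Fact (0 ≤ T)] (hG : IsPropagator T G) (t : Time T) :
    MemLp (fun s : Time T => truncPropagator T G ((t : ℝ) - s)) 2 volume :=
  (memLp_two_iff_integrable_sq (hG.measurable.comp (by fun_prop)).aestronglyMeasurable).2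
    (hG.integrable_row t)

lemma IsPropagator.memLp_col [Fact (0 ≤ T)] (hG : IsPropagator T G) (s : Time T) :
    MemLp (fun t : Time T => truncPropagator T G ((t : ℝ) - s)) 2 volume :=
  (memLp_two_iff_integrable_sq (hG.measurable.comp (by fun_prop)).aestronglyMeasurable).2
    (hG.integrable_col s)

/-- Translation invariance of Lebesgue measure bounds all rows and columns by the same number, the
squared `L²` norm of the propagator. -/
lemma IsPropagator.isCausalKernel [Fact (0 ≤ T)] (hG : IsPropagator T G) :
    IsCausalKernel (fun t s : Time T => truncPropagator T G ((t : ℝ) - s))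
      (∫ τ, truncPropagator T G τ ^ 2) where
  measurable := hG.measurable.comp (by fun_prop)
  causal t s hts := by rw [← ite_propagator_eq, if_neg (not_le.2 hts)]
  row_memLp := hG.memLp_row
  col_memLp := hG.memLp_col
  row_le t := by
    refine (integral_comp_coe_le (h := fun s => truncPropagator T G ((t : ℝ) - s) ^ 2)
      (hG.integrable_sq.comp_sub_left (t : ℝ)) fun _ => sq_nonneg _).trans_eq ?_
    exact integral_sub_left_eq_self (fun τ => truncPropagator T G τ ^ 2) volume (t : ℝ)
  col_le s := by
    refine (integral_comp_coe_le (h := fun t => truncPropagator T G (t - s) ^ 2)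
      (hG.integrable_sq.comp_sub_right (s : ℝ)) fun _ => sq_nonneg _).trans_eq ?_
    exact integral_sub_right_eq_self (fun τ => truncPropagator T G τ ^ 2) (s : ℝ)

lemma isCausalKernel_kernelC (hφ : 0 ≤ φ) (hϱ : 0 ≤ ϱ) :
    IsCausalKernel (kernelC (T := T) φ ϱ)
      ((2 * ϱ + 2 * φ * T) ^ 2 * (volume : Measure (Time T)).real univ) where
  measurable := measurable_kernelC
  causal t s hts := by simp [kernelC, not_le.2 hts]
  row_memLp := memLp_kernelC_row hφ hϱ
  col_memLp := memLp_kernelC_col hφ hϱ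
  row_le t := by
    refine (integral_mono (memLp_kernelC_row hφ hϱ t).integrable_sq (integrable_const _)
      fun s => sq_le_sq.2 ((abs_kernelC_le hφ hϱ t s).trans (le_abs_self _))).trans_eq ?_
    rw [integral_const, smul_eq_mul, mul_comm]
  col_le s := by
    refine (integral_mono (memLp_kernelC_col hφ hϱ s).integrable_sq (integrable_const _)
      fun t => sq_le_sq.2 ((abs_kernelC_le hφ hϱ t s).trans (le_abs_self _))).trans_eq ?_
    rw [integral_const, smul_eq_mul, mul_comm]

lemma integral_add_sq_le {f g : Time T → ℝ} (hf : MemLp f 2 (volume : Measure (Time T)))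
    (hg : MemLp g 2 (volume : Measure (Time T))) (c : ℝ) :
    ∫ s, (f s + c * g s) ^ 2 ≤ 2 * (∫ s, f s ^ 2) + 2 * c ^ 2 * ∫ s, g s ^ 2 := by
  rw [← integral_const_mul, ← integral_const_mul,
    ← integral_add (hf.integrable_sq.const_mul _) (hg.integrable_sq.const_mul _)]
  refine integral_mono (hf.add (hg.const_mul c)).integrable_sq
    ((hf.integrable_sq.const_mul _).add (hg.integrable_sq.const_mul _)) fun s => ?_
  beta_reduce
  nlinarith [sq_nonneg (f s - c * g s)]

lemma isCausalKernel_kernelK [Fact (0 ≤ T)] (hG : IsPropagator T G) (lam : ℝ) (hφ : 0 ≤ φ) (hϱ : 0 ≤ ϱ) :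
    ∃ C, IsCausalKernel (kernelK (T := T) G lam φ ϱ) C := by
  have h1 := isCausalKernel_kernelC (T := T) hφ hϱ
  have h2 := hG.isCausalKernel
  have e : kernelK (T := T) G lam φ ϱ
      = fun t s => kernelC φ ϱ t s + lam * truncPropagator T G ((t : ℝ) - s) := by
    funext t s
    exact kernelK_eq t s
  refine ⟨2 * ((2 * ϱ + 2 * φ * T) ^ 2 * (volume : Measure (Time T)).real univ)
    + 2 * lam ^ 2 * ∫ τ, truncPropagator T G τ ^ 2, ?_⟩
  rw [e]
  refine ⟨h1.measurable.add (h2.measurable.const_mul lam), ?_, ?_, ?_, ?_, ?_⟩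
  · intro t s hts
    rw [h1.causal t s hts, h2.causal t s hts, mul_zero, add_zero]
  · exact fun t => (h1.row_memLp t).add ((h2.row_memLp t).const_mul lam)
  · exact fun s => (h1.col_memLp s).add ((h2.col_memLp s).const_mul lam)
  · intro t
    refine (integral_add_sq_le (h1.row_memLp t) (h2.row_memLp t) lam).trans ?_
    gcongr
    · exact h1.row_le t
    · exact h2.row_le t
  · intro s
    refine (integral_add_sq_le (h1.col_memLp s) (h2.col_memLp s) lam).trans ?_
    gcongr
    · exact h1.col_le s
    · exact h2.col_le s

/-- The right-hand side is the pure quadratic part of the inventory penalties. The identity serves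
twice: for positivity of `K` and for matching the payoff. -/
lemma inner_kernelOp_kernelC [Fact (0 ≤ T)] (hφ : 0 ≤ φ) (hϱ : 0 ≤ ϱ) (f : L2 T) :
    inner ℝ f (kernelOp (kernelC φ ϱ) f)
      = ϱ * runningIntegral f ⊤ ^ 2 + φ * ∫ t, runningIntegral f t ^ 2 := by
  have hf : Integrable (fun s => f s) (volume : Measure (Time T)) :=
    (Lp.memLp f).integrable one_le_two
  have hi := (isCausalKernel_kernelC (T := T) hφ hϱ).sqInt.integrable_bilin f f
  rw [inner_kernelOp (isCausalKernel_kernelC hφ hϱ).sqInt]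
  refine (integral_prod_lower (g := fun t _ => 2 * ϱ + 2 * φ * (T - t)) hi).trans ?_
  have h1 : ∀ t : Time T, f t * ∫ s in Iic t, (2 * ϱ + 2 * φ * (T - t)) * f s
      = 2 * ϱ * (f t * runningIntegral f t) + 2 * φ * ((T - t) * (f t * runningIntegral f t)) := by
    intro t
    rw [integral_const_mul, runningIntegral]
    ring
  have hFi := integrable_mul_runningIntegral hf
  have hi2 : Integrable fun t : Time T => (T - (t:ℝ)) * (f t * runningIntegral f t) := by
    refine hFi.bdd_mul (c := T) (by fun_prop) (ae_of_all _ fun t => ?_)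
    rw [Real.norm_of_nonneg (sub_nonneg.2 t.2.2)]
    linarith [t.2.1]
  simp_rw [h1]
  rw [integral_add (hFi.const_mul _) (hi2.const_mul _), integral_const_mul, integral_const_mul,
    integral_sub_mul_runningIntegral hf]
  have h5 := integral_Iic_mul_runningIntegral hf ⊤
  rw [Iic_top, Measure.restrict_univ] at h5
  rw [h5]
  ring

lemma impact_eq [Fact (0 ≤ T)] (G : ℝ → ℝ) (lam : ℝ) (u : Time T → ℝ) (t : Time T) :
    impact G lam u t = lam * ∫ s : Time T, truncPropagator T G ((t : ℝ) - s) * u s := by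
  rw [impact, ← integral_indicator measurableSet_Iic, ← integral_const_mul]
  refine integral_congr_ae (ae_of_all _ fun s => ?_)
  beta_reduce
  rw [← ite_propagator_eq]
  by_cases h : s ≤ t
  · simp [h]; ring
  · simp [h]

lemma memLp_impact [Fact (0 ≤ T)] (hG : IsPropagator T G) (lam : ℝ) (f : L2 T) :
    MemLp (impact G lam f) 2 (volume : Measure (Time T)) := by
  have h := (hG.isCausalKernel.sqInt.memLp_integral f).const_mul lam
  exact h.ae_eq (ae_of_all _ fun t => (impact_eq G lam f t).symm)

lemma inner_kernelOp_propagator [Fact (0 ≤ T)] (hG : IsPropagator T G) (lam : ℝ) (f : L2 T) :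
    lam * inner ℝ f (kernelOp (fun t s : Time T => truncPropagator T G ((t : ℝ) - s)) f)
      = ∫ t, impact G lam f t * f t := by
  rw [inner_L2, ← integral_const_mul]
  refine integral_congr_ae ?_
  filter_upwards [coeFn_kernelOp hG.isCausalKernel.sqInt f] with t ht
  rw [ht, impact_eq]
  ring

lemma inner_kernelOp_propagator_nonneg [Fact (0 ≤ T)] (hG : IsPropagator T G) (f : L2 T) :
    0 ≤ inner ℝ f (kernelOp (fun t s : Time T => truncPropagator T G ((t : ℝ) - s)) f) := by
  have hi := hG.isCausalKernel.sqInt.integrable_bilin f f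
  rw [inner_kernelOp hG.isCausalKernel.sqInt]
  simp_rw [← ite_propagator_eq] at hi ⊢
  exact hG.integral_nonneg ((Lp.memLp f).integrable one_le_two) (Lp.stronglyMeasurable f).measurable
    hi

lemma inner_kernelOp_kernelK [Fact (0 ≤ T)] (hG : IsPropagator T G) (lam : ℝ) (hφ : 0 ≤ φ) (hϱ : 0 ≤ ϱ)
    (f : L2 T) :
    inner ℝ f (kernelOp (kernelK G lam φ ϱ) f) = inner ℝ f (kernelOp (kernelC φ ϱ) f)
      + lam * inner ℝ f (kernelOp (fun t s : Time T => truncPropagator T G ((t : ℝ) - s)) f) := by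
  obtain ⟨C, hK⟩ := isCausalKernel_kernelK (T := T) hG lam hφ hϱ
  have h1 := (isCausalKernel_kernelC (T := T) hφ hϱ).sqInt
  have h2 := hG.isCausalKernel.sqInt
  rw [inner_kernelOp hK.sqInt, inner_kernelOp h1, inner_kernelOp h2, ← integral_const_mul,
    ← integral_add (h1.integrable_bilin f f) ((h2.integrable_bilin f f).const_mul _)]
  refine integral_congr_ae (ae_of_all _ fun p => ?_)
  beta_reduce
  rw [kernelK_eq]
  ring

lemma isMonotoneKernel_kernelK [Fact (0 ≤ T)] (hG : IsPropagator T G) (hlam : 0 ≤ lam) (hφ : 0 ≤ φ)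
    (hϱ : 0 ≤ ϱ) : ∃ C, IsMonotoneKernel (kernelK (T := T) G lam φ ϱ) C := by
  obtain ⟨C, hK⟩ := isCausalKernel_kernelK (T := T) hG lam hφ hϱ
  refine ⟨C, hK, fun f => ?_⟩
  rw [real_inner_comm, inner_kernelOp_kernelK hG lam hφ hϱ, inner_kernelOp_kernelC hφ hϱ]
  have h1 := inner_kernelOp_propagator_nonneg hG f
  have h2 : 0 ≤ ∫ t, runningIntegral f t ^ 2 := integral_nonneg fun _ => sq_nonneg _
  positivity

/-! ### The payoff as a quadratic functional of the strategy -/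

lemma impact_congr {u v : Time T → ℝ} (h : u =ᵐ[volume] v) (G : ℝ → ℝ) (lam : ℝ) :
    impact G lam u = impact G lam v := by
  funext t
  refine integral_congr_ae (ae_restrict_of_ae ?_)
  filter_upwards [h] with s hs
  rw [hs]

lemma inventory_eq (x : ℝ) (u : Time T → ℝ) (t : Time T) :
    inventory x u t = x - runningIntegral u t := rfl

lemma integral_mul_runningIntegral {w F : Time T → ℝ} (hw : Integrable w) (hF : Integrable F) :
    ∫ t, w t * runningIntegral F t = ∫ s, (∫ t in Ici s, w t) * F s := by
  have hi : Integrable (fun p : Time T × Time T => {p : Time T × Time T | p.2 ≤ p.1}.indicator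
      (fun p => w p.1 * F p.2) p) ((volume : Measure (Time T)).prod volume) :=
    (hw.mul_prod hF).indicator (measurableSet_le measurable_snd measurable_fst)
  have h1 : ∫ t, w t * runningIntegral F t
      = ∫ t, ∫ s, {p : Time T × Time T | p.2 ≤ p.1}.indicator
        (fun p => w p.1 * F p.2) (t, s) := by
    refine integral_congr_ae (ae_of_all _ fun t => ?_)
    beta_reduce
    rw [runningIntegral_eq_integral, ← integral_const_mul]
    refine integral_congr_ae (ae_of_all _ fun s => ?_)
    by_cases h : s ≤ t <;> simp [h]
  rw [h1, integral_integral_swap (f := fun t s => {p : Time T × Time T | p.2 ≤ p.1}.indicator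
      (fun p => w p.1 * F p.2) (t, s)) hi]
  refine integral_congr_ae (ae_of_all _ fun s => ?_)
  beta_reduce
  rw [← integral_mul_const, ← integral_indicator measurableSet_Ici]
  refine integral_congr_ae (ae_of_all _ fun t => ?_)
  by_cases h : s ≤ t <;> simp [h]

lemma integral_runningIntegral {F : Time T → ℝ} (hF : Integrable F) :
    ∫ t, runningIntegral F t = ∫ s : Time T, (T - s) * F s := by
  have h := integral_mul_runningIntegral (integrable_const (1:ℝ)) hF
  simp only [one_mul] at h
  rw [h]
  refine integral_congr_ae (ae_of_all _ fun s => ?_)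
  have h2 := integral_Ici_eq (g := fun _ => 1) s
  simp only [intervalIntegral.integral_const, smul_eq_mul, mul_one] at h2
  beta_reduce
  rw [h2]

lemma pathwiseIntegrable [Fact (0 ≤ T)] (hG : IsPropagator T G) (x lam : ℝ) {S u : Time T → ℝ}
    (hS : MemLp S 2 (volume : Measure (Time T))) (hu : MemLp u 2 (volume : Measure (Time T))) :
    PathwiseIntegrable G x lam S u := by
  have hui : Integrable u := hu.integrable one_le_two
  refine ⟨hu, fun t => ?_, ?_, ?_⟩
  · have h1 : Integrable fun s : Time T => truncPropagator T G ((t : ℝ) - s) * u s * lam :=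
      (((hG.memLp_row t).integrable_mul hu)).mul_const lam
    refine h1.integrableOn.congr_fun (fun s hs => ?_) measurableSet_Iic
    have hs' : s ≤ t := hs
    beta_reduce
    rw [← ite_propagator_eq, if_pos hs']
  · have h1 : impact G lam u = impact G lam (hu.toLp u) := impact_congr hu.coeFn_toLp.symm G lam
    rw [h1]
    exact (hS.sub (memLp_impact hG lam _)).integrable_mul hu
  · refine MemLp.integrable_sq ?_
    refine MemLp.of_bound (C := |x| + ∫ s, |u s|) ?_ (ae_of_all _ fun t => ?_)
    · exact aestronglyMeasurable_const.sub (aestronglyMeasurable_runningIntegral hui)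
    · rw [inventory_eq]
      exact (norm_sub_le _ _).trans (add_le_add_right (abs_runningIntegral_le hui t) _)

/-- Every term is expanded in `u`: Fubini turns the cross term of the inventory penalty into the
weight `T - t`, and together with the terminal terms it completes the linear coefficient. The pure
squares and the impact cost assemble into the quadratic form of `K`, whose symmetrisation accounts
for the factor `1/2`. -/
lemma payoff_eq [Fact (0 ≤ T)] (hG : IsPropagator T G) (x lam ε : ℝ) (hφ : 0 ≤ φ) (hϱ : 0 ≤ ϱ)
    {S u : Time T → ℝ} (hS : MemLp S 2 (volume : Measure (Time T)))
    (hu : MemLp u 2 (volume : Measure (Time T))) :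
    payoff G x lam ε φ ϱ S u = x * S ⊤ - (φ * x ^ 2 * (volume : Measure (Time T)).real univ
        + ϱ * x ^ 2)
      + inner ℝ (toL2 fun t : Time T => S t - S ⊤ + 2 * (φ * (T - t) + ϱ) * x) (toL2 u)
      - 1 / 2 * inner ℝ (symmOp (kernelK G lam φ ϱ) ε (toL2 u)) (toL2 u) := by
  have hui : Integrable u := hu.integrable one_le_two
  obtain ⟨C, hK⟩ := isCausalKernel_kernelK (T := T) hG lam hφ hϱ
  set f : L2 T := toL2 u with hf
  have hfu : f =ᵐ[volume] u := coeFn_toL2 hu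
  have hfi : Integrable (fun s => f s) (volume : Measure (Time T)) :=
    (Lp.memLp f).integrable one_le_two
  have hrun : runningIntegral (f : Time T → ℝ) = runningIntegral u := by
    funext t
    exact integral_congr_ae (ae_restrict_of_ae hfu)
  have himp : impact G lam u = impact G lam f := impact_congr hfu.symm G lam
  have hb : MemLp (fun t : Time T => S t - S ⊤ + 2 * (φ * (T - t) + ϱ) * x) 2
      (volume : Measure (Time T)) := by
    refine (hS.sub (memLp_const _)).add (MemLp.of_bound (C := (2 * (φ * T + ϱ)) * |x|)
      (by fun_prop) (ae_of_all _ fun t => ?_))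
    have h1 : 0 ≤ T - (t:ℝ) := sub_nonneg.2 t.2.2
    rw [norm_mul, Real.norm_of_nonneg (by positivity), Real.norm_eq_abs]
    have : T - (t:ℝ) ≤ T := by linarith [t.2.1]
    gcongr
  have e1 : ∫ t, (S t - impact G lam u t) * u t = (∫ t, S t * u t) - ∫ t, impact G lam f t * f t := by
    rw [himp]
    have h1 : Integrable fun t => S t * u t := hS.integrable_mul hu
    have h2 : Integrable fun t => impact G lam f t * u t := (memLp_impact hG lam f).integrable_mul hu
    simp_rw [sub_mul]
    rw [integral_sub h1 h2]
    congr 1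
    refine integral_congr_ae ?_
    filter_upwards [hfu] with t ht
    rw [ht]
  have e2 : ∫ t, u t ^ 2 = ‖f‖ ^ 2 := (norm_toL2_sq hu).symm
  have hRi : Integrable (runningIntegral u) (volume : Measure (Time T)) :=
    Integrable.of_bound (aestronglyMeasurable_runningIntegral hui) _
      (ae_of_all _ fun t => abs_runningIntegral_le hui t)
  have hR2 : Integrable (fun t => runningIntegral u t ^ 2) (volume : Measure (Time T)) :=
    (MemLp.of_bound (p := 2) (aestronglyMeasurable_runningIntegral hui) _
      (ae_of_all _ fun t => abs_runningIntegral_le hui t)).integrable_sq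
  have e3 : ∫ t, inventory x u t ^ 2 = x ^ 2 * (volume : Measure (Time T)).real univ
      - 2 * x * (∫ t : Time T, (T - t) * u t) + ∫ t, runningIntegral u t ^ 2 := by
    have h1 : ∀ t, inventory x u t ^ 2 = x ^ 2 - 2 * x * runningIntegral u t
        + runningIntegral u t ^ 2 := fun t => by rw [inventory_eq]; ring
    have h2 : Integrable (fun t => x ^ 2 - 2 * x * runningIntegral u t)
        (volume : Measure (Time T)) := (integrable_const _).sub (hRi.const_mul _)
    simp_rw [h1]
    rw [integral_add h2 hR2,
      integral_sub (integrable_const _) (hRi.const_mul _), integral_const_mul, integral_const,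
      integral_runningIntegral hui, smul_eq_mul, mul_comm (Measure.real _ _)]
  have e4 : inventory x u ⊤ = x - ∫ t, u t := by
    rw [inventory, Iic_top, Measure.restrict_univ]
  have hTi : Integrable fun t : Time T => (T - (t:ℝ)) * u t := by
    refine hui.bdd_mul (c := T) (by fun_prop) (ae_of_all _ fun t => ?_)
    rw [Real.norm_of_nonneg (sub_nonneg.2 t.2.2)]
    linarith [t.2.1]
  have e5 : inner ℝ (toL2 fun t : Time T => S t - S ⊤ + 2 * (φ * (T - t) + ϱ) * x) f
      = (∫ t, S t * u t) - S ⊤ * (∫ t, u t) + 2 * φ * x * (∫ t : Time T, (T - t) * u t)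
        + 2 * ϱ * x * ∫ t, u t := by
    have h1 : Integrable fun t => S t * u t := hS.integrable_mul hu
    rw [real_inner_comm, inner_toL2_right hb]
    have h2 : ∫ s, f s * (S s - S ⊤ + 2 * (φ * (T - (s:ℝ)) + ϱ) * x)
        = ∫ t : Time T, (S t * u t - S ⊤ * u t + 2 * φ * x * ((T - t) * u t)
          + 2 * ϱ * x * u t) := by
      refine integral_congr_ae ?_
      filter_upwards [hfu] with t ht
      rw [ht]
      ring
    have h3 : Integrable fun t => S t * u t - S ⊤ * u t := h1.sub (hui.const_mul _)
    have h4 : Integrable fun t : Time T => S t * u t - S ⊤ * u t + 2 * φ * x * ((T - t) * u t) :=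
      h3.add (hTi.const_mul _)
    rw [h2, integral_add h4 (hui.const_mul _), integral_add h3 (hTi.const_mul _),
      integral_sub h1 (hui.const_mul _), integral_const_mul, integral_const_mul, integral_const_mul]
  have e6 : runningIntegral u ⊤ = ∫ t, u t := by
    rw [runningIntegral, Iic_top, Measure.restrict_univ]
  rw [payoff, e1, e2, e3, e4, e5, inner_symmOp_self hK.sqInt, real_inner_comm,
    inner_kernelOp_kernelK hG lam hφ hϱ, inner_kernelOp_kernelC hφ hϱ,
    inner_kernelOp_propagator hG, hrun, e6]
  ring

end ImpactKernel

/-! ### Processes as random elements of L²([0,T]) and Lax-Milgram on progressive processes. -/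

section Paths

variable {Ω : Type*} {mΩ : MeasurableSpace Ω} {T : ℝ} {P : Measure Ω}

/-- Jointly measurable processes in `L²(dt ⊗ P)`. -/
structure IsL2Process (P : Measure Ω) (u : Time T → Ω → ℝ) : Prop where
  measurable : Measurable (Function.uncurry u)
  memLp : MemLp (Function.uncurry u) 2 ((volume : Measure (Time T)).prod P)

/-- The path of a process, as an element of `L²([0,T])`. -/
noncomputable def pathMap (u : Time T → Ω → ℝ) (ω : Ω) : L2 T := toL2 fun t => u t ω

lemma isL2Process_iff [SFinite P] {u : Time T → Ω → ℝ} :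
    IsL2Process P u ↔ Measurable (Function.uncurry u) ∧ SqIntProcess P u := by
  have key : Measurable (Function.uncurry u) →
      (MemLp (Function.uncurry u) 2 ((volume : Measure (Time T)).prod P) ↔ SqIntProcess P u) := by
    intro hu
    have h1 : ∫⁻ p, ‖Function.uncurry u p‖ₑ ^ 2 ∂((volume : Measure (Time T)).prod P)
        = ∫⁻ t : Time T, ∫⁻ ω, ‖u t ω‖ₑ ^ 2 ∂P :=
      lintegral_prod _ ((hu.enorm.pow_const 2).aemeasurable)
    rw [SqIntProcess, ← h1]
    have h2 := eLpNorm_lt_top_iff_lintegral_rpow_enorm_lt_top (f := Function.uncurry u)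
      (μ := (volume : Measure (Time T)).prod P) (p := 2) two_ne_zero ENNReal.ofNat_ne_top
    simp only [ENNReal.toReal_ofNat, ENNReal.rpow_ofNat] at h2
    rw [← h2]
    exact ⟨fun h => h.2, fun h => ⟨hu.aestronglyMeasurable, h⟩⟩
  exact ⟨fun h => ⟨h.1, (key h.1).1 h.2⟩, fun h => ⟨h.1, (key h.1).2 h.2⟩⟩

lemma Admissible.isL2Process [Fact (0 ≤ T)] [SFinite P] {𝓕 : Filtration (Time T) mΩ}
    {u : Time T → Ω → ℝ} (h : Admissible 𝓕 P u) : IsL2Process P u :=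
  isL2Process_iff.2 ⟨measurable_uncurry_of_progressive h.1, h.2⟩

lemma ae_ae_path [SFinite P] {Q : Time T × Ω → Prop}
    (h : ∀ᵐ p ∂((volume : Measure (Time T)).prod P), Q p) : ∀ᵐ ω ∂P, ∀ᵐ t : Time T, Q (t, ω) :=
  Measure.ae_ae_of_ae_prod (Measure.measurePreserving_swap.quasiMeasurePreserving.ae h)

namespace IsL2Process

lemma add [SFinite P] {u v : Time T → Ω → ℝ} (hu : IsL2Process P u) (hv : IsL2Process P v) :
    IsL2Process P fun t ω => u t ω + v t ω :=
  ⟨hu.1.add hv.1, hu.2.add hv.2⟩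

lemma sub [SFinite P] {u v : Time T → Ω → ℝ} (hu : IsL2Process P u) (hv : IsL2Process P v) :
    IsL2Process P fun t ω => u t ω - v t ω :=
  ⟨hu.1.sub hv.1, hu.2.sub hv.2⟩

lemma const_mul [SFinite P] {u : Time T → Ω → ℝ} (hu : IsL2Process P u) (c : ℝ) :
    IsL2Process P fun t ω => c * u t ω :=
  ⟨hu.1.const_mul c, hu.2.const_mul c⟩

lemma ae_memLp_path [SFinite P] {u : Time T → Ω → ℝ} (hu : IsL2Process P u) :
    ∀ᵐ ω ∂P, MemLp (fun t => u t ω) 2 (volume : Measure (Time T)) := by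
  filter_upwards [hu.memLp.integrable_sq.prod_left_ae] with ω hω
  exact (memLp_two_iff_integrable_sq
    (hu.1.comp measurable_prodMk_right).aestronglyMeasurable).2 hω

lemma ae_memLp_section [SFinite P] {u : Time T → Ω → ℝ} (hu : IsL2Process P u) :
    ∀ᵐ t : Time T, MemLp (u t) 2 P := by
  filter_upwards [hu.memLp.integrable_sq.prod_right_ae] with t ht
  exact (memLp_two_iff_integrable_sq
    (hu.1.comp measurable_prodMk_left).aestronglyMeasurable).2 ht

lemma aestronglyMeasurable_pathMap [SFinite P] {u : Time T → Ω → ℝ} (hu : IsL2Process P u) :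
    AEStronglyMeasurable (pathMap u) P := by
  classical
  set E : Set Ω := {ω | ∫⁻ t : Time T, ‖u t ω‖ₑ ^ 2 < ∞} with hE
  have hEm : MeasurableSet E :=
    measurableSet_lt ((hu.1.enorm.pow_const 2).lintegral_prod_left') measurable_const
  have hiff : ∀ ω, MemLp (fun t => u t ω) 2 (volume : Measure (Time T)) ↔ ω ∈ E := by
    intro ω
    have h2 := eLpNorm_lt_top_iff_lintegral_rpow_enorm_lt_top (f := fun t => u t ω)
      (μ := (volume : Measure (Time T))) (p := 2) two_ne_zero ENNReal.ofNat_ne_top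
    simp only [ENNReal.toReal_ofNat, ENNReal.rpow_ofNat] at h2
    rw [hE, mem_ofPred_eq, ← h2]
    exact ⟨fun h => h.2, fun h => ⟨(hu.1.comp measurable_prodMk_right).aestronglyMeasurable, h⟩⟩
  -- Paths outside `L²` form a null event; setting them to zero makes every section square
  -- integrable, as `stronglyMeasurable_toLp` demands.
  set u' : Ω → Time T → ℝ := fun ω t => if ω ∈ E then u t ω else 0 with hu'
  have hm : Measurable (Function.uncurry u') :=
    Measurable.ite (hEm.preimage measurable_fst) (hu.1.comp measurable_swap) measurable_const
  have hmem : ∀ ω, MemLp (u' ω) 2 (volume : Measure (Time T)) := by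
    intro ω
    by_cases h : ω ∈ E
    · simp only [hu', h, if_true]
      exact (hiff ω).2 h
    · simp only [hu', h, if_false]
      exact MemLp.zero'
  refine (stronglyMeasurable_toLp hm hmem).aestronglyMeasurable.congr ?_
  filter_upwards [hu.ae_memLp_path] with ω hω
  have h := (hiff ω).1 hω
  rw [pathMap, toL2_eq hω]
  congr 1
  funext t
  simp [hu', h]

lemma integrable_mul [SFinite P] {u v : Time T → Ω → ℝ} (hu : IsL2Process P u)
    (hv : IsL2Process P v) : Integrable (fun p : Time T × Ω => u p.1 p.2 * v p.1 p.2)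
      ((volume : Measure (Time T)).prod P) :=
  MemLp.integrable_mul hu.2 hv.2

lemma inner_pathMap [SFinite P] {u v : Time T → Ω → ℝ} (hu : IsL2Process P u)
    (hv : IsL2Process P v) :
    ∀ᵐ ω ∂P, inner ℝ (pathMap u ω) (pathMap v ω) = ∫ t, u t ω * v t ω := by
  filter_upwards [hu.ae_memLp_path, hv.ae_memLp_path] with ω h1 h2
  rw [pathMap, pathMap, inner_toL2_right h2]
  refine integral_congr_ae ?_
  filter_upwards [coeFn_toL2 h1] with t ht
  rw [ht]

lemma integral_inner_pathMap [SFinite P] {u v : Time T → Ω → ℝ} (hu : IsL2Process P u)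
    (hv : IsL2Process P v) :
    ∫ ω, inner ℝ (pathMap u ω) (pathMap v ω) ∂P
      = ∫ p : Time T × Ω, u p.1 p.2 * v p.1 p.2 ∂((volume : Measure (Time T)).prod P) := by
  rw [integral_prod_symm _ (hu.integrable_mul hv)]
  exact integral_congr_ae (hu.inner_pathMap hv)

lemma memLp_pathMap [SFinite P] {u : Time T → Ω → ℝ} (hu : IsL2Process P u) :
    MemLp (pathMap u) 2 P := by
  rw [memLp_two_iff_integrable_sq_norm hu.aestronglyMeasurable_pathMap]
  refine (hu.integrable_mul hu).integral_prod_right.congr ?_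
  filter_upwards [hu.inner_pathMap hu] with ω hω
  rw [← hω, real_inner_self_eq_norm_sq]

lemma pathMap_sub [SFinite P] {u v : Time T → Ω → ℝ} (hu : IsL2Process P u)
    (hv : IsL2Process P v) :
    pathMap (fun t ω => u t ω - v t ω) =ᵐ[P] fun ω => pathMap u ω - pathMap v ω := by
  filter_upwards [hu.ae_memLp_path, hv.ae_memLp_path] with ω h1 h2
  rw [pathMap, pathMap, pathMap, toL2_eq h1, toL2_eq h2]
  exact toL2_eq (h1.sub h2)

end IsL2Process

lemma isL2Process_coeFn [SFinite P] (g : Lp ℝ 2 ((volume : Measure (Time T)).prod P)) :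
    IsL2Process P fun t ω => g (t, ω) :=
  ⟨(Lp.stronglyMeasurable g).measurable, Lp.memLp g⟩

lemma toL2_congr {f g : Time T → ℝ} (h : f =ᵐ[volume] g) : toL2 f = toL2 g := by
  by_cases hf : MemLp f 2 (volume : Measure (Time T))
  · rw [toL2_eq hf, toL2_eq (hf.ae_eq h)]
    exact MemLp.toLp_congr _ _ h
  · have hg : ¬ MemLp g 2 (volume : Measure (Time T)) := fun hg => hf (hg.ae_eq h.symm)
    rw [toL2, toL2, dif_neg hf, dif_neg hg]

lemma pathMap_congr [SFinite P] {u v : Time T → Ω → ℝ}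
    (h : ∀ᵐ p ∂((volume : Measure (Time T)).prod P), u p.1 p.2 = v p.1 p.2) :
    pathMap u =ᵐ[P] pathMap v := by
  filter_upwards [ae_ae_path h] with ω hω
  exact toL2_congr hω

/-- The isometry `L²(dt ⊗ P) → L²(P; L²([0,T]))`. -/
noncomputable def pathIsometry (P : Measure Ω) [SFinite P] :
    Lp ℝ 2 ((volume : Measure (Time T)).prod P) →ₗᵢ[ℝ] Lp (L2 T) 2 P where
  toFun g := (isL2Process_coeFn g).memLp_pathMap.toLp _
  map_add' g h := by
    rw [← MemLp.toLp_add, MemLp.toLp_eq_toLp_iff]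
    filter_upwards [ae_ae_path (Lp.coeFn_add g h), (isL2Process_coeFn g).ae_memLp_path,
      (isL2Process_coeFn h).ae_memLp_path] with ω h1 h2 h3
    rw [Pi.add_apply, pathMap, pathMap, pathMap, toL2_congr h1, toL2_eq h2, toL2_eq h3]
    exact toL2_eq (h2.add h3)
  map_smul' c g := by
    rw [RingHom.id_apply, ← MemLp.toLp_const_smul, MemLp.toLp_eq_toLp_iff]
    filter_upwards [ae_ae_path (Lp.coeFn_smul c g), (isL2Process_coeFn g).ae_memLp_path]
      with ω h1 h2
    rw [Pi.smul_apply, pathMap, pathMap, toL2_congr h1, toL2_eq h2]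
    exact toL2_eq (h2.const_smul c)
  norm_map' g := by
    have h : ‖(isL2Process_coeFn g).memLp_pathMap.toLp _‖ ^ 2 = ‖g‖ ^ 2 := by
      rw [← real_inner_self_eq_norm_sq, ← real_inner_self_eq_norm_sq, L2.inner_def, L2.inner_def]
      have h1 := (isL2Process_coeFn g).integral_inner_pathMap (isL2Process_coeFn g)
      have h2 : ∫ p, inner ℝ (g p) (g p) ∂((volume : Measure (Time T)).prod P)
          = ∫ p : Time T × Ω, g (p.1, p.2) * g (p.1, p.2) ∂((volume : Measure (Time T)).prod P) :=
        rfl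
      rw [h2, ← h1]
      refine integral_congr_ae ?_
      filter_upwards [(isL2Process_coeFn g).memLp_pathMap.coeFn_toLp] with ω hω
      rw [hω]
    exact (sq_eq_sq₀ (norm_nonneg _) (norm_nonneg _)).1 h

lemma pathIsometry_toLp [SFinite P] {u : Time T → Ω → ℝ} (hu : IsL2Process P u) :
    pathIsometry P (hu.memLp.toLp _) =ᵐ[P] pathMap u := by
  refine (MemLp.coeFn_toLp (isL2Process_coeFn (hu.memLp.toLp _)).memLp_pathMap).trans ?_
  exact pathMap_congr hu.memLp.coeFn_toLp

/-- The compression `ι* A ι` inherits coercivity because `ι` is isometric, hence it is invertible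
and the equation can be solved against test vectors from the subspace. -/
lemma exists_galerkin {V H : Type*} [NormedAddCommGroup V] [InnerProductSpace ℝ V] [CompleteSpace V]
    [NormedAddCommGroup H] [InnerProductSpace ℝ H] [CompleteSpace H] (ι : V →ₗᵢ[ℝ] H)
    {A : H →L[ℝ] H} {c : ℝ} (hc : 0 < c) (hA : ∀ f, c * ‖f‖ ^ 2 ≤ inner ℝ (A f) f) (b : H) :
    ∃ v, ∀ h, inner ℝ (A (ι v)) (ι h) = inner ℝ b (ι h) := by
  set j : V →L[ℝ] H := ι.toContinuousLinearMap
  set B : V →L[ℝ] V := (ContinuousLinearMap.adjoint j).comp (A.comp j)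
  have hB : IsUnit B := by
    refine isUnit_of_coercive hc fun v => ?_
    have h1 : inner ℝ (B v) v = inner ℝ (A (ι v)) (ι v) :=
      ContinuousLinearMap.adjoint_inner_left j v (A (ι v))
    rw [h1, ← ι.norm_map v]
    exact hA _
  have hv : B (Ring.inverse B (ContinuousLinearMap.adjoint j b)) = ContinuousLinearMap.adjoint j b :=
    congrArg (fun L : V →L[ℝ] V => L (ContinuousLinearMap.adjoint j b))
      (Ring.mul_inverse_cancel _ hB)
  refine ⟨Ring.inverse B (ContinuousLinearMap.adjoint j b), fun h => ?_⟩
  have h1 := congrArg (fun w => inner ℝ w h) hv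
  have h2 : inner ℝ (ContinuousLinearMap.adjoint j b) h = inner ℝ b (ι h) :=
    ContinuousLinearMap.adjoint_inner_left j h b
  rw [← h2, ← h1]
  exact (ContinuousLinearMap.adjoint_inner_left j h _).symm

/-- A progressively measurable solution of the first order condition. -/
lemma exists_first_order_condition [Fact (0 ≤ T)] [IsProbabilityMeasure P]
    (𝓕 : Filtration (Time T) mΩ) {A : L2 T →L[ℝ] L2 T} {c : ℝ} (hc : 0 < c)
    (hA : ∀ f, c * ‖f‖ ^ 2 ≤ inner ℝ (A f) f) {b : Time T → Ω → ℝ} (hb : IsL2Process P b) :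
    ∃ u, Admissible 𝓕 P u ∧ ∀ h, Admissible 𝓕 P h →
      ∫ ω, inner ℝ (A (pathMap u ω)) (pathMap h ω) ∂P
        = ∫ ω, inner ℝ (pathMap b ω) (pathMap h ω) ∂P := by
  have hle : Fact (progSigma 𝓕 ≤ (inferInstance : MeasurableSpace (Time T × Ω))) :=
    ⟨progSigma_le 𝓕⟩
  -- The closed subspace of progressive classes. Minimising over it, rather than pathwise, is what
  -- enforces non-anticipation.
  set V := lpMeas ℝ ℝ (progSigma 𝓕) 2 ((volume : Measure (Time T)).prod P)
  have hVc : CompleteSpace V := inferInstance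
  set ι : V →ₗᵢ[ℝ] Lp (L2 T) 2 P := (pathIsometry P).comp V.subtypeₗᵢ
  have hA' : ∀ f, c * ‖f‖ ^ 2 ≤ inner ℝ (A.compLpL 2 P f) f := by
    intro f
    have h1 : Integrable (fun ω => inner ℝ (f ω) (f ω)) P := L2.integrable_inner f f
    rw [← real_inner_self_eq_norm_sq, L2.inner_def, L2.inner_def, ← integral_const_mul]
    refine integral_mono_ae (h1.const_mul c) (L2.integrable_inner _ _) ?_
    filter_upwards [ContinuousLinearMap.coeFn_compLpL A f] with ω hω
    rw [hω, real_inner_self_eq_norm_sq]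
    exact hA _
  obtain ⟨v, hv⟩ := exists_galerkin ι hc hA' (pathIsometry P (hb.memLp.toLp _))
  have hvm : AEStronglyMeasurable[progSigma 𝓕] (v : Time T × Ω → ℝ)
      ((volume : Measure (Time T)).prod P) := mem_lpMeas_iff_aestronglyMeasurable.1 v.2
  -- The class has a representative measurable for the progressive σ-algebra itself, so no
  -- completion of that σ-algebra is needed.
  set u : Time T → Ω → ℝ := fun t ω => hvm.mk _ (t, ω) with hu
  have hup : IsStronglyProgressive 𝓕 u :=
    isStronglyProgressive_iff.2 hvm.stronglyMeasurable_mk.measurable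
  have hu2 : MemLp (Function.uncurry u) 2 ((volume : Measure (Time T)).prod P) :=
    (Lp.memLp (v : Lp ℝ 2 ((volume : Measure (Time T)).prod P))).ae_eq hvm.ae_eq_mk
  have huL : IsL2Process P u := ⟨measurable_uncurry_of_progressive hup, hu2⟩
  refine ⟨u, ⟨hup, (isL2Process_iff.1 huL).2⟩, fun h hh => ?_⟩
  have hhL := hh.isL2Process
  have hhV : hhL.memLp.toLp _ ∈ V := by
    rw [mem_lpMeas_iff_aestronglyMeasurable]
    exact ⟨Function.uncurry h, (isStronglyProgressive_iff.1 hh.1).stronglyMeasurable,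
      hhL.memLp.coeFn_toLp⟩
  have key := hv ⟨_, hhV⟩
  have e1 : ι v =ᵐ[P] pathMap u := by
    have h1 : (v : Lp ℝ 2 ((volume : Measure (Time T)).prod P)) = huL.memLp.toLp _ := by
      refine Lp.ext ?_
      exact hvm.ae_eq_mk.trans huL.memLp.coeFn_toLp.symm
    have h2 : ι v = pathIsometry P (huL.memLp.toLp _) := by rw [← h1]; rfl
    rw [h2]
    exact pathIsometry_toLp huL
  have e2 : ι ⟨_, hhV⟩ =ᵐ[P] pathMap h := pathIsometry_toLp hhL
  rw [L2.inner_def, L2.inner_def] at key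
  have k1 : ∫ ω, inner ℝ (A.compLpL 2 P (ι v) ω) (ι ⟨_, hhV⟩ ω) ∂P
      = ∫ ω, inner ℝ (A (pathMap u ω)) (pathMap h ω) ∂P := by
    refine integral_congr_ae ?_
    filter_upwards [ContinuousLinearMap.coeFn_compLpL A (ι v), e1, e2] with ω h1 h2 h3
    rw [h1, h2, h3]
  have k2 : ∫ ω, inner ℝ (pathIsometry P (hb.memLp.toLp _) ω) (ι ⟨_, hhV⟩ ω) ∂P
      = ∫ ω, inner ℝ (pathMap b ω) (pathMap h ω) ∂P := by
    refine integral_congr_ae ?_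
    filter_upwards [pathIsometry_toLp hb, e2] with ω h1 h2
    rw [h1, h2]
  rw [← k1, ← k2]
  exact key

end Paths

/-! ### Projection on the filtration and test strategies. -/

section ConditionalProcesses

variable {Ω : Type*} {mΩ : MeasurableSpace Ω} {T : ℝ} {P : Measure Ω}

lemma lintegral_enorm_sq {f : Ω → ℝ} : ∫⁻ ω, ‖f ω‖ₑ ^ 2 ∂P = eLpNorm f 2 P ^ 2 := by
  have := eLpNorm_nnreal_pow_eq_lintegral (f := f) (μ := P) (p := 2) two_ne_zero
  simpa using this.symm

/-- The map is Lipschitz with constant `‖e‖`. It transfers measurability in `t` from a deterministic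
family in `L²([0,T])` to the random variables obtained by pairing with a process. -/
lemma continuous_inner_compLp (e : Lp (L2 T) 2 P) :
    Continuous fun g : L2 T => (innerSL ℝ g).compLp e := by
  have h : ∀ g g' : L2 T, (innerSL ℝ g).compLp e - (innerSL ℝ g').compLp e
      = (innerSL ℝ (g - g')).compLp e := by
    intro g g'
    rw [sub_eq_iff_eq_add, ← ContinuousLinearMap.add_compLp, ← map_add, sub_add_cancel]
  refine (LipschitzWith.of_dist_le_mul (K := ‖e‖₊) fun g g' => ?_).continuous
  rw [dist_eq_norm, dist_eq_norm, h, mul_comm]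
  refine (ContinuousLinearMap.norm_compLp_le _ _).trans ?_
  rw [innerSL_apply_norm]
  rfl

lemma exists_progressive_condExp_of_measurable [Fact (0 ≤ T)] [IsProbabilityMeasure P]
    (𝓕 : Filtration (Time T) mΩ) {f : Time T → Ω → ℝ} (hf : Measurable (Function.uncurry f))
    (h2 : ∀ t, MemLp (f t) 2 P) :
    ∃ Z : Time T → Ω → ℝ, IsStronglyProgressive 𝓕 Z ∧ (∀ t, Z t =ᵐ[P] P[f t | 𝓕 t]) ∧
      (SqIntProcess P f → SqIntProcess P Z) := by
  obtain ⟨Z, hZ1, hZ2⟩ := exists_progressive_condExp_of_stronglyMeasurable 𝓕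
    (stronglyMeasurable_toLp hf h2)
  have hZ3 : ∀ t, Z t =ᵐ[P] P[f t | 𝓕 t] := fun t =>
    (hZ2 t).trans (condExp_congr_ae (h2 t).coeFn_toLp)
  refine ⟨Z, hZ1, hZ3, fun hs => lt_of_le_of_lt (lintegral_mono fun t => ?_) hs⟩
  rw [lintegral_enorm_sq, lintegral_enorm_sq, eLpNorm_congr_ae (hZ3 t)]
  gcongr
  exact eLpNorm_condExp_le_eLpNorm _ one_le_two

lemma exists_progressive_condExp_inner [Fact (0 ≤ T)] [IsProbabilityMeasure P]
    (𝓕 : Filtration (Time T) mΩ) {θ : Time T → L2 T} (hθ : StronglyMeasurable θ) {M : ℝ}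
    (hM : ∀ t, ‖θ t‖ ≤ M) {u : Time T → Ω → ℝ} (hu : IsL2Process P u) :
    ∃ Z : Time T → Ω → ℝ, IsStronglyProgressive 𝓕 Z ∧ SqIntProcess P Z ∧
      ∀ t, Z t =ᵐ[P] P[fun ω => inner ℝ (θ t) (pathMap u ω) | 𝓕 t] := by
  set e : Lp (L2 T) 2 P := hu.memLp_pathMap.toLp _ with he
  obtain ⟨Z, hZ1, hZ2⟩ := exists_progressive_condExp_of_stronglyMeasurable 𝓕
    ((continuous_inner_compLp e).comp_stronglyMeasurable hθ)
  refine ⟨Z, hZ1, ?_, fun t => (hZ2 t).trans (condExp_congr_ae ?_)⟩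
  · have hb : ∀ t, ∫⁻ ω, ‖Z t ω‖ₑ ^ 2 ∂P ≤ ENNReal.ofReal (M * ‖e‖) ^ 2 := by
      intro t
      rw [lintegral_enorm_sq, eLpNorm_congr_ae (hZ2 t)]
      gcongr
      refine (eLpNorm_condExp_le_eLpNorm _ one_le_two).trans ?_
      rw [← Lp.enorm_def, ← ofReal_norm]
      refine ENNReal.ofReal_le_ofReal ((ContinuousLinearMap.norm_compLp_le _ _).trans ?_)
      rw [innerSL_apply_norm]
      gcongr
      exact hM t
    refine lt_of_le_of_lt (lintegral_mono hb) ?_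
    rw [lintegral_const]
    exact ENNReal.mul_lt_top (by simp) (measure_lt_top _ _)
  · filter_upwards [ContinuousLinearMap.coeFn_compLp (innerSL ℝ (θ t)) e,
      hu.memLp_pathMap.coeFn_toLp] with ω h1 h2
    refine h1.trans ?_
    rw [he, h2]
    rfl

lemma IsL2Process.integrable_inner [IsFiniteMeasure P] {u : Time T → Ω → ℝ}
    (hu : IsL2Process P u) (g : L2 T) : Integrable (fun ω => inner ℝ g (pathMap u ω)) P :=
  (hu.memLp_pathMap.integrable one_le_two).const_inner g

lemma IsL2Process.integrable_inner_clm [IsFiniteMeasure P] {u : Time T → Ω → ℝ}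
    (hu : IsL2Process P u) (A : L2 T →L[ℝ] L2 T) (g : L2 T) :
    Integrable (fun ω => inner ℝ g (A (pathMap u ω))) P :=
  (A.integrable_comp (hu.memLp_pathMap.integrable one_le_two)).const_inner g

/-- On `[0,t] × Ω` the integrand is measurable for the product with `𝓕 t`, so integrating out time
leaves an `𝓕 t`-measurable variable. -/
lemma stronglyMeasurable_setIntegral_progressive {𝓕 : Filtration (Time T) mΩ}
    {u : Time T → Ω → ℝ} (hu : IsStronglyProgressive 𝓕 u) {g : Time T → ℝ} (hg : Measurable g)
    (t : Time T) : StronglyMeasurable[𝓕 t] fun ω => ∫ s in Iic t, g s * u s ω := by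
  have h1 : @StronglyMeasurable _ _ _ (Subtype.instMeasurableSpace.prod (𝓕 t))
      (fun p : Iic t × Ω => g p.1 * u p.1 p.2) := by
    refine StronglyMeasurable.mul ?_ (hu t)
    exact ((hg.comp measurable_subtype_coe).comp measurable_fst).stronglyMeasurable
  have h2 : (fun ω => ∫ s in Iic t, g s * u s ω)
      = fun ω => ∫ s : Iic t, g s * u s ω ∂(Measure.comap Subtype.val volume) := by
    funext ω
    exact (integral_subtype_comap measurableSet_Iic (fun s => g s * u s ω)).symm
  rw [h2]
  exact @StronglyMeasurable.integral_prod_left' _ _ _ _ (𝓕 t) _ _ _ _ _ h1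

lemma integral_mul_condExp [IsFiniteMeasure P] {m : MeasurableSpace Ω} (hm : m ≤ mΩ)
    {X Y : Ω → ℝ} (hX : MemLp X 2 P) (hY : MemLp Y 2 P) (hYm : StronglyMeasurable[m] Y) :
    ∫ ω, (P[X | m]) ω * Y ω ∂P = ∫ ω, X ω * Y ω ∂P := by
  have hi : Integrable (fun ω => X ω * Y ω) P := hX.integrable_mul hY
  have h1 : P[fun ω => X ω * Y ω | m] =ᵐ[P] fun ω => (P[X | m]) ω * Y ω :=
    condExp_mul_of_stronglyMeasurable_right hYm hi (hX.integrable one_le_two)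
  rw [← integral_condExp hm (f := fun ω => X ω * Y ω)]
  exact (integral_congr_ae h1).symm

lemma integral_inner_pathMap_congr [SFinite P] {u v h : Time T → Ω → ℝ} (hu : IsL2Process P u)
    (hv : IsL2Process P v) (hh : IsL2Process P h)
    (he : ∀ᵐ t : Time T, ∫ ω, u t ω * h t ω ∂P = ∫ ω, v t ω * h t ω ∂P) :
    ∫ ω, inner ℝ (pathMap u ω) (pathMap h ω) ∂P = ∫ ω, inner ℝ (pathMap v ω) (pathMap h ω) ∂P := by
  rw [hu.integral_inner_pathMap hh, hv.integral_inner_pathMap hh, integral_prod _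
    (hu.integrable_mul hh), integral_prod _ (hv.integrable_mul hh)]
  exact integral_congr_ae he

/-- Against progressive strategies a process can be replaced by its optional projection. -/
lemma integral_inner_pathMap_condExp [Fact (0 ≤ T)] [IsFiniteMeasure P]
    {𝓕 : Filtration (Time T) mΩ} {f Z h : Time T → Ω → ℝ} (hf : IsL2Process P f)
    (hZ : IsL2Process P Z) (hZf : ∀ t, Z t =ᵐ[P] P[f t | 𝓕 t]) (hh : Admissible 𝓕 P h) :
    ∫ ω, inner ℝ (pathMap Z ω) (pathMap h ω) ∂P
      = ∫ ω, inner ℝ (pathMap f ω) (pathMap h ω) ∂P := by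
  refine integral_inner_pathMap_congr hZ hf hh.isL2Process ?_
  filter_upwards [hf.ae_memLp_section, hh.isL2Process.ae_memLp_section] with t h1 h2
  rw [← integral_mul_condExp (𝓕.le t) h1 h2 (hh.1.stronglyAdapted t)]
  refine integral_congr_ae ?_
  filter_upwards [hZf t] with ω hω
  rw [hω]

/-- The strategy `1_C ψ` for `C ∈ 𝓕_t` and `ψ` supported on `[t,T]`. -/
lemma exists_admissible_test [Fact (0 ≤ T)] [IsFiniteMeasure P] {𝓕 : Filtration (Time T) mΩ}
    {t : Time T} {ψ : L2 T} (hψ : ∀ᵐ s, s < t → ψ s = 0) {E : Set Ω} (hE : MeasurableSet[𝓕 t] E) :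
    ∃ h, Admissible 𝓕 P h ∧ (∀ s ω, h s ω = (Ici t).indicator ψ s * E.indicator (fun _ => 1) ω) ∧
      ∀ ω, pathMap h ω = E.indicator (fun _ => ψ) ω := by
  classical
  have hψm : Measurable ((Ici t).indicator (ψ : Time T → ℝ)) :=
    (Lp.stronglyMeasurable ψ).measurable.indicator measurableSet_Ici
  have hψ2 : MemLp ((Ici t).indicator (ψ : Time T → ℝ)) 2 (volume : Measure (Time T)) :=
    (Lp.memLp ψ).indicator measurableSet_Ici
  set h : Time T → Ω → ℝ := fun s ω => (Ici t).indicator ψ s * E.indicator (fun _ => 1) ω with hh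
  have hprog : IsStronglyProgressive 𝓕 h := by
    rw [isStronglyProgressive_iff]
    have h1 := measurableSet_progSigma_prod (𝓕 := 𝓕) (σ := t) (A := Ici t) measurableSet_Ici
      (fun s hs => hs) hE
    have h2 : Measurable[progSigma 𝓕] (fun p : Time T × Ω => (Ici t).indicator (ψ : Time T → ℝ) p.1) :=
      hψm.comp (measurable_fst_progSigma 𝓕)
    convert Measurable.indicator h2 h1 using 1
    funext p
    by_cases hp1 : t ≤ p.1 <;> by_cases hp2 : p.2 ∈ E <;>
      simp [Function.uncurry, hh, hp1, hp2]
  have hm := measurable_uncurry_of_progressive hprog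
  refine ⟨h, ⟨hprog, (isL2Process_iff.1 ⟨hm, ?_⟩).2⟩, fun _ _ => rfl, fun ω => ?_⟩
  · rw [memLp_two_iff_integrable_sq hm.aestronglyMeasurable]
    have h3 : Integrable (E.indicator (fun _ => (1:ℝ))) P :=
      (integrable_const 1).indicator (𝓕.le t _ hE)
    refine (hψ2.integrable_sq.mul_prod h3).congr (ae_of_all _ fun p => ?_)
    by_cases hp2 : p.2 ∈ E <;> simp [Function.uncurry, hh, hp2]
  · by_cases hω : ω ∈ E
    · have : toL2 (fun s => h s ω) = toL2 ψ := by
        refine toL2_congr ?_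
        filter_upwards [hψ] with s hs
        by_cases hts : t ≤ s
        · simp [hh, hts, hω]
        · simp [hh, hts, hs (not_le.1 hts)]
      rw [pathMap, this, indicator_of_mem hω, toL2_eq (Lp.memLp ψ)]
      exact Lp.toLp_coeFn ψ _
    · have : toL2 (fun s => h s ω) = toL2 (T := T) (fun _ => 0) := by
        congr 1
        funext s
        simp [hh, hω]
      rw [pathMap, this, indicator_of_notMem hω, toL2_eq MemLp.zero']
      exact MemLp.toLp_zero _

/-- The test strategies determine the conditional expectations of pairings with `ψ`. -/
lemma condExp_inner_eq_of_forall_admissible [Fact (0 ≤ T)] [IsFiniteMeasure P]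
    {𝓕 : Filtration (Time T) mΩ} {t : Time T} {ψ : L2 T} (hψ : ∀ᵐ s, s < t → ψ s = 0)
    {X Y : Ω → L2 T} (hX : Integrable (fun ω => inner ℝ ψ (X ω)) P)
    (hY : Integrable (fun ω => inner ℝ ψ (Y ω)) P)
    (hXY : ∀ h, Admissible 𝓕 P h →
      ∫ ω, inner ℝ (X ω) (pathMap h ω) ∂P = ∫ ω, inner ℝ (Y ω) (pathMap h ω) ∂P) :
    P[fun ω => inner ℝ ψ (X ω) | 𝓕 t] =ᵐ[P] P[fun ω => inner ℝ ψ (Y ω) | 𝓕 t] := by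
  refine (ae_eq_condExp_of_forall_setIntegral_eq (𝓕.le t) hY
    (fun _ _ _ => integrable_condExp.integrableOn) (fun E hE _ => ?_)
    stronglyMeasurable_condExp.aestronglyMeasurable)
  obtain ⟨h, hh, -, hp⟩ := exists_admissible_test (P := P) hψ hE
  rw [setIntegral_condExp (𝓕.le t) hX hE, ← integral_indicator (𝓕.le t _ hE),
    ← integral_indicator (𝓕.le t _ hE)]
  have key : ∀ Z : Ω → L2 T, (fun ω => inner ℝ (Z ω) (pathMap h ω))
      = E.indicator fun ω => inner ℝ ψ (Z ω) := by
    intro Z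
    funext ω
    rw [hp ω]
    by_cases hω : ω ∈ E <;> simp [hω, real_inner_comm]
  have := hXY h hh
  rwa [key X, key Y] at this

end ConditionalProcesses

/-! ### From the first order condition to the Volterra equation. -/

section Solution

variable {Ω : Type*} {mΩ : MeasurableSpace Ω} {T : ℝ} {P : Measure Ω}
  {K : Time T → Time T → ℝ} {C ε : ℝ}

lemma toL2_coeFn (g : L2 T) : toL2 (fun s => g s) = g := by
  rw [toL2_eq (Lp.memLp g)]
  exact Lp.toLp_coeFn g _

lemma IsL2Process.inner_toL2_pathMap [SFinite P] {u : Time T → Ω → ℝ} (hu : IsL2Process P u) :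
    ∀ᵐ ω ∂P, ∀ f : Time T → ℝ, MemLp f 2 (volume : Measure (Time T)) →
      inner ℝ (toL2 f) (pathMap u ω) = ∫ s, f s * u s ω := by
  filter_upwards [hu.ae_memLp_path] with ω hω f hf
  rw [pathMap, inner_toL2_right hω]
  refine integral_congr_ae ?_
  filter_upwards [coeFn_toL2 hf] with s hs
  rw [hs]

/-- Integrating a process against a kernel with uniformly bounded rows. -/
lemma IsL2Process.integral_kernel [IsFiniteMeasure P] {k : Time T → Time T → ℝ}
    (hk : Measurable (Function.uncurry k))
    (hk2 : ∀ t, MemLp (k t) 2 (volume : Measure (Time T))) {M : ℝ} (hM : ∀ t, ‖toL2 (k t)‖ ≤ M)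
    {u : Time T → Ω → ℝ} (hu : IsL2Process P u) :
    IsL2Process P fun t ω => ∫ s, k t s * u s ω := by
  have hm : Measurable (Function.uncurry fun t ω => ∫ s, k t s * u s ω) := by
    have h1 : Measurable (fun p : (Time T × Ω) × Time T => k p.1.1 p.2 * u p.2 p.1.2) :=
      (hk.comp (by fun_prop : Measurable fun p : (Time T × Ω) × Time T => (p.1.1, p.2))).mul
        (hu.1.comp (by fun_prop : Measurable fun p : (Time T × Ω) × Time T => (p.2, p.1.2)))
    exact (h1.stronglyMeasurable.integral_prod_right').measurable
  refine isL2Process_iff.2 ⟨hm, ?_⟩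
  have hb : ∀ t, ∫⁻ ω, ‖∫ s, k t s * u s ω‖ₑ ^ 2 ∂P
      ≤ (ENNReal.ofReal M * eLpNorm (pathMap u) 2 P) ^ 2 := by
    intro t
    rw [lintegral_enorm_sq]
    gcongr
    refine eLpNorm_le_mul_eLpNorm_of_ae_le_mul ?_ 2
    filter_upwards [hu.inner_toL2_pathMap] with ω hω
    rw [← hω _ (hk2 t)]
    refine (norm_inner_le_norm _ _).trans ?_
    gcongr
    exact hM t
  refine lt_of_le_of_lt (lintegral_mono hb) ?_
  rw [lintegral_const]
  exact ENNReal.mul_lt_top (ENNReal.pow_lt_top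
    (ENNReal.mul_lt_top ENNReal.ofReal_lt_top hu.memLp_pathMap.2)) (measure_lt_top _ _)

lemma IsL2Process.ae_eq_zero [SFinite P] {u : Time T → Ω → ℝ} (hu : IsL2Process P u)
    (h : ∫ ω, ‖pathMap u ω‖ ^ 2 ∂P = 0) :
    ∀ᵐ p ∂((volume : Measure (Time T)).prod P), u p.1 p.2 = 0 := by
  have h1 : ∫ p : Time T × Ω, u p.1 p.2 * u p.1 p.2 ∂((volume : Measure (Time T)).prod P) = 0 := by
    rw [← hu.integral_inner_pathMap hu, ← h]
    simp_rw [real_inner_self_eq_norm_sq]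
  rw [integral_eq_zero_iff_of_nonneg (fun p => mul_self_nonneg _) (hu.integrable_mul hu)] at h1
  filter_upwards [h1] with p hp
  simpa using hp

lemma ae_prod_of_forall_ae_eq [SFinite P] {u v : Time T → Ω → ℝ}
    (hu : Measurable (Function.uncurry u)) (hv : Measurable (Function.uncurry v))
    (h : ∀ᵐ t : Time T, u t =ᵐ[P] v t) : ProcessEq P u v :=
  (Measure.ae_prod_iff_ae_ae (measurableSet_eq_fun hu hv)).2 h

lemma norm_toL2_symm_le (hK : IsMonotoneKernel K C) (t : Time T) :
    ‖toL2 fun s => K t s + K s t‖ ≤ Real.sqrt C + Real.sqrt C := by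
  have h1 := hK.row_memLp t
  have h2 := hK.col_memLp t
  have h3 : (toL2 fun s => K t s + K s t) = toL2 (K t) + toL2 fun s => K s t := by
    rw [toL2_eq h1, toL2_eq h2]
    exact toL2_eq (h1.add h2)
  rw [h3]
  refine (norm_add_le _ _).trans (add_le_add ?_ ?_)
  · exact Real.le_sqrt_of_sq_le ((norm_toL2_sq h1).le.trans (hK.row_le t))
  · exact Real.le_sqrt_of_sq_le ((norm_toL2_sq h2).le.trans (hK.col_le t))

lemma IsMonotoneKernel.measurable_symm (hK : IsMonotoneKernel K C) :
    Measurable (Function.uncurry fun t s => K t s + K s t) :=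
  hK.measurable.add (hK.measurable.comp measurable_swap)

lemma IsMonotoneKernel.memLp_symm (hK : IsMonotoneKernel K C) (t : Time T) :
    MemLp (fun s => K t s + K s t) 2 (volume : Measure (Time T)) :=
  (hK.row_memLp t).add (hK.col_memLp t)

/-- The operator `symmOp K ε` along the paths of a process. -/
lemma IsMonotoneKernel.symmOp_pathMap (hK : IsMonotoneKernel K C) [SFinite P]
    {u : Time T → Ω → ℝ} (hu : IsL2Process P u) :
    ∀ᵐ ω ∂P, symmOp K ε (pathMap u ω)
      = pathMap (fun t ω => 2 * ε * u t ω + ∫ s, (K t s + K s t) * u s ω) ω := by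
  filter_upwards [hu.ae_memLp_path] with ω hω
  have h1 : (fun t => symmOp K ε (pathMap u ω) t)
      =ᵐ[volume] fun t => 2 * ε * u t ω + ∫ s, (K t s + K s t) * u s ω := by
    have hc := coeFn_toL2 hω
    filter_upwards [coeFn_symmOp hK.sqInt ε (pathMap u ω), hc] with t h2 h3
    rw [h2, pathMap, h3, add_assoc]
    congr 1
    have hi1 : Integrable fun s => K t s * toL2 (fun t => u t ω) s :=
      (hK.row_memLp t).integrable_mul (Lp.memLp _)
    have hi2 : Integrable fun s => K s t * toL2 (fun t => u t ω) s :=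
      (hK.col_memLp t).integrable_mul (Lp.memLp _)
    rw [← integral_add hi1 hi2]
    refine integral_congr_ae ?_
    filter_upwards [hc] with s hs
    rw [hs]
    ring
  rw [← toL2_coeFn (symmOp K ε (pathMap u ω)), pathMap]
  exact toL2_congr h1

/-- The first order condition holds pointwise once the anticipating part is projected. -/
lemma first_order_condition_projected [Fact (0 ≤ T)] [IsProbabilityMeasure P]
    {𝓕 : Filtration (Time T) mΩ} (hK : IsMonotoneKernel K C) {b u q : Time T → Ω → ℝ}
    (hb : Admissible 𝓕 P b) (hu : Admissible 𝓕 P u) (hq : Admissible 𝓕 P q)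
    (hqu : ∀ t, q t =ᵐ[P] P[fun ω => ∫ s, (K t s + K s t) * u s ω | 𝓕 t])
    (hfoc : ∀ h, Admissible 𝓕 P h →
      ∫ ω, inner ℝ (symmOp K ε (pathMap u ω)) (pathMap h ω) ∂P
        = ∫ ω, inner ℝ (pathMap b ω) (pathMap h ω) ∂P) :
    ∀ᵐ p ∂((volume : Measure (Time T)).prod P), 2 * ε * u p.1 p.2 + q p.1 p.2 - b p.1 p.2 = 0 := by
  have hbL := hb.isL2Process
  have huL := hu.isL2Process
  have hqL := hq.isL2Process
  have hcL := huL.integral_kernel hK.measurable_symm hK.memLp_symm (norm_toL2_symm_le hK)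
  have heL := huL.const_mul (2 * ε)
  -- The residual of the projected equation is itself admissible. Tested against itself, with the
  -- anticipating integral replaced by its optional projection `q`, it has norm zero.
  set r : Time T → Ω → ℝ := fun t ω => 2 * ε * u t ω + q t ω - b t ω with hr
  have hrL : IsL2Process P r := (heL.add hqL).sub hbL
  have hrA : Admissible 𝓕 P r := by
    refine ⟨?_, (isL2Process_iff.1 hrL).2⟩
    exact fun t => (((hu.1 t).const_mul (2 * ε)).add (hq.1 t)).sub (hb.1 t)
  have h1 := hfoc r hrA
  have h2 := integral_inner_pathMap_condExp hcL hqL hqu hrA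
  have h3 : ∫ ω, inner ℝ (symmOp K ε (pathMap u ω)) (pathMap r ω) ∂P
      = ∫ ω, inner ℝ (pathMap (fun t ω => 2 * ε * u t ω + ∫ s, (K t s + K s t) * u s ω) ω)
          (pathMap r ω) ∂P := by
    refine integral_congr_ae ?_
    filter_upwards [hK.symmOp_pathMap (ε := ε) huL] with ω hω
    rw [hω]
  rw [h3, (heL.add hcL).integral_inner_pathMap hrL, hbL.integral_inner_pathMap hrL] at h1
  rw [hqL.integral_inner_pathMap hrL, hcL.integral_inner_pathMap hrL] at h2
  refine hrL.ae_eq_zero ?_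
  have h4 : ∫ ω, ‖pathMap r ω‖ ^ 2 ∂P = ∫ p : Time T × Ω, r p.1 p.2 * r p.1 p.2
      ∂((volume : Measure (Time T)).prod P) := by
    rw [← hrL.integral_inner_pathMap hrL]
    simp_rw [real_inner_self_eq_norm_sq]
  rw [h4]
  have h5 : ∀ p : Time T × Ω, r p.1 p.2 * r p.1 p.2 = 2 * ε * u p.1 p.2 * r p.1 p.2
      + q p.1 p.2 * r p.1 p.2 - b p.1 p.2 * r p.1 p.2 := by
    intro p
    simp only [hr]
    ring
  have h6 : ∀ p : Time T × Ω, (2 * ε * u p.1 p.2 + ∫ s, (K p.1 s + K s p.1) * u s p.2) * r p.1 p.2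
      = 2 * ε * u p.1 p.2 * r p.1 p.2 + (∫ s, (K p.1 s + K s p.1) * u s p.2) * r p.1 p.2 :=
    fun p => add_mul _ _ _
  simp_rw [h6] at h1
  rw [integral_add (heL.integrable_mul hrL) (hcL.integrable_mul hrL)] at h1
  simp_rw [h5]
  have hi : Integrable (fun p : Time T × Ω => 2 * ε * u p.1 p.2 * r p.1 p.2 + q p.1 p.2 * r p.1 p.2)
      ((volume : Measure (Time T)).prod P) := (heL.integrable_mul hrL).add (hqL.integrable_mul hrL)
  rw [integral_sub hi (hbL.integrable_mul hrL),
    integral_add (heL.integrable_mul hrL) (hqL.integrable_mul hrL)]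
  linarith

lemma setIntegral_volterraKernel (t : Time T) (f : Time T → ℝ) :
    ∫ s in Iic t, volterraKernel K ε t s * f s = ∫ s, volterraKernel K ε t s * f s := by
  rw [← integral_indicator measurableSet_Iic]
  congr 1
  funext s
  by_cases h : s ≤ t
  · simp [h]
  · simp [h, volterraKernel]

/-- The solution of the first order condition, in Volterra form. -/
theorem exists_volterra_solution [Fact (0 ≤ T)] [IsProbabilityMeasure P]
    {𝓕 : Filtration (Time T) mΩ} (hK : IsMonotoneKernel K C) (hε : 0 < ε)
    {b : Time T → Ω → ℝ} (hb : Admissible 𝓕 P b) :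
    ∃ a u, Admissible 𝓕 P a ∧ Admissible 𝓕 P u ∧
      (∀ t, ∀ᵐ ω ∂P, a t ω = 1 / (2 * ε) * (b t ω
        - (P[fun ω => inner ℝ (costate K ε t) (pathMap b ω) | 𝓕 t]) ω)) ∧
      (∀ t, ∀ᵐ ω ∂P, u t ω = a t ω + ∫ s in Iic t, volterraKernel K ε t s * u s ω) ∧
      ∀ h, Admissible 𝓕 P h → ∫ ω, inner ℝ (symmOp K ε (pathMap u ω)) (pathMap h ω) ∂P
        = ∫ ω, inner ℝ (pathMap b ω) (pathMap h ω) ∂P := by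
  obtain ⟨u₀, hu₀, hfoc⟩ := exists_first_order_condition 𝓕 (by positivity : 0 < 2 * ε)
    (hK.le_inner_symmOp ε) hb.isL2Process
  obtain ⟨C', hC', hB⟩ := hK.exists_integral_volterraKernel_le hε
  have hBm := hK.measurable_volterraKernel hε
  have hBs : StronglyMeasurable fun t => toL2 (volterraKernel K ε t) := by
    convert stronglyMeasurable_toLp hBm (fun t => (hB t).1) using 2 with t
    exact toL2_eq (hB t).1
  have hσs : StronglyMeasurable fun t => toL2 fun s => K t s + K s t := by
    convert stronglyMeasurable_toLp hK.measurable_symm hK.memLp_symm using 2 with t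
    exact toL2_eq (hK.memLp_symm t)
  have hBn : ∀ t, ‖toL2 (volterraKernel K ε t)‖ ≤ Real.sqrt C' := fun t =>
    Real.le_sqrt_of_sq_le ((norm_toL2_sq (hB t).1).le.trans (hB t).2)
  have hu₀L := hu₀.isL2Process
  have hbL := hb.isL2Process
  obtain ⟨q, hq1, hq2, hq⟩ := exists_progressive_condExp_inner 𝓕 hσs (norm_toL2_symm_le hK) hu₀L
  obtain ⟨W, hW1, hW2, hW⟩ := exists_progressive_condExp_inner 𝓕 hBs hBn hu₀L
  obtain ⟨Z, hZ1, hZ2, hZ⟩ := exists_progressive_condExp_inner 𝓕 (hK.stronglyMeasurable_costate hε)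
    (hK.norm_costate_le hε) hbL
  have hWL := Admissible.isL2Process (𝓕 := 𝓕) (P := P) ⟨hW1, hW2⟩
  have hZL := Admissible.isL2Process (𝓕 := 𝓕) (P := P) ⟨hZ1, hZ2⟩
  have hqL := Admissible.isL2Process (𝓕 := 𝓕) (P := P) ⟨hq1, hq2⟩
  -- the Volterra integral is adapted
  have hWu : ∀ t, W t =ᵐ[P] fun ω => ∫ s in Iic t, volterraKernel K ε t s * u₀ s ω := by
    intro t
    have h1 : (fun ω => inner ℝ (toL2 (volterraKernel K ε t)) (pathMap u₀ ω))
        =ᵐ[P] fun ω => ∫ s in Iic t, volterraKernel K ε t s * u₀ s ω := by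
      filter_upwards [hu₀L.inner_toL2_pathMap] with ω hω
      rw [hω _ (hB t).1, setIntegral_volterraKernel t fun s => u₀ s ω]
    refine (hW t).trans ((condExp_congr_ae h1).trans ?_)
    rw [condExp_of_stronglyMeasurable (𝓕.le t)]
    · exact stronglyMeasurable_setIntegral_progressive hu₀.1 (hBm.comp measurable_prodMk_left) t
    · exact (hu₀L.integrable_inner _).congr h1
  -- The elimination of the future. By `integral_symm_kernel` the anticipating integral is the
  -- costate paired with `symmOp K ε u₀`, minus `2ε` times the Volterra integral. Test strategies
  -- supported on `[t,T]` then replace `symmOp K ε u₀` by `b` under conditioning on `𝓕 t`.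
  have hqZ : ∀ t, ∀ᵐ ω ∂P, q t ω = Z t ω - 2 * ε * W t ω := by
    intro t
    have h1 : (fun ω => inner ℝ (toL2 fun s => K t s + K s t) (pathMap u₀ ω)) =ᵐ[P]
        (fun ω => inner ℝ (costate K ε t) (symmOp K ε (pathMap u₀ ω)))
          - (2 * ε) • fun ω => inner ℝ (toL2 (volterraKernel K ε t)) (pathMap u₀ ω) := by
      refine ae_of_all _ fun ω => ?_
      have h2 := hK.integral_symm_kernel hε t (pathMap u₀ ω)
      rw [setIntegral_volterraKernel] at h2
      have h3 : ∀ f : Time T → ℝ, MemLp f 2 (volume : Measure (Time T)) →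
          inner ℝ (toL2 f) (pathMap u₀ ω) = ∫ s, f s * pathMap u₀ ω s := by
        intro f hf
        rw [real_inner_comm, inner_toL2_right hf]
        simp_rw [mul_comm]
      simp only [Pi.sub_apply, Pi.smul_apply, smul_eq_mul]
      rw [h3 _ (hK.memLp_symm t), h2, h3 _ (hB t).1]
    have hi1 := hu₀L.integrable_inner_clm (symmOp K ε) (costate K ε t)
    have hi2 := hu₀L.integrable_inner (toL2 (volterraKernel K ε t))
    have h4 := condExp_inner_eq_of_forall_admissible (𝓕 := 𝓕) (hK.costate_eq_zero hε t) hi1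
      (hbL.integrable_inner _) hfoc
    filter_upwards [hq t, condExp_congr_ae (m := 𝓕 t) h1, condExp_sub hi1 (hi2.smul (2 * ε)) (𝓕 t),
      condExp_smul (2 * ε) (fun ω => inner ℝ (toL2 (volterraKernel K ε t)) (pathMap u₀ ω)) (𝓕 t)
        (μ := P), h4, hZ t, hW t] with ω e1 e2 e3 e4 e5 e6 e7
    rw [e1, e2, e3, Pi.sub_apply, e4, Pi.smul_apply, e5, ← e6, ← e7, smul_eq_mul]
  have hr := first_order_condition_projected hK hb hu₀ ⟨hq1, hq2⟩ (fun t => (hq t).trans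
    (condExp_congr_ae (by
      filter_upwards [hu₀L.inner_toL2_pathMap] with ω hω
      exact hω _ (hK.memLp_symm t)))) hfoc
  set a : Time T → Ω → ℝ := fun t ω => 1 / (2 * ε) * (b t ω - Z t ω) with ha
  -- The solution is redefined by the right-hand side. It changes only on a `dt ⊗ P`-null set, so
  -- the Volterra integral is almost surely unchanged, and the equation now holds at every `t`.
  set u : Time T → Ω → ℝ := fun t ω => a t ω + W t ω with hu
  have haL : IsL2Process P a := (hbL.sub hZL).const_mul _
  have huL : IsL2Process P u := haL.add hWL
  have hap : IsStronglyProgressive 𝓕 a := fun t => ((hb.1 t).sub (hZ1 t)).const_mul _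
  have hup : IsStronglyProgressive 𝓕 u := fun t => (hap t).add (hW1 t)
  have huu : ∀ᵐ p ∂((volume : Measure (Time T)).prod P), u p.1 p.2 = u₀ p.1 p.2 := by
    have h1 : ProcessEq P q fun t ω => Z t ω - 2 * ε * W t ω :=
      ae_prod_of_forall_ae_eq hqL.1 (hZL.sub (hWL.const_mul _)).1 (ae_of_all _ hqZ)
    filter_upwards [hr, h1] with p h2 h3
    rw [h3] at h2
    simp only [hu, ha]
    field_simp
    linarith
  have hpath := pathMap_congr huu
  refine ⟨a, u, ⟨hap, (isL2Process_iff.1 haL).2⟩, ⟨hup, (isL2Process_iff.1 huL).2⟩, fun t => ?_,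
    fun t => ?_, fun h hh => ?_⟩
  · filter_upwards [hZ t] with ω hω
    simp only [ha]
    rw [hω]
  · filter_upwards [hWu t, ae_ae_path huu] with ω h1 h2
    have h3 : ∫ s in Iic t, volterraKernel K ε t s * u s ω
        = ∫ s in Iic t, volterraKernel K ε t s * u₀ s ω := by
      refine setIntegral_congr_ae measurableSet_Iic ?_
      filter_upwards [h2] with s hs _
      rw [hs]
    rw [h3, ← h1]
  · rw [← hfoc h hh]
    refine integral_congr_ae ?_
    filter_upwards [hpath] with ω hω
    rw [hω]

end Solution

/-! ### Gronwall's inequality and uniqueness for the Volterra equation. -/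

section Uniqueness

variable {T : ℝ}

/-- Gronwall for an almost everywhere inequality: integrated against `e^{-(c+1)t}`, the running
integral gains the factor `1/(c+1)` by Fubini. The weighted integral of `F` is then at most `c/(c+1)
< 1` times itself, so it vanishes. -/
lemma ae_eq_zero_of_le_mul_runningIntegral {F : Time T → ℝ} (hF : Integrable F)
    (h0 : ∀ t, 0 ≤ F t) {c : ℝ} (hc : 0 ≤ c) (h : ∀ᵐ t : Time T, F t ≤ c * runningIntegral F t) :
    F =ᵐ[volume] 0 := by
  have hd : (0:ℝ) < c + 1 := by positivity
  set w : Time T → ℝ := fun t => Real.exp (-((c + 1) * t)) with hw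
  have hwc : Continuous w := by fun_prop
  have hwi : Integrable w := hwc.integrable_of_hasCompactSupport (HasCompactSupport.of_compactSpace w)
  have hwF : Integrable fun t => w t * F t := by
    refine hF.bdd_mul (c := 1) hwc.aestronglyMeasurable (ae_of_all _ fun t => ?_)
    rw [Real.norm_of_nonneg (Real.exp_nonneg _), Real.exp_le_one_iff, neg_nonpos]
    exact mul_nonneg hd.le t.2.1
  have hwR : Integrable fun t => w t * runningIntegral F t :=
    hwi.mul_bdd (c := ∫ s, |F s|) (aestronglyMeasurable_runningIntegral hF)
      (ae_of_all _ fun t => abs_runningIntegral_le hF t)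
  have hW : ∀ s : Time T, ∫ t in Ici s, w t ≤ (c + 1)⁻¹ * w s := by
    intro s
    rw [integral_Ici_eq (g := fun t => Real.exp (-((c + 1) * t))) s]
    have hderiv : ∀ t ∈ uIcc (s : ℝ) T, HasDerivAt (fun t : ℝ => -((c + 1)⁻¹ * Real.exp (-((c + 1) * t))))
        (Real.exp (-((c + 1) * t))) t := by
      intro t _
      have h1 := ((((hasDerivAt_id t).const_mul (c + 1)).neg).exp.const_mul (c + 1)⁻¹).neg
      refine h1.congr_deriv ?_
      simp only [id, Pi.neg_apply, mul_one]
      field_simp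
    rw [intervalIntegral.integral_eq_sub_of_hasDerivAt hderiv
      (Continuous.intervalIntegrable (by fun_prop) _ _)]
    have : 0 ≤ (c + 1)⁻¹ * Real.exp (-((c + 1) * T)) := by positivity
    simp only [hw]
    linarith
  have h1 : ∫ t, w t * F t ≤ c * ∫ t, w t * runningIntegral F t := by
    rw [← integral_const_mul]
    refine integral_mono_ae hwF (hwR.const_mul c) ?_
    filter_upwards [h] with t ht
    have := mul_le_mul_of_nonneg_left ht (Real.exp_nonneg (-((c + 1) * (t:ℝ))))
    simp only [hw]
    linarith
  have hwm : Integrable fun s => (∫ t in Ici s, w t) * F s := by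
    have hm : Measurable fun s : Time T => ∫ t in Ici s, w t := by
      have h2 : Antitone fun s : Time T => ∫ t in Ici s, w t := by
        intro s s' hs
        exact setIntegral_mono_set hwi.integrableOn (ae_of_all _ fun t => Real.exp_nonneg _)
          (Ici_subset_Ici.2 hs).eventuallyLE
      exact h2.measurable
    refine hF.bdd_mul (c := (c + 1)⁻¹) hm.aestronglyMeasurable (ae_of_all _ fun s => ?_)
    rw [Real.norm_of_nonneg (integral_nonneg fun t => Real.exp_nonneg _)]
    refine (hW s).trans (mul_le_of_le_one_right (by positivity) ?_)
    simp only [hw]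
    rw [Real.exp_le_one_iff, neg_nonpos]
    exact mul_nonneg hd.le s.2.1
  have h2 : ∫ t, w t * runningIntegral F t ≤ (c + 1)⁻¹ * ∫ t, w t * F t := by
    rw [integral_mul_runningIntegral hwi hF, ← integral_const_mul]
    refine integral_mono hwm (hwF.const_mul _) fun s => ?_
    have := mul_le_mul_of_nonneg_right (hW s) (h0 s)
    simp only
    linarith
  have h3 : ∫ t, w t * F t ≤ 0 := by
    have h4 := h1.trans (mul_le_mul_of_nonneg_left h2 hc)
    have h5 : c * ((c + 1)⁻¹ * ∫ t, w t * F t) = (∫ t, w t * F t) - (c + 1)⁻¹ * ∫ t, w t * F t := by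
      field_simp
      ring
    rw [h5] at h4
    have h6 : (c + 1)⁻¹ * ∫ t, w t * F t ≤ 0 := by linarith
    exact nonpos_of_mul_nonpos_right h6 (by positivity)
  have hnn : ∀ t, 0 ≤ w t * F t := fun t => mul_nonneg (Real.exp_nonneg _) (h0 t)
  have h4 := (integral_eq_zero_iff_of_nonneg hnn hwF).1 (le_antisymm h3 (integral_nonneg hnn))
  filter_upwards [h4] with t ht
  exact (mul_eq_zero.1 ht).resolve_left (Real.exp_ne_zero _)

/-- The homogeneous Volterra equation has only the trivial solution. -/
lemma ae_eq_zero_of_volterra {k : Time T → Time T → ℝ} {c : ℝ} (hc : 0 ≤ c)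
    (hk : ∀ t, MemLp (k t) 2 (volume : Measure (Time T)) ∧ ∫ s, k t s ^ 2 ≤ c) {f : Time T → ℝ}
    (hf : MemLp f 2 (volume : Measure (Time T)))
    (h : ∀ᵐ t : Time T, f t = ∫ s in Iic t, k t s * f s) : f =ᵐ[volume] 0 := by
  have h1 : (fun t => f t ^ 2) =ᵐ[volume] 0 := by
    refine ae_eq_zero_of_le_mul_runningIntegral hf.integrable_sq (fun t => sq_nonneg _) hc ?_
    filter_upwards [h] with t ht
    have hfi : MemLp ((Iic t).indicator f) 2 (volume : Measure (Time T)) :=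
      hf.indicator measurableSet_Iic
    -- Cauchy-Schwarz on `[0,t]` bounds `f t ^ 2` by `c` times the running integral of `f ^ 2`.
    have h2 := abs_integral_mul_le (hk t).1 (toL2 ((Iic t).indicator f))
    have h3 : ∫ s, k t s * toL2 ((Iic t).indicator f) s = f t := by
      rw [ht, ← integral_indicator measurableSet_Iic]
      refine integral_congr_ae ?_
      filter_upwards [coeFn_toL2 hfi] with s hs
      rw [hs]
      by_cases hst : s ≤ t <;> simp [hst]
    have h4 : ‖toL2 ((Iic t).indicator f)‖ ^ 2 = runningIntegral (fun s => f s ^ 2) t := by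
      rw [norm_toL2_sq hfi, runningIntegral_eq_integral]
      congr 1
      funext s
      by_cases hst : s ≤ t <;> simp [hst]
    rw [h3, h4] at h2
    refine h2.trans (mul_le_mul_of_nonneg_right (hk t).2 ?_)
    exact integral_nonneg fun s => sq_nonneg _
  filter_upwards [h1] with t ht
  exact pow_eq_zero_iff two_ne_zero |>.1 ht

end Uniqueness

/-! ### Joint measurability of the price. -/

section JointMeasurability

variable {Ω : Type*} {mΩ : MeasurableSpace Ω} {T : ℝ}

/-- The process sampled at the dyadic point before `t` takes countably many random variables as
values and converges pointwise by left continuity. -/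
lemma measurable_uncurry_of_leftContinuous [Fact (0 ≤ T)] {f : Time T → Ω → ℝ}
    (hf : ∀ t, Measurable (f t))
    (hc : ∀ ω t, ContinuousWithinAt (fun t => f t ω) (Iic t) t) :
    Measurable (Function.uncurry f) := by
  have h1 : ∀ n, Measurable fun p : Time T × Ω => f (dyadicFloor n p.1) p.2 := by
    intro n s hs
    have h2 : (fun p : Time T × Ω => f (dyadicFloor n p.1) p.2) ⁻¹' s
        = ⋃ r ∈ range (dyadicFloor (T := T) n), (dyadicFloor n ⁻¹' {r}) ×ˢ (f r ⁻¹' s) := by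
      ext p
      simp only [mem_preimage, mem_iUnion, mem_prod, mem_singleton_iff, exists_prop]
      exact ⟨fun h => ⟨_, mem_range_self p.1, rfl, h⟩, fun ⟨r, _, h3, h4⟩ => by rwa [h3]⟩
    rw [h2]
    exact MeasurableSet.biUnion (countable_range_dyadicFloor n) fun r _ =>
      (measurable_dyadicFloor n (measurableSet_singleton r)).prod (hf r hs)
  refine measurable_of_tendsto_metrizable h1 (tendsto_pi_nhds.2 fun p => ?_)
  exact (hc p.2 p.1).tendsto.comp (tendsto_nhdsWithin_iff.2
    ⟨tendsto_dyadicFloor p.1, Eventually.of_forall fun n => dyadicFloor_le n p.1⟩)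

/-- Time reversal on `[0,T]`. -/
noncomputable def timeRev (t : Time T) : Time T :=
  ⟨T - t, sub_nonneg.2 t.2.2, sub_le_self _ t.2.1⟩

lemma timeRev_timeRev (t : Time T) : timeRev (timeRev t) = t :=
  Subtype.ext (sub_sub_cancel T (t : ℝ))

lemma continuous_timeRev : Continuous (timeRev (T := T)) := by
  unfold timeRev
  fun_prop

/-- Time reversal exchanges right and left continuity. It destroys adaptedness, but only joint
measurability is at stake. -/
lemma measurable_uncurry_of_rightContinuous [Fact (0 ≤ T)] {f : Time T → Ω → ℝ}
    (hf : ∀ t, Measurable (f t))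
    (hc : ∀ ω t, ContinuousWithinAt (fun t => f t ω) (Ici t) t) :
    Measurable (Function.uncurry f) := by
  have h1 : Measurable (Function.uncurry fun t : Time T => f (timeRev t)) := by
    refine measurable_uncurry_of_leftContinuous (fun t => hf _) fun ω t => ?_
    refine (hc ω (timeRev t)).comp (t := Ici (timeRev t)) continuous_timeRev.continuousWithinAt ?_
    intro s hs
    exact sub_le_sub_left (show (s:ℝ) ≤ t from hs) T
  have h2 := h1.comp ((continuous_timeRev.measurable.comp measurable_fst).prodMk
    (measurable_snd : Measurable (Prod.snd : Time T × Ω → Ω)))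
  convert h2 using 1
  funext p
  simp [Function.uncurry, timeRev_timeRev]

lemma IsSpecialSemimartingale.measurable_uncurry [Fact (0 ≤ T)] {𝓕 : Filtration (Time T) mΩ}
    {P : Measure Ω} {S : Time T → Ω → ℝ} (hS : IsSpecialSemimartingale 𝓕 P S) :
    Measurable (Function.uncurry S) := by
  obtain ⟨M, A, hM, hMc, -, hA, -, -, -, hMA⟩ := hS
  have h1 : Measurable (Function.uncurry M) := measurable_uncurry_of_rightContinuous
    (fun t => ((hM t).mono (𝓕.le t)).measurable) fun ω t => (hMc ω t).1
  have h2 : Measurable (Function.uncurry A) :=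
    measurable_uncurry_of_progressive hA.isStronglyProgressive
  convert h1.add h2 using 1
  funext p
  exact hMA p.1 p.2

end JointMeasurability

/-! ### Conditioning inside the costate pairing. -/

section Version

variable {Ω : Type*} {mΩ : MeasurableSpace Ω} {T : ℝ} {P : Measure Ω}

/-- Pairing with a function supported on `[t,T]` commutes with conditioning on `𝓕_t`. -/
lemma exists_isCondVersion [Fact (0 ≤ T)] [IsProbabilityMeasure P] (𝓕 : Filtration (Time T) mΩ)
    {b : Time T → Ω → ℝ} (hb : IsL2Process P b) (hb2 : ∀ s, MemLp (b s) 2 P) {t : Time T}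
    {ψ : L2 T} (hψ : ∀ᵐ s, s < t → ψ s = 0) :
    ∃ β, IsCondVersion 𝓕 P b t β ∧ ∀ᵐ ω ∂P,
      MemLp (cutoff t fun s => β s ω) 2 (volume : Measure (Time T)) ∧
      inner ℝ ψ (toL2 (cutoff t fun s => β s ω))
        = (P[fun ω => inner ℝ ψ (pathMap b ω) | 𝓕 t]) ω := by
  -- For the filtration frozen at `𝓕 t`, a progressive version of `E[b_s | 𝓖_s]` is exactly a
  -- jointly measurable version of `s ↦ E[b_s | 𝓕_t]`. It also makes integrals of `β` over all of
  -- `[0,T]` measurable for `𝓕 t`.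
  set 𝓖 : Filtration (Time T) mΩ := Filtration.const (Time T) (𝓕 t) (𝓕.le t) with h𝓖
  obtain ⟨β, hβ1, hβ2, hβ3⟩ := exists_progressive_condExp_of_measurable 𝓖 hb.1 hb2
  have hβ4 := hβ3 (isL2Process_iff.1 hb).2
  have hβL : IsL2Process P β := Admissible.isL2Process (𝓕 := 𝓖) ⟨hβ1, hβ4⟩
  have h1 := condExp_inner_eq_of_forall_admissible (𝓕 := 𝓖) (t := t) hψ (hβL.integrable_inner ψ)
    (hb.integrable_inner ψ) fun h hh => integral_inner_pathMap_condExp hb hβL hβ2 hh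
  have h2 : (fun ω => inner ℝ ψ (pathMap β ω)) =ᵐ[P] fun ω => ∫ s in Iic ⊤, ψ s * β s ω := by
    filter_upwards [hβL.ae_memLp_path] with ω hω
    rw [pathMap, inner_toL2_right hω, Iic_top, Measure.restrict_univ]
  have h3 : P[fun ω => inner ℝ ψ (pathMap β ω) | 𝓖 t] =ᵐ[P] fun ω => inner ℝ ψ (pathMap β ω) := by
    refine (condExp_congr_ae h2).trans (EventuallyEq.trans ?_ h2.symm)
    rw [condExp_of_stronglyMeasurable (𝓖.le t)]
    · exact stronglyMeasurable_setIntegral_progressive hβ1 (Lp.stronglyMeasurable ψ).measurable ⊤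
    · exact (hβL.integrable_inner ψ).congr h2
  refine ⟨β, ⟨hβL.1, ae_of_all _ fun s _ => hβ2 s⟩, ?_⟩
  filter_upwards [hβL.ae_memLp_path, h1, h3] with ω hω e1 e3
  refine ⟨memLp_cutoff hω t, ?_⟩
  rw [h𝓖, Filtration.const_apply] at e1
  rw [← e1]
  refine Eq.trans ?_ e3.symm
  rw [pathMap, inner_toL2_right hω, inner_toL2_right (memLp_cutoff hω t)]
  refine integral_congr_ae ?_
  filter_upwards [hψ] with s hs
  by_cases hts : t ≤ s
  · simp [cutoff, hts]
  · simp [hs (not_le.1 hts)]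

end Version

/-! ### Completing the square. -/

section Objective

variable {Ω : Type*} {mΩ : MeasurableSpace Ω} {T : ℝ} {P : Measure Ω} {K : Time T → Time T → ℝ}
  {C ε : ℝ}

lemma integrable_inner_of_memLp {f g : Ω → L2 T} (hf : MemLp f 2 P) (hg : MemLp g 2 P) :
    Integrable (fun ω => inner ℝ (f ω) (g ω)) P := by
  have h : Integrable (fun ω => ‖f ω‖ * ‖g ω‖) P := hf.norm.integrable_mul hg.norm
  exact h.mono' (hf.1.inner hg.1) (ae_of_all _ fun ω => norm_inner_le_norm _ _)

/-- Completing the square around a solution of the first order condition. -/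
lemma objective_add_le (hK : IsMonotoneKernel K C) {b u v : Ω → L2 T}
    (hu : MemLp u 2 P) (hv : MemLp v 2 P)
    (h1 : ∫ ω, inner ℝ (symmOp K ε (u ω)) (u ω) ∂P = ∫ ω, inner ℝ (b ω) (u ω) ∂P)
    (h2 : ∫ ω, inner ℝ (symmOp K ε (u ω)) (v ω) ∂P = ∫ ω, inner ℝ (b ω) (v ω) ∂P) :
    (∫ ω, inner ℝ (b ω) (v ω) ∂P) - 1 / 2 * (∫ ω, inner ℝ (symmOp K ε (v ω)) (v ω) ∂P)
        + ε * ∫ ω, ‖v ω - u ω‖ ^ 2 ∂P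
      ≤ (∫ ω, inner ℝ (b ω) (u ω) ∂P) - 1 / 2 * ∫ ω, inner ℝ (symmOp K ε (u ω)) (u ω) ∂P := by
  have hAu : MemLp (fun ω => symmOp K ε (u ω)) 2 P := (symmOp K ε).comp_memLp' hu
  have hAv : MemLp (fun ω => symmOp K ε (v ω)) 2 P := (symmOp K ε).comp_memLp' hv
  have iuu := integrable_inner_of_memLp hAu hu
  have iuv := integrable_inner_of_memLp hAu hv
  have ivv := integrable_inner_of_memLp hAv hv
  have i1 : Integrable (fun ω => inner ℝ (symmOp K ε (v ω)) (v ω)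
      - 2 * inner ℝ (symmOp K ε (u ω)) (v ω)) P := ivv.sub (iuv.const_mul 2)
  -- Coercivity at `v - u`, expanded by symmetry. The two first order conditions then convert the
  -- terms containing `symmOp K ε u` into pairings with `b`.
  have hle : 2 * ε * ∫ ω, ‖v ω - u ω‖ ^ 2 ∂P ≤ ∫ ω, (inner ℝ (symmOp K ε (v ω)) (v ω)
      - 2 * inner ℝ (symmOp K ε (u ω)) (v ω) + inner ℝ (symmOp K ε (u ω)) (u ω)) ∂P := by
    rw [← integral_const_mul]
    refine integral_mono ((hv.sub hu).integrable_norm_pow two_ne_zero |>.const_mul _)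
      (i1.add iuu) fun ω => ?_
    have h3 := hK.le_inner_symmOp ε (v ω - u ω)
    have h4 : inner ℝ (symmOp K ε (v ω)) (u ω) = inner ℝ (symmOp K ε (u ω)) (v ω) := by
      rw [inner_symmOp_left hK.sqInt, real_inner_comm]
    rw [map_sub, inner_sub_left, inner_sub_right, inner_sub_right, h4] at h3
    beta_reduce
    linarith
  rw [integral_add i1 iuu, integral_sub ivv (iuv.const_mul 2), integral_const_mul] at hle
  linarith

end Objective

/-! ### Matching the abstract solution with the data of the problem. -/

section Data

variable {Ω : Type*} {mΩ : MeasurableSpace Ω} {T : ℝ} {P : Measure Ω} {G : ℝ → ℝ}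
  {lam ε φ ϱ C : ℝ}

/-- Self-adjointness of `𝑫_t⁻¹` moves the inverse to the deterministic column, so that a single
costate serves both `a` and `B`. -/
lemma pairing_eq (hK : IsMonotoneKernel (kernelK (T := T) G lam φ ϱ) C) (hε : 0 < ε) (t : Time T)
    (f : Time T → ℝ) :
    pairing G lam ε φ ϱ t f = costatePairing (kernelK G lam φ ϱ) ε t f :=
  (hK.inner_inverse_left hε t _ _).symm

lemma kernelB_eq (hK : IsMonotoneKernel (kernelK (T := T) G lam φ ϱ) C) (hε : 0 < ε) :
    kernelB (T := T) G lam ε φ ϱ = volterraKernel (kernelK G lam φ ϱ) ε := by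
  funext t s
  simp only [kernelB, volterraKernel, pairing_eq hK hε]

/-- The anticipating linear coefficient of the payoff. -/
noncomputable def priceSignal [Fact (0 ≤ T)] (x φ ϱ : ℝ) (S : Time T → ℝ) (t : Time T) : ℝ :=
  S t - S ⊤ + 2 * (φ * (T - t) + ϱ) * x

lemma isL2Process_of_continuous [IsFiniteMeasure P] {f : Time T → ℝ} (hf : Continuous f) :
    IsL2Process P fun t _ => f t := by
  have hm : Measurable (Function.uncurry fun (t : Time T) (_ : Ω) => f t) :=
    hf.measurable.comp measurable_fst
  obtain ⟨c, hc⟩ := isCompact_univ.exists_bound_of_continuousOn hf.continuousOn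
  exact ⟨hm, MemLp.of_bound hm.aestronglyMeasurable c (ae_of_all _ fun p => hc p.1 (mem_univ _))⟩

lemma isL2Process_const [IsFiniteMeasure P] {f : Ω → ℝ} (hf : Measurable f) (h2 : MemLp f 2 P) :
    IsL2Process P fun (_ : Time T) ω => f ω :=
  ⟨hf.comp measurable_snd, h2.comp_snd _⟩

/-- Integrated against the kernel of the Volterra equation a square integrable process remains
square integrable. -/
lemma IsMonotoneKernel.isL2Process_volterra [IsFiniteMeasure P] {K : Time T → Time T → ℝ}
    (hK : IsMonotoneKernel K C) (hε : 0 < ε) {u : Time T → Ω → ℝ} (hu : IsL2Process P u) :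
    IsL2Process P fun t ω => ∫ s in Iic t, volterraKernel K ε t s * u s ω := by
  obtain ⟨C', -, hB⟩ := hK.exists_integral_volterraKernel_le hε
  have h := hu.integral_kernel (hK.measurable_volterraKernel hε) (fun t => (hB t).1)
    (M := Real.sqrt C') fun t => Real.le_sqrt_of_sq_le ((norm_toL2_sq (hB t).1).le.trans (hB t).2)
  convert h using 3 with t ω
  exact setIntegral_volterraKernel t fun s => u s ω

/-- Two square integrable solutions of the Volterra equation agree. -/
lemma IsMonotoneKernel.processEq_of_volterra [IsFiniteMeasure P] {K : Time T → Time T → ℝ}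
    (hK : IsMonotoneKernel K C) (hε : 0 < ε) {a u v : Time T → Ω → ℝ} (hu : IsL2Process P u)
    (hv : IsL2Process P v)
    (hue : ProcessEq P u fun t ω => a t ω + ∫ s in Iic t, volterraKernel K ε t s * u s ω)
    (hve : ProcessEq P v fun t ω => a t ω + ∫ s in Iic t, volterraKernel K ε t s * v s ω) :
    ProcessEq P v u := by
  obtain ⟨C', hC', hB⟩ := hK.exists_integral_volterraKernel_le hε
  have h0 : ∀ᵐ ω ∂P, pathMap (fun t ω => v t ω - u t ω) ω = 0 := by
    filter_upwards [ae_ae_path hue, ae_ae_path hve, hu.ae_memLp_path, hv.ae_memLp_path]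
      with ω h1 h2 m1 m2
    have h3 : (fun t => v t ω - u t ω) =ᵐ[volume] 0 := by
      refine ae_eq_zero_of_volterra hC' hB (m2.sub m1) ?_
      filter_upwards [h1, h2] with t e1 e2
      have i1 : Integrable fun s => volterraKernel K ε t s * u s ω := (hB t).1.integrable_mul m1
      have i2 : Integrable fun s => volterraKernel K ε t s * v s ω := (hB t).1.integrable_mul m2
      simp_rw [mul_sub]
      rw [integral_sub i2.integrableOn i1.integrableOn]
      linarith
    rw [pathMap, toL2_congr h3, toL2_eq MemLp.zero]
    exact MemLp.toLp_zero _
  have h1 := (hv.sub hu).ae_eq_zero (by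
    rw [← integral_zero Ω ℝ]
    refine integral_congr_ae ?_
    filter_upwards [h0] with ω hω
    simp [hω])
  filter_upwards [h1] with p hp
  exact sub_eq_zero.1 hp

variable [Fact (0 ≤ T)] {𝓕 : Filtration (Time T) mΩ} {S : Time T → Ω → ℝ}

lemma IsSqIntSpecialSemimartingale.isL2Process [SFinite P]
    (hS : IsSqIntSpecialSemimartingale 𝓕 P S) : IsL2Process P S :=
  isL2Process_iff.2 ⟨hS.special.measurable_uncurry, hS.sqInt⟩

lemma IsSqIntSpecialSemimartingale.isL2Process_sub_top [IsFiniteMeasure P]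
    (hS : IsSqIntSpecialSemimartingale 𝓕 P S) : IsL2Process P fun t ω => S t ω - S ⊤ ω :=
  hS.isL2Process.sub (isL2Process_const (hS.special.measurable_uncurry.comp measurable_prodMk_left)
    (hS.memLp ⊤))

lemma IsSqIntSpecialSemimartingale.isL2Process_priceSignal [IsFiniteMeasure P]
    (hS : IsSqIntSpecialSemimartingale 𝓕 P S) (x φ ϱ : ℝ) :
    IsL2Process P fun t ω => priceSignal x φ ϱ (fun t => S t ω) t :=
  hS.isL2Process_sub_top.add
    (isL2Process_of_continuous (f := fun t => 2 * (φ * (T - t) + ϱ) * x) (by fun_prop))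

/-- Only `S_t - S_T` has to be conditioned; the rest is deterministic and continuous in time. The
last clause records that `b` is the optional projection of the anticipating signal. -/
lemma exists_isProcessB [IsProbabilityMeasure P] (hS : IsSqIntSpecialSemimartingale 𝓕 P S)
    (x φ ϱ : ℝ) :
    ∃ b, IsProcessB 𝓕 P x φ ϱ S b ∧ SqIntProcess P b ∧ (∀ t, MemLp (b t) 2 P) ∧
      ∀ t, b t =ᵐ[P] P[fun ω => priceSignal x φ ϱ (fun t => S t ω) t | 𝓕 t] := by
  have hd := hS.isL2Process_sub_top
  have hd2 : ∀ t, MemLp (fun ω => S t ω - S ⊤ ω) 2 P := fun t => (hS.memLp t).sub (hS.memLp ⊤)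
  obtain ⟨Z, hZ1, hZ2, hZ3⟩ := exists_progressive_condExp_of_measurable 𝓕 hd.1 hd2
  have hZL : IsL2Process P Z :=
    Admissible.isL2Process (𝓕 := 𝓕) ⟨hZ1, hZ3 (isL2Process_iff.1 hd).2⟩
  set g : Time T → ℝ := fun t => 2 * (φ * (T - t) + ϱ) * x with hg
  have hgc : Continuous g := by fun_prop
  have hgp : IsStronglyProgressive 𝓕 fun t (_ : Ω) => g t :=
    isStronglyProgressive_iff.2 (hgc.measurable.comp (measurable_fst_progSigma 𝓕))
  have hb2 : ∀ t, MemLp (fun ω => Z t ω + g t) 2 P := by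
    intro t
    have h1 : MemLp (Z t) 2 P := ((hd2 t).condExp (m := 𝓕 t) one_le_two).ae_eq (hZ2 t).symm
    exact h1.add (memLp_const (g t))
  refine ⟨fun t ω => Z t ω + g t, ⟨fun t => (hZ1 t).add (hgp t), fun t => ?_⟩,
    (isL2Process_iff.1 (hZL.add (isL2Process_of_continuous hgc))).2, hb2, fun t => ?_⟩
  · filter_upwards [hZ2 t] with ω hω
    rw [hω]
    rfl
  · have h1 := condExp_add (m := 𝓕 t) ((hd2 t).integrable one_le_two) (integrable_const (g t))
    have h2 : P[fun ω => priceSignal x φ ϱ (fun t => S t ω) t | 𝓕 t]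
        =ᵐ[P] P[fun ω => S t ω - S ⊤ ω | 𝓕 t] + P[fun _ => g t | 𝓕 t] := h1
    filter_upwards [hZ2 t, h2] with ω e1 e2
    rw [e2, e1, Pi.add_apply, condExp_const (𝓕.le t)]

/-- The payoff along the paths of a square integrable strategy. -/
lemma ae_payoff_eq [IsFiniteMeasure P] (hS : IsSqIntSpecialSemimartingale 𝓕 P S)
    (hG : IsPropagator T G) (x lam ε : ℝ) (hφ : 0 ≤ φ) (hϱ : 0 ≤ ϱ) {u : Time T → Ω → ℝ}
    (hu : IsL2Process P u) :
    ∀ᵐ ω ∂P, payoff G x lam ε φ ϱ (fun t => S t ω) (fun t => u t ω)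
      = x * S ⊤ ω - (φ * x ^ 2 * (volume : Measure (Time T)).real univ + ϱ * x ^ 2)
        + inner ℝ (pathMap (fun t ω => priceSignal x φ ϱ (fun t => S t ω) t) ω) (pathMap u ω)
        - 1 / 2 * inner ℝ (symmOp (kernelK G lam φ ϱ) ε (pathMap u ω)) (pathMap u ω) := by
  filter_upwards [hS.isL2Process.ae_memLp_path, hu.ae_memLp_path] with ω h1 h2
  exact payoff_eq hG x lam ε hφ hϱ h1 h2

lemma integrable_payoff [IsFiniteMeasure P] (hS : IsSqIntSpecialSemimartingale 𝓕 P S)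
    (hG : IsPropagator T G) (x lam ε : ℝ) (hφ : 0 ≤ φ) (hϱ : 0 ≤ ϱ) {u : Time T → Ω → ℝ}
    (hu : IsL2Process P u) :
    Integrable (fun ω => payoff G x lam ε φ ϱ (fun t => S t ω) (fun t => u t ω)) P ∧
    ∫ ω, payoff G x lam ε φ ϱ (fun t => S t ω) (fun t => u t ω) ∂P
      = (∫ ω, (x * S ⊤ ω - (φ * x ^ 2 * (volume : Measure (Time T)).real univ + ϱ * x ^ 2)) ∂P)
        + (∫ ω, inner ℝ (pathMap (fun t ω => priceSignal x φ ϱ (fun t => S t ω) t) ω)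
          (pathMap u ω) ∂P)
        - 1 / 2 * ∫ ω, inner ℝ (symmOp (kernelK G lam φ ϱ) ε (pathMap u ω)) (pathMap u ω) ∂P := by
  have h := ae_payoff_eq hS hG x lam ε hφ hϱ hu
  have i1 : Integrable (fun ω => x * S ⊤ ω
      - (φ * x ^ 2 * (volume : Measure (Time T)).real univ + ϱ * x ^ 2)) P :=
    (((hS.memLp ⊤).integrable one_le_two).const_mul x).sub (integrable_const _)
  have i2 := integrable_inner_of_memLp (hS.isL2Process_priceSignal x φ ϱ).memLp_pathMap
    hu.memLp_pathMap
  have i3 := integrable_inner_of_memLp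
    ((symmOp (kernelK G lam φ ϱ) ε).comp_memLp' hu.memLp_pathMap) hu.memLp_pathMap
  have i12 := i1.add i2
  refine ⟨(i12.sub (i3.const_mul (1 / 2))).congr (h.mono fun ω hω => hω.symm), ?_⟩
  rw [integral_congr_ae h]
  refine (integral_sub i12 (i3.const_mul (1 / 2))).trans ?_
  rw [integral_const_mul]
  exact congrArg (· - _) (integral_add i1 i2)

end Data

end LinearPropagator

/-! ### The main theorem. -/

open LinearPropagator
theorem proposition2p1 {Ω : Type*} [mΩ : MeasurableSpace Ω] (P : Measure Ω)
    [IsProbabilityMeasure P] {T : ℝ} [Fact (0 ≤ T)] (hT : 0 < T)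
    (𝓕 : Filtration (Time T) mΩ) (h𝓕 : UsualConditions 𝓕 P)
    (S : Time T → Ω → ℝ) (hS : IsSqIntSpecialSemimartingale 𝓕 P S)
    (G : ℝ → ℝ) (hG : IsPropagator T G) (x lam ε φ ϱ : ℝ) (hlam : 0 < lam)
    (hε : 0 < ε) (hφ : 0 ≤ φ) (hϱ : 0 ≤ ϱ) :
    -- the objective is well defined and finite on the admissible set
    (∀ u, Admissible 𝓕 P u →
      (∀ᵐ ω ∂P, PathwiseIntegrable G x lam (fun t => S t ω) (fun t => u t ω)) ∧
      Integrable (fun ω => payoff G x lam ε φ ϱ (fun t => S t ω) (fun t => u t ω)) P) ∧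
    -- the kernels and the inverse operators in the definitions of `a` and `B` are well defined
    SqIntKernel (T := T) (kernelK G lam φ ϱ) ∧
    (∀ s : Time T, MemLp (fun r : Time T => kernelK G lam φ ϱ r s) 2 volume) ∧
    (∀ t : Time T, IsUnit (opD G lam ε φ ϱ t)) ∧
    (∀ t : Time T, MemLp (fun s : Time T => kernelB G lam ε φ ϱ t s) 2 volume) ∧
    -- the optimal strategy
    ∃ b a u : Time T → Ω → ℝ,
      IsProcessB 𝓕 P x φ ϱ S b ∧ SqIntProcess P b ∧
      IsProcessA 𝓕 P G lam ε φ ϱ b a ∧ SqIntProcess P a ∧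
      IsOptimal 𝓕 P G x lam ε φ ϱ S u ∧
      (∀ t, ∀ᵐ ω ∂P, u t ω = a t ω + ∫ s in Iic t, kernelB G lam ε φ ϱ t s * u s ω) ∧
      -- uniqueness of the optimal strategy
      (∀ v, IsOptimal 𝓕 P G x lam ε φ ϱ S v → ProcessEq P v u) ∧
      -- the equation determines the optimal strategy
      (∀ v, Admissible 𝓕 P v →
        ProcessEq P v (fun t ω => a t ω + ∫ s in Iic t, kernelB G lam ε φ ϱ t s * v s ω) →
        ProcessEq P v u) := by
  obtain ⟨C, hK⟩ := isMonotoneKernel_kernelK (T := T) hG hlam.le hφ hϱ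
  obtain ⟨C', -, hB⟩ := hK.exists_integral_volterraKernel_le hε
  obtain ⟨b, hbB, hbS, hb2, hbc⟩ := exists_isProcessB hS x φ ϱ
  have hb : Admissible 𝓕 P b := ⟨hbB.1, hbS⟩
  have hbL := hb.isL2Process
  have hsL := hS.isL2Process_priceSignal x φ ϱ
  obtain ⟨a, u, ha, hu, hab, hua, hfoc⟩ := exists_volterra_solution hK hε hb
  have huL := hu.isL2Process
  -- The quantitative gap: dropping the square gives optimality, and equality of the objectives
  -- forces the square to vanish. The payoff involves the anticipating signal, which is exchanged
  -- for `b` because both strategies are progressive.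
  have hgap : ∀ v, Admissible 𝓕 P v → J P G x lam ε φ ϱ S v
      + ε * ∫ ω, ‖pathMap v ω - pathMap u ω‖ ^ 2 ∂P ≤ J P G x lam ε φ ϱ S u := by
    intro v hv
    have hvL := hv.isL2Process
    have h1 := objective_add_le hK huL.memLp_pathMap hvL.memLp_pathMap (hfoc u hu) (hfoc v hv)
    rw [integral_inner_pathMap_condExp hsL hbL hbc hu,
      integral_inner_pathMap_condExp hsL hbL hbc hv] at h1
    rw [J, J, (integrable_payoff hS hG x lam ε hφ hϱ hvL).2,
      (integrable_payoff hS hG x lam ε hφ hϱ huL).2]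
    linarith
  have hkB := kernelB_eq (T := T) hK hε
  refine ⟨fun v hv => ⟨?_, (integrable_payoff hS hG x lam ε hφ hϱ hv.isL2Process).1⟩, hK.sqInt,
    hK.col_memLp, hK.isUnit_truncSymmOp hε, fun t => hkB ▸ (hB t).1, b, a, u, hbB, hbS,
    ⟨ha.1, fun t => ?_⟩, ha.2, ⟨hu, fun v hv => ?_⟩, hkB ▸ hua, fun v hv => ?_, fun v hv hve => ?_⟩
  · filter_upwards [hS.isL2Process.ae_memLp_path, hv.isL2Process.ae_memLp_path] with ω h1 h2
    exact pathwiseIntegrable hG x lam h1 h2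
  · obtain ⟨β, hβ1, hβ2⟩ := exists_isCondVersion 𝓕 hbL hb2 (hK.costate_eq_zero hε t)
    refine ⟨β, hβ1, ?_⟩
    filter_upwards [hβ2, hab t] with ω h1 h2
    refine ⟨h1.1, ?_⟩
    rw [h2, pairing_eq hK hε, costatePairing, h1.2]
  · have h1 : 0 ≤ ∫ ω, ‖pathMap v ω - pathMap u ω‖ ^ 2 ∂P := integral_nonneg fun _ => sq_nonneg _
    have h2 := mul_nonneg hε.le h1
    linarith [hgap v hv]
  · have hvL := Admissible.isL2Process hv.1
    have h1 : 0 ≤ ∫ ω, ‖pathMap v ω - pathMap u ω‖ ^ 2 ∂P := integral_nonneg fun _ => sq_nonneg _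
    have h2 : ∫ ω, ‖pathMap v ω - pathMap u ω‖ ^ 2 ∂P ≤ 0 :=
      nonpos_of_mul_nonpos_right (by linarith [hgap v hv.1, hv.2 u hu]) hε
    have h3 := (hvL.sub huL).ae_eq_zero (by
      rw [← le_antisymm h2 h1]
      refine integral_congr_ae ?_
      filter_upwards [hvL.pathMap_sub huL] with ω hω
      rw [hω])
    filter_upwards [h3] with p hp
    exact sub_eq_zero.1 hp
  · rw [hkB] at hve
    exact hK.processEq_of_volterra hε huL hv.isL2Process (ae_prod_of_forall_ae_eq huL.1
      (ha.isL2Process.add (hK.isL2Process_volterra hε huL)).1 (ae_of_all _ hua)) hve
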